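/- Let $n\ge 1$, $m\ge 0$, $r\ge 1$, $s\ge 2r$ be integers and let $X$ be a smooth (Hausdorff, second countable) manifold of dimension $N=n+m$. Let $\mathrm{Imm}\,T^r_nX$ be the set of $r$-jets $j^r_0\gamma$ at $0$ of smooth immersions $\gamma$ of neighbourhoods of $0\in\mathbb R^n$ into $X$, with the coordinates $x^A_J(j^r_0\gamma)=\partial_J(x^A\circ\gamma)(0)$, $|J|\le r$, for each chart $\psi=(x^A)$ of $X$. Let $L^r_n$ be the group of invertible $r$-jets $a=j^r_0\alpha$ of maps $(\mathbb R^n,0)\to(\mathbb R^n,0)$, acting by $j^r_0\gamma\cdot j^r_0\alpha=j^r_0(\gamma\circ\alpha)$, and let $\rho^r_n:\mathrm{Imm}\,T^r_nX\to P^r_nX=\mathrm{Imm}\,T^r_nX/L^r_n$ be the projection. Every chart $\psi=(x^A)$ of $X$ with domain $V$, in which we write $x^i$ for $x^1,\dots,x^n$ and $x^\sigma$ for the other $m$ coordinates, gives a chart $\Phi=(x^i,y^\sigma_J)_{|J|\le r}$ of $P^r_nX$ on $\rho^r_n(W)$, where $W=\{j^r_0\gamma:\gamma(0)\in V,\ \det(\mathbf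 x)\ne 0\}$, $\mathbf x=(x^i_j)$, and $y^\sigma=x^\sigma$, $y^\sigma_{iJ}=z^j_i\,d_j y^\sigma_J$; here $z=\mathbf x^{-1}$ and $d_j$ is the formal derivative, i.e. $\partial/\partial t^j$ along prolonged immersions. On the coordinate space of order $s$ put $$D_i=\frac{\partial}{\partial x^i}+\sum_{|J|\le s-1}y^\sigma_{iJ}\frac{\partial}{\partial y^\sigma_J},\qquad E_\sigma(L)=\sum_{|J|\le r}(-1)^{|J|}D_J\frac{\partial L}{\partial y^\sigma_J},\qquad \omega^\sigma_J=dy^\sigma_J-y^\sigma_{iJ}\,dx^i\ (|J|\le s-1),$$ and $\omega^\sigma=\omega^\sigma_\emptyset$, $\theta_0=dx^1\wedge\dots\wedge dx^n$. (Sums over $J$ are over multi-indices.) A strongly contact $(n+1)$-form on $P^s_nX$ is a smooth $(n+1)$-form that in each of these charts is a finite sum of products $\xi\wedge\eta\wedge\Phi$, where each of $\xi,\eta$ is one of the $\omega^\sigma_J$ with $|J|\le s-1$ or one of the $d\omega^\sigma_I$ with $|I|=s-1$, and $\Phi$ is a smooth form. The space of these is denoted $\Omega^s_{n+1(c)}(PX)\subset\Omega^s_{n+1}(PX)$.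 Let $\mathcal L$ be a homogeneous Lagrangian, i.e. a smooth real function on $\mathrm{Imm}\,T^r_nX$ with $\mathcal L(x\cdot a)=\det(a^i_j)\,\mathcal L(x)$ for all $a\in L^r_n$. In each chart it has an associated non-homogeneous local Lagrangian: there is a smooth function $L$ on $\rho^r_n(W)$, necessarily unique, with $\mathcal L=\det(\mathbf x)\,L\circ\rho^r_n$ on $W$. Moreover: 1. Let $\psi,\bar\psi$ be two charts of $X$ and $L,\bar L$ the corresponding local Lagrangians. Then on the overlap of the two associated charts of $P^s_nX$ $$E_\sigma(L)=\mathcal J\,P^\nu_\sigma\,\bar E_\nu(\bar L),\qquad \mathcal J=\det(D_i\bar x^j),\qquad P^\nu_\sigma=\frac{\partial\bar y^\nu}{\partial y^\sigma}-\bar y^\nu_i\,\frac{\partial\bar x^i}{\partial y^\sigma}.$$ 2. There is exactly one class $[E(L)]\in\Omega^s_{n+1}(PX)/\Omega^s_{n+1(c)}(PX)$ such that, on the domain of the chart of $P^s_nX$ associated to any chart of $X$, every representative of the class differs from $E_\sigma(L)\,\omega^\sigma\wedge\theta_0$ by a strongly contact $(n+1)$-form. -/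

import Mathlib

open scoped Manifold ContDiff Topology
open Filter

set_option maxSynthPendingDepth 3

noncomputable section

namespace GrassmannBundle

/-! ### Multi-indices and iterated operators -/

/-- Multi-indices `J = (J 0, …, J (n-1))` with `|J| ≤ s`. -/
abbrev MultiIdx (n s : ℕ) : Type := {J : Fin n → ℕ // ∑ i, J i ≤ s}

instance instFintypeMultiIdx (n s : ℕ) : Fintype (MultiIdx n s) := by
  have : Finite (MultiIdx n s) := by
    refine Finite.of_injective
      (fun (J : MultiIdx n s) (i : Fin n) =>
        (⟨J.1 i, Nat.lt_succ_of_le ((Finset.single_le_sum (f := J.1)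
          (fun _ _ => Nat.zero_le _) (Finset.mem_univ i)).trans J.2)⟩ : Fin (s + 1))) ?_
    intro J K h
    apply Subtype.ext
    funext i
    exact congrArg Fin.val (congrFun h i)
  exact Fintype.ofFinite _

/-- The multi-index `{i}` of length one. -/
def unitIdx {n : ℕ} (i : Fin n) : Fin n → ℕ := Pi.single i 1

/-- The increasing sequence `j₁ ≤ … ≤ jₖ` in which each `i` occurs `J i` times. -/
def idxList {n : ℕ} (J : Fin n → ℕ) : List (Fin n) :=
  (List.finRange n).flatMap fun i => List.replicate (J i) i

/-- The composite operator `D_{j₁} ⋯ D_{jₖ}`. -/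
def opList {n : ℕ} {F : Type*} (D : Fin n → F → F) (l : List (Fin n)) (f : F) : F :=
  l.foldr D f

/-- The partial derivative `∂f/∂tⁱ`. -/
def pd {n : ℕ} (i : Fin n) (f : (Fin n → ℝ) → ℝ) : (Fin n → ℝ) → ℝ :=
  fun t => fderiv ℝ f t (Pi.single i 1)

/-! ### Regular velocities and contact elements of a manifold of dimension `n + m` -/

variable (n m : ℕ) (X : Type*) [TopologicalSpace X] [ChartedSpace (Fin (n + m) → ℝ) X]

/-- The smooth charts of `X`. -/
abbrev Chart : Type _ :=
  {ψ : OpenPartialHomeomorph X (Fin (n + m) → ℝ) //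
    ψ ∈ IsManifold.maximalAtlas 𝓘(ℝ, Fin (n + m) → ℝ) ∞ X}

/-- Smooth immersions of a neighbourhood of `0 ∈ ℝⁿ` into `X` (the values away from some
neighbourhood of `0` are irrelevant). -/
structure ImmGerm where
  toFun : (Fin n → ℝ) → X
  smooth : ∀ᶠ t in 𝓝 0, ContMDiffAt 𝓘(ℝ, Fin n → ℝ) 𝓘(ℝ, Fin (n + m) → ℝ) ∞ toFun t
  immersive : ∀ᶠ t in 𝓝 0, Function.Injective
    (mfderiv 𝓘(ℝ, Fin n → ℝ) 𝓘(ℝ, Fin (n + m) → ℝ) toFun t)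

/-- Local diffeomorphisms of `ℝⁿ` around `0` fixing `0`; their `r`-jets at `0` are the elements
of the differential group of order `r`. -/
structure DiffGerm (n : ℕ) where
  toFun : (Fin n → ℝ) → (Fin n → ℝ)
  map_zero : toFun 0 = 0
  smooth : ∀ᶠ t in 𝓝 0, ContDiffAt ℝ ∞ toFun t
  det_ne_zero : (fderiv ℝ toFun 0).det ≠ 0

variable {n m X}

/-- The reparametrisation `γ ∘ α`. -/
def ImmGerm.comp (γ : ImmGerm n m X) (α : DiffGerm n) : ImmGerm n m X where
  toFun := γ.toFun ∘ α.toFun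
  smooth := by
    have hα := α.smooth.self_of_nhds
    have hc : Tendsto α.toFun (𝓝 0) (𝓝 0) := by
      simpa [α.map_zero] using hα.continuousAt.tendsto
    filter_upwards [α.smooth, hc.eventually γ.smooth] with t h1 h2
    exact h2.comp t h1.contMDiffAt
  immersive := by
    have hα := α.smooth.self_of_nhds
    have hc : Tendsto α.toFun (𝓝 0) (𝓝 0) := by
      simpa [α.map_zero] using hα.continuousAt.tendsto
    have hdet : ∀ᶠ t in 𝓝 (0 : Fin n → ℝ), (fderiv ℝ α.toFun t).det ≠ 0 := by
      have h1 : ContinuousAt (fun t => fderiv ℝ α.toFun t) 0 :=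
        (hα.fderiv_right (m := 0) (by simp)).continuousAt
      have h2 : ContinuousAt (fun t => (fderiv ℝ α.toFun t).det) 0 :=
        ContinuousLinearMap.continuous_det.continuousAt.comp h1
      exact h2.eventually_ne α.det_ne_zero
    filter_upwards [α.smooth, hc.eventually γ.smooth, hc.eventually γ.immersive, hdet]
      with t h1 h2 h3 h4
    have hd1 : MDifferentiableAt 𝓘(ℝ, Fin n → ℝ) 𝓘(ℝ, Fin n → ℝ) α.toFun t :=
      (h1.differentiableAt (by simp)).mdifferentiableAt
    rw [mfderiv_comp t (h2.mdifferentiableAt (by simp)) hd1, mfderiv_eq_fderiv]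
    have h5 : Function.Injective (fderiv ℝ α.toFun t) := by
      have := LinearMap.equivOfDetNeZero (fderiv ℝ α.toFun t : (Fin n → ℝ) →ₗ[ℝ] (Fin n → ℝ)) h4
      exact (LinearMap.equivOfDetNeZero
        (fderiv ℝ α.toFun t : (Fin n → ℝ) →ₗ[ℝ] (Fin n → ℝ)) h4).injective
    exact h3.comp h5

/-- The coordinate expression `x^A ∘ γ`. -/
def coordFun (ψ : Chart n m X) (γ : ImmGerm n m X) (A : Fin (n + m)) : (Fin n → ℝ) → ℝ :=
  fun t => ψ.1 (γ.toFun t) A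

/-- Equality of `r`-jets at `0`: same value and, in the charts at this value, same partial
derivatives up to order `r`. -/
def velSetoid (n m : ℕ) (X : Type*) [TopologicalSpace X] [ChartedSpace (Fin (n + m) → ℝ) X]
    (r : ℕ) : Setoid (ImmGerm n m X) where
  r γ δ := γ.toFun 0 = δ.toFun 0 ∧ ∀ ψ : Chart n m X, γ.toFun 0 ∈ ψ.1.source →
    ∀ (A : Fin (n + m)) (l : List (Fin n)), l.length ≤ r →
      opList pd l (coordFun ψ γ A) 0 = opList pd l (coordFun ψ δ A) 0
  iseqv :=
    { refl := fun _ => ⟨rfl, fun _ _ _ _ _ => rfl⟩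
      symm := fun h => ⟨h.1.symm, fun ψ hψ A l hl => (h.2 ψ (h.1 ▸ hψ) A l hl).symm⟩
      trans := fun h h' => ⟨h.1.trans h'.1, fun ψ hψ A l hl =>
        (h.2 ψ hψ A l hl).trans (h'.2 ψ (h.1 ▸ hψ) A l hl)⟩ }

/-- The regular `(r,n)`-velocities `Imm Tʳₙ X`. -/
def ImmVel (n m : ℕ) (X : Type*) [TopologicalSpace X] [ChartedSpace (Fin (n + m) → ℝ) X]
    (r : ℕ) : Type _ := Quotient (velSetoid n m X r)

/-- The velocity `jʳ₀γ`. -/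
def jet (r : ℕ) (γ : ImmGerm n m X) : ImmVel n m X r := Quotient.mk (velSetoid n m X r) γ

/-- The Grassmann bundle `Pʳₙ X`: regular velocities modulo `jʳ₀γ ∼ jʳ₀γ · jʳ₀α = jʳ₀(γ ∘ α)`. -/
def Grass (n m : ℕ) (X : Type*) [TopologicalSpace X] [ChartedSpace (Fin (n + m) → ℝ) X]
    (r : ℕ) : Type _ :=
  Quot fun v w : ImmVel n m X r =>
    ∃ (γ : ImmGerm n m X) (α : DiffGerm n), v = jet r γ ∧ w = jet r (γ.comp α)

/-- The canonical projection `ρʳₙ`. -/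
def proj {r : ℕ} (v : ImmVel n m X r) : Grass n m X r := Quot.mk _ v

/-! ### Charts on the Grassmann bundle -/

/-- Points `(xⁱ, y^σ_J)`, `|J| ≤ s`, of the coordinate space. -/
abbrev Coords (n m s : ℕ) : Type := (Fin n → ℝ) × (MultiIdx n s → Fin m → ℝ)

/-- The coordinate `y^σ_J`, read as `0` when `|J| > s`. -/
def yCoord {n m s : ℕ} (e : Coords n m s) (J : Fin n → ℕ) (σ : Fin m) : ℝ :=
  if h : ∑ i, J i ≤ s then e.2 ⟨J, h⟩ σ else 0

/-- The projection from order `s` to order `r`, for `r ≤ s`. -/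
def trunc {n m s : ℕ} (r : ℕ) (e : Coords n m s) : Coords n m r :=
  (e.1, fun J σ => yCoord e J.1 σ)

/-- The matrix `𝐱 = (xⁱ_j)`, `xⁱ_j = ∂xⁱ/∂tʲ`, along `γ`, built from the first `n` coordinates. -/
def jac (ψ : Chart n m X) (γ : ImmGerm n m X) (t : Fin n → ℝ) : Matrix (Fin n) (Fin n) ℝ :=
  Matrix.of fun i j => pd j (coordFun ψ γ (Fin.castAdd m i)) t

/-- The operator `z^j_i d_j` along `γ`, where `z = 𝐱⁻¹`; along the prolongation of `γ` the formal
derivative `d_j` is `∂/∂tʲ`. -/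
def zd (ψ : Chart n m X) (γ : ImmGerm n m X) (i : Fin n) (f : (Fin n → ℝ) → ℝ) :
    (Fin n → ℝ) → ℝ :=
  fun t => ∑ j, (jac ψ γ t)⁻¹ j i * pd j f t

/-- `γ` meets the domain of the adapted chart: `γ(0)` lies in the domain of `ψ` and
`det (xⁱ_j) ≠ 0`. -/
def InDom (ψ : Chart n m X) (γ : ImmGerm n m X) : Prop :=
  γ.toFun 0 ∈ ψ.1.source ∧ (jac ψ γ 0).det ≠ 0

/-- The adapted coordinates `(xⁱ, y^σ_J)` of `[jˢ₀γ]`: `y^σ = x^{n+σ}` and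
`y^σ_{iJ} = z^j_i d_j y^σ_J`. -/
def adapted (s : ℕ) (ψ : Chart n m X) (γ : ImmGerm n m X) : Coords n m s :=
  (fun i => coordFun ψ γ (Fin.castAdd m i) 0,
   fun J σ => opList (zd ψ γ) (idxList J.1) (coordFun ψ γ (Fin.natAdd n σ)) 0)

/-- The domain `ρ(W)` of the chart of `Pˢₙ X` associated to `ψ`. -/
def chartDom (s : ℕ) (ψ : Chart n m X) : Set (Grass n m X s) :=
  {p | ∃ γ, InDom ψ γ ∧ proj (jet s γ) = p}

open Classical in
/-- The chart `(xⁱ, y^σ_J)` of `Pˢₙ X` associated to `ψ`, `0` off its domain; the adapted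
coordinates do not depend on the representative (for `s ≥ 1`). -/
def chart (s : ℕ) (ψ : Chart n m X) (p : Grass n m X s) : Coords n m s :=
  if h : ∃ γ, InDom ψ γ ∧ proj (jet s γ) = p then adapted s ψ h.choose else 0

/-- The open image of the chart. -/
def chartTarget (s : ℕ) (ψ : Chart n m X) : Set (Coords n m s) := chart s ψ '' chartDom s ψ

/-- The change of coordinates `Φ̄ ∘ Φ⁻¹`, `Φ` and `Φ̄` being the charts of `ψ` and `ψ'`. -/
def transition (s : ℕ) (ψ ψ' : Chart n m X) (e : Coords n m s) : Coords n m s :=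
  open Classical in
  if h : ∃ p ∈ chartDom s ψ, chart s ψ p = e then chart s ψ' h.choose else 0

/-! ### Lagrangians -/

/-- The coordinates `x^A_J`, `|J| ≤ r`, of a velocity, from any representative. -/
def velCoord (r : ℕ) (ψ : Chart n m X) (γ : ImmGerm n m X) :
    MultiIdx n r → Fin (n + m) → ℝ :=
  fun J A => opList pd (idxList J.1) (coordFun ψ γ A) 0

/-- Smoothness of a function on `Imm Tʳₙ X`, in the associated charts `(x^A_J)`. -/
def SmoothOnVel {r : ℕ} (𝓛 : ImmVel n m X r → ℝ) : Prop :=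
  ∀ ψ : Chart n m X, ∃ f : (MultiIdx n r → Fin (n + m) → ℝ) → ℝ,
    ContDiffOn ℝ ∞ f (velCoord r ψ '' {γ | γ.toFun 0 ∈ ψ.1.source}) ∧
    ∀ γ : ImmGerm n m X, γ.toFun 0 ∈ ψ.1.source → 𝓛 (jet r γ) = f (velCoord r ψ γ)

/-- Homogeneous Lagrangians: smooth, with `𝓛(x · a) = det(a) 𝓛(x)` for all `a`. -/
structure IsHomogeneousLagrangian {r : ℕ} (𝓛 : ImmVel n m X r → ℝ) : Prop where
  smooth : SmoothOnVel 𝓛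
  homogeneous : ∀ (γ : ImmGerm n m X) (α : DiffGerm n),
    𝓛 (jet r (γ.comp α)) = (fderiv ℝ α.toFun 0).det * 𝓛 (jet r γ)

/-- `L` is the coordinate expression of the non-homogeneous local Lagrangian associated to `𝓛`:
`𝓛 = det(𝐱) L ∘ ρ`. -/
def IsLocalLagrangian {r : ℕ} (𝓛 : ImmVel n m X r → ℝ) (ψ : Chart n m X)
    (L : Coords n m r → ℝ) : Prop :=
  ∀ γ : ImmGerm n m X, InDom ψ γ →
    𝓛 (jet r γ) = (jac ψ γ 0).det * L (chart r ψ (proj (jet r γ)))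

/-! ### Calculus in a chart -/

section Local

variable {s : ℕ}

/-- The coordinate vector `∂/∂y^σ_J`, for `|J| ≤ s`. -/
def yVec (J : MultiIdx n s) (σ : Fin m) : Coords n m s := (0, Pi.single J (Pi.single σ 1))

/-- The multi-index `∅`. -/
def zeroIdx (n s : ℕ) : MultiIdx n s := ⟨0, by simp⟩

/-- The vector field `∂/∂xⁱ + ∑_{|J| ≤ s-1} y^σ_{iJ} ∂/∂y^σ_J`. -/
def totalVec (i : Fin n) (e : Coords n m s) : Coords n m s :=
  (Pi.single i 1, fun J σ => yCoord e (J.1 + unitIdx i) σ)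

/-- The total derivative `D_i`. -/
def totalD (i : Fin n) (f : Coords n m s → ℝ) : Coords n m s → ℝ :=
  fun e => fderiv ℝ f e (totalVec i e)

/-- The Euler–Lagrange expression `E_σ(L) = ∑_{|J| ≤ r} (-1)^{|J|} D_J (∂L/∂y^σ_J)`
of a Lagrangian of order `r`, as a function of the coordinates of order `s`. -/
def eulerLagrange (s : ℕ) {r : ℕ} (L : Coords n m r → ℝ) (σ : Fin m) : Coords n m s → ℝ :=
  fun e => ∑ J : MultiIdx n r, (-1 : ℝ) ^ (∑ i, J.1 i) *
    opList totalD (idxList J.1) (fun e' => fderiv ℝ L (trunc r e') (yVec J σ)) e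

/-- `𝒥 = det (D_i x̄ʲ)`, the barred coordinates being those of `ψ'`. -/
def jacobianDet (s : ℕ) (ψ ψ' : Chart n m X) (e : Coords n m s) : ℝ :=
  (Matrix.of fun i j : Fin n => totalD i (fun e' => (transition s ψ ψ' e').1 j) e).det

/-- `P^ν_σ = ∂ȳ^ν/∂y^σ - ȳ^ν_i ∂x̄ⁱ/∂y^σ`. -/
def pMatrix (s : ℕ) (ψ ψ' : Chart n m X) (ν σ : Fin m) (e : Coords n m s) : ℝ :=
  fderiv ℝ (fun e' => yCoord (transition s ψ ψ' e') 0 ν) e (yVec (zeroIdx n s) σ) -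
    ∑ i : Fin n, yCoord (transition s ψ ψ' e) (unitIdx i) ν *
      fderiv ℝ (fun e' => (transition s ψ ψ' e').1 i) e (yVec (zeroIdx n s) σ)

/-! ### Differential forms in a chart -/

/-- Fields of `q`-covectors on the coordinate space. -/
abbrev Form (n m s q : ℕ) : Type := Coords n m s → (Coords n m s) [⋀^Fin q]→ₗ[ℝ] ℝ

/-- Smoothness of a form on `U`. -/
def SmoothForm {q : ℕ} (α : Form n m s q) (U : Set (Coords n m s)) : Prop :=
  ∀ v : Fin q → Coords n m s, ContDiffOn ℝ ∞ (fun e => α e v) U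

/-- The wedge product, with `(dx ∧ dy)(v, w) = dx(v) dy(w) - dx(w) dy(v)`. -/
def wedge {a b : ℕ} (α : Form n m s a) (β : Form n m s b) : Form n m s (a + b) := fun e =>
  ((LinearMap.mul' ℝ ℝ).compAlternatingMap ((α e).domCoprod (β e))).domDomCongr finSumFinEquiv

/-- Transport of the degree along an equality. -/
def castForm {a b : ℕ} (h : a = b) (α : Form n m s a) : Form n m s b := fun e =>
  (α e).domDomCongr (finCongr h)

/-- A field of linear forms as a `1`-form. -/
def oneForm (f : Coords n m s → Coords n m s →ₗ[ℝ] ℝ) : Form n m s 1 := fun e =>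
  AlternatingMap.ofSubsingleton ℝ (Coords n m s) ℝ (0 : Fin 1) (f e)

/-- `dxⁱ`. -/
def dx (i : Fin n) : Form n m s 1 :=
  oneForm fun _ => (LinearMap.proj i).comp (LinearMap.fst ℝ _ _)

/-- `dy^σ_J`, for `|J| ≤ s`. -/
def dy (J : MultiIdx n s) (σ : Fin m) : Form n m s 1 :=
  oneForm fun _ => (LinearMap.proj (R := ℝ) (φ := fun _ : Fin m => ℝ) σ).comp
    ((LinearMap.proj (R := ℝ) (φ := fun _ : MultiIdx n s => Fin m → ℝ) J).comp
      (LinearMap.snd ℝ _ _))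

/-- `J ↦ iJ` for `|J| < s`. -/
def addIdx (i : Fin n) (J : Fin n → ℕ) (h : ∑ k, J k < s) : MultiIdx n s :=
  ⟨J + unitIdx i, by
    simp only [Pi.add_apply, unitIdx, Finset.sum_add_distrib, Finset.sum_pi_single',
      Finset.mem_univ, if_true]
    omega⟩

/-- The contact form `ω^σ_J = dy^σ_J - y^σ_{iJ} dxⁱ`, for `|J| < s`. -/
def omega (J : Fin n → ℕ) (h : ∑ k, J k < s) (σ : Fin m) : Form n m s 1 := fun e =>
  dy ⟨J, h.le⟩ σ e - ∑ i : Fin n, yCoord e (J + unitIdx i) σ • dx i e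

/-- The exterior derivative `dω^σ_J = - dy^σ_{iJ} ∧ dxⁱ`, for `|J| < s`. -/
def dOmega (J : Fin n → ℕ) (h : ∑ k, J k < s) (σ : Fin m) : Form n m s 2 :=
  -∑ i : Fin n, wedge (dy (addIdx i J h) σ) (dx i)

/-- `θ₀ = dx¹ ∧ ⋯ ∧ dxⁿ`. -/
def theta (n m s : ℕ) : Form n m s n := fun _ =>
  (Matrix.detRowAlternating : (Fin n → ℝ) [⋀^Fin n]→ₗ[ℝ] ℝ).compLinearMap (LinearMap.fst ℝ _ _)

/-- The generators `ω^σ_J`, `|J| ≤ s-1`, and `dω^σ_I`, `|I| = s-1`, with their degrees. -/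
inductive IsContactGenerator : (a : ℕ) → Form n m s a → Prop
  | omega (J : Fin n → ℕ) (h : ∑ k, J k < s) (σ : Fin m) : IsContactGenerator 1 (omega J h σ)
  | dOmega (I : Fin n → ℕ) (h : ∑ k, I k < s) (hI : ∑ k, I k + 1 = s) (σ : Fin m) :
      IsContactGenerator 2 (dOmega I h σ)

/-- The products `ξ ∧ η ∧ Φ` of degree `n + 1` of two contact generators and a form `Φ`
smooth on `U`. -/
def contactProducts (U : Set (Coords n m s)) : Set (Form n m s (n + 1)) :=
  {β | ∃ (a b k : ℕ) (h : a + b + k = n + 1) (ξ : Form n m s a) (η : Form n m s b)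
    (Φ : Form n m s k), IsContactGenerator a ξ ∧ IsContactGenerator b η ∧ SmoothForm Φ U ∧
      β = castForm h (wedge (wedge ξ η) Φ)}

/-- Strongly contact `(n+1)`-forms on `U`: those which are, on `U`, finite sums of
products of two contact generators with a smooth form. -/
def contactOn (U : Set (Coords n m s)) : Submodule ℝ (Form n m s (n + 1)) where
  carrier := {α | ∃ β ∈ Submodule.span ℝ (contactProducts U), Set.EqOn α β U}
  zero_mem' := ⟨0, Submodule.zero_mem _, fun _ _ => rfl⟩
  add_mem' := by
    rintro α α' ⟨β, hβ, h⟩ ⟨β', hβ', h'⟩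
    exact ⟨β + β', Submodule.add_mem _ hβ hβ', fun e he => by simp [h he, h' he]⟩
  smul_mem' := by
    rintro c α ⟨β, hβ, h⟩
    exact ⟨c • β, Submodule.smul_mem _ c hβ, fun e he => by simp [h he]⟩

/-- The local form `E_σ(L) ω^σ ∧ θ₀`. -/
def eulerLagrangeForm (s : ℕ) (hs : 0 < s) {r : ℕ} (L : Coords n m r → ℝ) :
    Form n m s (n + 1) := fun e =>
  ∑ σ : Fin m, eulerLagrange s L σ e •
    castForm (Nat.add_comm 1 n) (wedge (omega 0 (by simpa using hs) σ) (theta n m s)) e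

end Local

/-! ### Differential forms on the Grassmann bundle -/

/-- Smooth `q`-forms on `Pˢₙ X`: families of smooth forms on the images of the charts (set to `0`
outside the images) that are related by pull-back along the changes of coordinates. -/
def grassForms (n m : ℕ) (X : Type*) [TopologicalSpace X] [ChartedSpace (Fin (n + m) → ℝ) X]
    (s q : ℕ) : Submodule ℝ (Chart n m X → Form n m s q) where
  carrier := {α |
    (∀ ψ, SmoothForm (α ψ) (chartTarget s ψ)) ∧
    (∀ ψ, ∀ e ∉ chartTarget s ψ, α ψ e = 0) ∧
    ∀ ψ ψ', ∀ p ∈ chartDom s ψ ∩ chartDom s ψ',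
      α ψ (chart s ψ p) = (α ψ' (chart s ψ' p)).compLinearMap
        (fderiv ℝ (transition s ψ ψ') (chart s ψ p) : Coords n m s →ₗ[ℝ] Coords n m s)}
  zero_mem' := by
    refine ⟨fun _ _ => contDiffOn_const, fun _ _ _ => rfl, fun _ _ _ _ => ?_⟩
    simp
  add_mem' := by
    rintro α β ⟨h1, h2, h3⟩ ⟨k1, k2, k3⟩
    refine ⟨fun ψ v => (h1 ψ v).add (k1 ψ v), fun ψ e he => ?_, fun ψ ψ' p hp => ?_⟩
    · simp [h2 ψ e he, k2 ψ e he]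
    · simp [h3 ψ ψ' p hp, k3 ψ ψ' p hp]
  smul_mem' := by
    rintro c α ⟨h1, h2, h3⟩
    refine ⟨fun ψ v => (h1 ψ v).const_smul c, fun ψ e he => ?_, fun ψ ψ' p hp => ?_⟩
    · simp [h2 ψ e he]
    · simp only [Pi.smul_apply]
      rw [h3 ψ ψ' p hp]
      rfl

/-- The strongly contact `(n+1)`-forms among the `(n+1)`-forms on `Pˢₙ X`. -/
def contactForms (n m : ℕ) (X : Type*) [TopologicalSpace X] [ChartedSpace (Fin (n + m) → ℝ) X]
    (s : ℕ) : Submodule ℝ (grassForms n m X s (n + 1)) where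
  carrier := {α | ∀ ψ, α.1 ψ ∈ contactOn (chartTarget s ψ)}
  zero_mem' := fun _ => Submodule.zero_mem _
  add_mem' := fun hα hβ ψ => Submodule.add_mem _ (hα ψ) (hβ ψ)
  smul_mem' := fun c _ hα ψ => Submodule.smul_mem _ c (hα ψ)

end GrassmannBundle

end

open GrassmannBundle

/-! The local Lagrangian is the restriction of `𝓛` to graphs. A germ `γ` with `det 𝐱 ≠ 0` can be
reparametrised by the local inverse of `t ↦ x(γ(t)) - x(γ(0))`. It then has the same jet as the
polynomial graph with the same adapted coordinates (`InDom.exists_normalisation`). Homogeneity gives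
`𝓛 = det(𝐱) L`, and `L` is smooth because the velocity coordinates of that graph are affine in its
adapted coordinates.

The transformation law is invariance of the first variation. The recurring tool is a frame: the
vector fields dual to functions `xⁱ` inside the span of constant directions `vⱼ`. It describes at
once `z^j_i d_j` along a germ, the same operators on a whole family of germs, and ordinary partial
derivatives. Frame fields commute (`FrameOn.comm`), are natural under maps (`frame_comp`) and are
divergence free for the density `det (∂xⁱ/∂vⱼ)` (`FrameOn.piola`, `FrameOn.integral_frame`). On
prolongations, total derivatives become frame derivatives (`FrameOn.opList_comp_prolong`). This
holds as long as the order stays at most `s`, which is why `s ≥ 2r` is required.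

Given a point `e` of the overlap, perturb its polynomial graph by `ε η` in the direction `y^σ`.
Evaluating `𝓛` on one germ in both charts gives `L = det(D x̄) L̄` along the perturbed graphs
(`lagrangian_varFam`). The `ε`-derivative of the right side is a sum of frame derivatives of the
vertical variations `η P^ν_σ`, up to a divergence (`FrameOn.dirDeriv_density`). Integrating by parts
for compactly supported `η` leaves the Euler–Lagrange expressions. The fundamental lemma gives the
law along the graph, and its value at parameter `0` is the law at `e`.

For the class, `ω^σ` pulls back exactly with the matrix `P`, but `θ₀` acquires the factor `𝒥` only
modulo contact forms. A Riemannian metric on `X` repairs this. Orthogonal projection onto the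
tangent `n`-plane of a contact element, read in the basis that projects to the standard one, is a
map to `ℝⁿ`. Its determinant form `θ_G` satisfies the pull-back law with factor `𝒥` exactly
(`retractVol_comp_fderiv_transition`), so `E_σ ω^σ ∧ θ_G` is a global form. On the common kernel of
the `ω^τ` the forms `θ_G` and `θ₀` coincide. Hence their difference lies in the ideal of the `ω^τ`,
and `ω^σ ∧ (θ_G - θ₀)` is a sum of products `ω^σ ∧ ω^τ ∧ Φ` (`oneMul_mem_contactOn`). Uniqueness is
immediate: two classes with the property differ by a strongly contact form in every chart. -/

namespace GrassmannBundle

noncomputable section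

/-! ### Frames of vector fields dual to coordinate functions -/

section Frame

variable {E : Type*} [NormedAddCommGroup E] [NormedSpace ℝ E]
  {E₁ : Type*} [NormedAddCommGroup E₁] [NormedSpace ℝ E₁] {n : ℕ}

/-- The derivative of `f` in the constant direction `w`. -/
def dirDeriv (w : E) (f : E → ℝ) : E → ℝ := fun e => fderiv ℝ f e w

/-- The matrix of derivatives of the functions `x i` in the directions `v j`. -/
def frameJac (v : Fin n → E) (x : Fin n → E → ℝ) (e : E) : Matrix (Fin n) (Fin n) ℝ :=
  Matrix.of fun i j => fderiv ℝ (x i) e (v j)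

/-- The vector fields in the span of the `v j` that are dual to the functions `x i`. -/
def frameVec (v : Fin n → E) (x : Fin n → E → ℝ) (i : Fin n) (e : E) : E :=
  ∑ j, (frameJac v x e)⁻¹ j i • v j

/-- Differentiation along `frameVec v x i`. -/
def frame (v : Fin n → E) (x : Fin n → E → ℝ) (i : Fin n) (f : E → ℝ) : E → ℝ :=
  fun e => fderiv ℝ f e (frameVec v x i e)

lemma frame_eq_sum (v : Fin n → E) (x : Fin n → E → ℝ) (i : Fin n) (f : E → ℝ) (e : E) :
    frame v x i f e = ∑ j, (frameJac v x e)⁻¹ j i * dirDeriv (v j) f e := by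
  simp [frame, frameVec, dirDeriv, map_sum]

/-- The functions `x i` are smooth on the open set `O` and independent on the span of the `v j`. -/
structure FrameOn (O : Set E) (v : Fin n → E) (x : Fin n → E → ℝ) : Prop where
  isOpen : IsOpen O
  smooth : ∀ i, ContDiffOn ℝ ∞ (x i) O
  det_ne : ∀ e ∈ O, (frameJac v x e).det ≠ 0

lemma contDiffOn_dirDeriv {O : Set E} (hO : IsOpen O) {f : E → ℝ} (hf : ContDiffOn ℝ ∞ f O)
    (w : E) : ContDiffOn ℝ ∞ (dirDeriv w f) O :=
  (hf.fderiv_of_isOpen hO (m := ∞) (by simp)).clm_apply contDiffOn_const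

lemma differentiableAt_of_contDiffOn {F : Type*} [NormedAddCommGroup F] [NormedSpace ℝ F]
    {O : Set E} (hO : IsOpen O) {f : E → F} (hf : ContDiffOn ℝ ∞ f O) {e : E} (he : e ∈ O) :
    DifferentiableAt ℝ f e :=
  (hf.contDiffAt (hO.mem_nhds he)).differentiableAt (by simp)

lemma dirDeriv_comm {O : Set E} (hO : IsOpen O) {f : E → ℝ} (hf : ContDiffOn ℝ ∞ f O)
    (w u : E) {e : E} (he : e ∈ O) :
    dirDeriv w (dirDeriv u f) e = dirDeriv u (dirDeriv w f) e := by
  have h1 : DifferentiableAt ℝ (fderiv ℝ f) e :=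
    differentiableAt_of_contDiffOn hO (hf.fderiv_of_isOpen hO (m := ∞) (by simp)) he
  have h2 : ∀ a b : E, dirDeriv a (dirDeriv b f) e = fderiv ℝ (fderiv ℝ f) e a b := by
    intro a b
    have := (h1.hasFDerivAt.clm_apply (hasFDerivAt_const b e)).fderiv
    change fderiv ℝ (fun e => fderiv ℝ f e b) e a = _
    rw [this]
    simp
  rw [h2, h2]
  have h3 := (hf.contDiffAt (hO.mem_nhds he)).isSymmSndFDerivAt
    (by simp only [minSmoothness_of_isRCLikeNormedField]; exact ENat.LEInfty.out)
  exact h3 w u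

lemma dirDeriv_congr {O : Set E} (hO : IsOpen O) {f g : E → ℝ} (h : Set.EqOn f g O) (w : E) :
    Set.EqOn (dirDeriv w f) (dirDeriv w g) O := by
  intro e he
  have : f =ᶠ[𝓝 e] g := Filter.eventuallyEq_of_mem (hO.mem_nhds he) h
  simp only [dirDeriv, this.fderiv_eq]

lemma dirDeriv_sum {ι : Type*} (s : Finset ι) {f : ι → E → ℝ} {e : E}
    (h : ∀ i ∈ s, DifferentiableAt ℝ (f i) e) (w : E) :
    dirDeriv w (fun e => ∑ i ∈ s, f i e) e = ∑ i ∈ s, dirDeriv w (f i) e := by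
  simp only [dirDeriv]
  rw [fderiv_fun_sum h]
  simp

lemma dirDeriv_mul {f g : E → ℝ} {e : E} (hf : DifferentiableAt ℝ f e)
    (hg : DifferentiableAt ℝ g e) (w : E) :
    dirDeriv w (fun e => f e * g e) e = dirDeriv w f e * g e + f e * dirDeriv w g e := by
  simp only [dirDeriv]
  rw [fderiv_fun_mul hf hg]
  simp
  ring

lemma contDiffOn_det {ι : Type*} [Fintype ι] [DecidableEq ι] {O : Set E} {k : WithTop ℕ∞}
    {M : E → Matrix ι ι ℝ} (h : ∀ i j, ContDiffOn ℝ k (fun e => M e i j) O) :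
    ContDiffOn ℝ k (fun e => (M e).det) O := by
  simp only [Matrix.det_apply, Units.smul_def, zsmul_eq_mul]
  refine ContDiffOn.sum fun σ _ => contDiffOn_const.mul ?_
  exact contDiffOn_prod fun i _ => h _ _

/-- Cramer's rule: an entry of the inverse is a cofactor divided by the determinant, and the
cofactor is the determinant of the matrix with one row made constant. -/
lemma contDiffOn_inv_apply {ι : Type*} [Fintype ι] [DecidableEq ι] {O : Set E} {k : WithTop ℕ∞}
    {M : E → Matrix ι ι ℝ} (h : ∀ i j, ContDiffOn ℝ k (fun e => M e i j) O)
    (hd : ∀ e ∈ O, (M e).det ≠ 0) (i j : ι) :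
    ContDiffOn ℝ k (fun e => (M e)⁻¹ i j) O := by
  simp only [Matrix.inv_def, Ring.inverse_eq_inv, Matrix.smul_apply, smul_eq_mul,
    Matrix.adjugate_apply]
  refine ((contDiffOn_det h).inv hd).mul (contDiffOn_det fun a b => ?_)
  by_cases hb : a = j
  · subst hb
    simpa using contDiffOn_const
  · simpa [Matrix.updateRow_ne hb] using h a b

variable {O : Set E} {v : Fin n → E} {x : Fin n → E → ℝ}

lemma FrameOn.jac_smooth (h : FrameOn O v x) (i j : Fin n) :
    ContDiffOn ℝ ∞ (fun e => frameJac v x e i j) O :=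
  contDiffOn_dirDeriv h.isOpen (h.smooth i) (v j)

lemma FrameOn.inv_smooth (h : FrameOn O v x) (i j : Fin n) :
    ContDiffOn ℝ ∞ (fun e => (frameJac v x e)⁻¹ i j) O :=
  contDiffOn_inv_apply h.jac_smooth h.det_ne i j

lemma FrameOn.contDiffOn (h : FrameOn O v x) {f : E → ℝ} (hf : ContDiffOn ℝ ∞ f O) (i : Fin n) :
    ContDiffOn ℝ ∞ (frame v x i f) O := by
  have : frame v x i f = fun e => ∑ j, (frameJac v x e)⁻¹ j i * dirDeriv (v j) f e :=
    funext fun e => frame_eq_sum v x i f e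
  rw [this]
  exact ContDiffOn.sum fun j _ => (h.inv_smooth j i).mul (contDiffOn_dirDeriv h.isOpen hf _)

lemma frame_congr (hO : IsOpen O) (i : Fin n) {f g : E → ℝ} (hfg : Set.EqOn f g O) :
    Set.EqOn (frame v x i f) (frame v x i g) O := by
  intro e he
  have : f =ᶠ[𝓝 e] g := Filter.eventuallyEq_of_mem (hO.mem_nhds he) hfg
  simp only [frame, this.fderiv_eq]

lemma FrameOn.inv_mul (h : FrameOn O v x) {e : E} (he : e ∈ O) :
    (frameJac v x e)⁻¹ * frameJac v x e = 1 :=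
  Matrix.nonsing_inv_mul _ (isUnit_iff_ne_zero.mpr (h.det_ne e he))

lemma FrameOn.mul_inv (h : FrameOn O v x) {e : E} (he : e ∈ O) :
    frameJac v x e * (frameJac v x e)⁻¹ = 1 :=
  Matrix.mul_nonsing_inv _ (isUnit_iff_ne_zero.mpr (h.det_ne e he))

lemma FrameOn.frame_coord (h : FrameOn O v x) {e : E} (he : e ∈ O) (i k : Fin n) :
    frame v x i (x k) e = if k = i then 1 else 0 := by
  have := congrFun (congrFun (h.mul_inv he) k) i
  rw [Matrix.one_apply, Matrix.mul_apply] at this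
  rw [frame_eq_sum, ← this]
  exact Finset.sum_congr rfl fun j _ => mul_comm _ _

/-- Differentiating `Z J = 1` gives `DZ = -Z (DJ) Z`. Symmetry of second derivatives moves `w`
inside, so that `(DJ) Z` becomes a frame derivative of `dirDeriv w (x k)`. -/
lemma FrameOn.dirDeriv_inv (h : FrameOn O v x) (w : E) {e : E} (he : e ∈ O) (j i : Fin n) :
    dirDeriv w (fun e => (frameJac v x e)⁻¹ j i) e =
      -∑ k, (frameJac v x e)⁻¹ j k * frame v x i (dirDeriv w (x k)) e := by
  set Z : E → Matrix (Fin n) (Fin n) ℝ := fun e => (frameJac v x e)⁻¹ with hZ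
  set J : E → Matrix (Fin n) (Fin n) ℝ := fun e => frameJac v x e with hJ
  have dZ : ∀ a b, DifferentiableAt ℝ (fun e => Z e a b) e := fun a b =>
    differentiableAt_of_contDiffOn h.isOpen (h.inv_smooth a b) he
  have dJ : ∀ a b, DifferentiableAt ℝ (fun e => J e a b) e := fun a b =>
    differentiableAt_of_contDiffOn h.isOpen (h.jac_smooth a b) he
  let DZ : Matrix (Fin n) (Fin n) ℝ := Matrix.of fun a b => dirDeriv w (fun e => Z e a b) e
  let DJ : Matrix (Fin n) (Fin n) ℝ := Matrix.of fun a b => dirDeriv w (fun e => J e a b) e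
  have key : DZ * J e + Z e * DJ = 0 := by
    ext a b
    have h1 : Set.EqOn (fun e => ∑ k, Z e a k * J e k b)
        (fun _ => (1 : Matrix (Fin n) (Fin n) ℝ) a b) O := by
      intro e' he'
      have := congrFun (congrFun (h.inv_mul he') a) b
      rw [Matrix.mul_apply] at this
      exact this
    have h2 := dirDeriv_congr h.isOpen h1 w he
    rw [dirDeriv_sum _ (fun k _ => (dZ a k).fun_mul (dJ k b))] at h2
    simp only [dirDeriv_mul (dZ a _) (dJ _ b), Finset.sum_add_distrib] at h2
    simp only [Matrix.add_apply, Matrix.mul_apply, Matrix.zero_apply, DZ, DJ, Matrix.of_apply]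
    rw [h2]
    simp [dirDeriv]
  have h3 : DZ = -(Z e * DJ * Z e) := by
    have h4 : DZ * J e * Z e + Z e * DJ * Z e = 0 := by
      rw [← Matrix.add_mul, key, Matrix.zero_mul]
    rw [Matrix.mul_assoc, h.mul_inv he, Matrix.mul_one] at h4
    exact eq_neg_of_add_eq_zero_left h4
  have h5 : dirDeriv w (fun e => Z e j i) e = DZ j i := rfl
  rw [h5, h3, Matrix.neg_apply, Matrix.mul_assoc, Matrix.mul_apply]
  congr 1
  refine Finset.sum_congr rfl fun k _ => ?_
  rw [frame_eq_sum, Matrix.mul_apply]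
  congr 1
  refine Finset.sum_congr rfl fun b _ => ?_
  rw [mul_comm]
  congr 1
  exact dirDeriv_comm h.isOpen (h.smooth k) w (v b) he

/-- The commutator of a constant field with a frame field: the correction records how the
coordinates `x k` themselves move along `w`. Commutation of frames, the divergence identity and the
first variation all rest on it. -/
lemma FrameOn.dirDeriv_frame (h : FrameOn O v x) {f : E → ℝ} (hf : ContDiffOn ℝ ∞ f O) (w : E)
    (i : Fin n) {e : E} (he : e ∈ O) :
    dirDeriv w (frame v x i f) e = frame v x i (dirDeriv w f) e -
      ∑ k, frame v x i (dirDeriv w (x k)) e * frame v x k f e := by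
  have h0 : frame v x i f = fun e => ∑ j, (frameJac v x e)⁻¹ j i * dirDeriv (v j) f e :=
    funext fun e => frame_eq_sum v x i f e
  have dZ : ∀ a b, DifferentiableAt ℝ (fun e => (frameJac v x e)⁻¹ a b) e := fun a b =>
    differentiableAt_of_contDiffOn h.isOpen (h.inv_smooth a b) he
  have df : ∀ j, DifferentiableAt ℝ (dirDeriv (v j) f) e := fun j =>
    differentiableAt_of_contDiffOn h.isOpen (contDiffOn_dirDeriv h.isOpen hf _) he
  rw [h0, dirDeriv_sum _ (fun j _ => (dZ j i).fun_mul (df j))]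
  simp only [dirDeriv_mul (dZ _ i) (df _), Finset.sum_add_distrib, h.dirDeriv_inv w he]
  rw [add_comm, sub_eq_add_neg]
  congr 1
  · rw [frame_eq_sum]
    exact Finset.sum_congr rfl fun j _ => by rw [dirDeriv_comm h.isOpen hf w (v j) he]
  · simp only [neg_mul, Finset.sum_neg_distrib, Finset.sum_mul]
    rw [Finset.sum_comm]
    congr 1
    refine Finset.sum_congr rfl fun k _ => ?_
    rw [frame_eq_sum v x k f, Finset.mul_sum]
    exact Finset.sum_congr rfl fun j _ => by ring

/-- Expanding one order of composition leaves only second derivatives contracted with two columns of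
the inverse Jacobian. The result is symmetric in `i` and `k`, because second derivatives are. -/
lemma FrameOn.comm (h : FrameOn O v x) {f : E → ℝ} (hf : ContDiffOn ℝ ∞ f O) (i k : Fin n) :
    Set.EqOn (frame v x i (frame v x k f)) (frame v x k (frame v x i f)) O := by
  intro e he
  have key : ∀ i k, frame v x i (frame v x k f) e =
      ∑ j, ∑ b, (frameJac v x e)⁻¹ j i * (frameJac v x e)⁻¹ b k *
        dirDeriv (v b) (dirDeriv (v j) f) e -
      ∑ l, (∑ j, ∑ b, (frameJac v x e)⁻¹ j i * (frameJac v x e)⁻¹ b k *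
        dirDeriv (v b) (dirDeriv (v j) (x l)) e) * frame v x l f e := by
    intro i k
    rw [frame_eq_sum]
    simp only [h.dirDeriv_frame hf _ _ he, mul_sub, Finset.sum_sub_distrib]
    congr 1
    · refine Finset.sum_congr rfl fun j _ => ?_
      rw [frame_eq_sum, Finset.mul_sum]
      exact Finset.sum_congr rfl fun b _ => by ring
    · simp only [Finset.mul_sum]
      rw [Finset.sum_comm]
      refine Finset.sum_congr rfl fun l _ => ?_
      rw [Finset.sum_mul]
      refine Finset.sum_congr rfl fun j _ => ?_
      rw [frame_eq_sum v x k, Finset.sum_mul, Finset.sum_mul, Finset.mul_sum]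
      exact Finset.sum_congr rfl fun b _ => by ring
  have symm : ∀ g : E → ℝ, ContDiffOn ℝ ∞ g O →
      ∑ j, ∑ b, (frameJac v x e)⁻¹ j i * (frameJac v x e)⁻¹ b k *
        dirDeriv (v b) (dirDeriv (v j) g) e =
      ∑ j, ∑ b, (frameJac v x e)⁻¹ j k * (frameJac v x e)⁻¹ b i *
        dirDeriv (v b) (dirDeriv (v j) g) e := by
    intro g hg
    rw [Finset.sum_comm]
    refine Finset.sum_congr rfl fun b _ => Finset.sum_congr rfl fun j _ => ?_
    rw [dirDeriv_comm h.isOpen hg (v b) (v j) he]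
    ring
  rw [key, key, symm f hf]
  congr 1
  exact Finset.sum_congr rfl fun l _ => by rw [symm _ (h.smooth l)]

/-- Naturality of frames under maps that respect the spans of the directions. -/
lemma frame_comp {v₁ : Fin n → E₁} {α : E₁ → E} {t : E₁} (hα : DifferentiableAt ℝ α t)
    (A : Matrix (Fin n) (Fin n) ℝ) (hA : ∀ j, fderiv ℝ α t (v₁ j) = ∑ b, A b j • v b)
    (hAd : A.det ≠ 0) (hx : ∀ i, DifferentiableAt ℝ (x i) (α t)) {f : E → ℝ}
    (hf : DifferentiableAt ℝ f (α t)) (i : Fin n) :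
    frame v₁ (fun i => x i ∘ α) i (f ∘ α) t = frame v x i f (α t) := by
  have hJ : frameJac v₁ (fun i => x i ∘ α) t = frameJac v x (α t) * A := by
    ext a j
    rw [Matrix.mul_apply]
    simp only [frameJac, Matrix.of_apply]
    rw [fderiv_comp t (hx a) hα]
    simp [hA, map_sum, mul_comm]
  have hA' : A * A⁻¹ = 1 := Matrix.mul_nonsing_inv _ (isUnit_iff_ne_zero.mpr hAd)
  simp only [frame]
  rw [fderiv_comp t hf hα, ContinuousLinearMap.comp_apply]
  congr 1
  simp only [frameVec, map_sum, map_smul, hA, hJ, Matrix.mul_inv_rev, Finset.smul_sum, smul_smul]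
  rw [Finset.sum_comm]
  refine Finset.sum_congr rfl fun b _ => ?_
  rw [← Finset.sum_smul]
  congr 1
  calc ∑ j, (A⁻¹ * (frameJac v x (α t))⁻¹) j i * A b j
      = (A * (A⁻¹ * (frameJac v x (α t))⁻¹)) b i := by
        rw [Matrix.mul_apply]
        exact Finset.sum_congr rfl fun j _ => mul_comm _ _
    _ = _ := by rw [← Matrix.mul_assoc, hA', Matrix.one_mul]

/-- The Leibniz expansion is differentiated factor by factor. The permutations with `σ j = i` then
reassemble into the cofactor that multiplies the derivative of the entry `(i, j)`. -/
lemma hasDerivAt_update_det {ι : Type*} [Fintype ι] [DecidableEq ι] {M : E → Matrix ι ι ℝ} {e : E}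
    (h : ∀ i j, DifferentiableAt ℝ (fun e => M e i j) e) (w : E) :
    dirDeriv w (fun e => (M e).det) e =
      ∑ i, ∑ j, (M e).adjugate j i * dirDeriv w (fun e => M e i j) e := by
  have h1 : HasFDerivAt (fun e => (M e).det)
      (∑ σ : Equiv.Perm ι, ((Equiv.Perm.sign σ : ℤ) : ℝ) •
        ∑ i, (∏ k ∈ Finset.univ.erase i, M e (σ k) k) •
          fderiv ℝ (fun e => M e (σ i) i) e) e := by
    simp only [Matrix.det_apply, Units.smul_def, zsmul_eq_mul]
    refine HasFDerivAt.fun_sum fun σ _ => ?_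
    exact (HasFDerivAt.finsetProd fun i _ => (h (σ i) i).hasFDerivAt).const_mul _
  simp only [dirDeriv]
  rw [h1.fderiv]
  simp only [sum_apply, smul_apply, smul_eq_mul]
  have h2 : ∀ i j, (M e).adjugate j i = ∑ σ : Equiv.Perm ι, ((Equiv.Perm.sign σ : ℤ) : ℝ) *
      if σ j = i then ∏ k ∈ Finset.univ.erase j, M e (σ k) k else 0 := by
    intro i j
    rw [Matrix.adjugate_apply, Matrix.det_apply]
    refine Finset.sum_congr rfl fun σ _ => ?_
    rw [Units.smul_def, zsmul_eq_mul]
    congr 1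
    rw [← Finset.mul_prod_erase _ _ (Finset.mem_univ j)]
    by_cases hij : σ j = i
    · rw [if_pos hij, hij]
      simp only [Matrix.updateRow_self, Pi.single_eq_same, one_mul]
      refine Finset.prod_congr rfl fun k hk => ?_
      rw [Matrix.updateRow_ne]
      exact fun hh => (Finset.ne_of_mem_erase hk) (σ.injective (hh.trans hij.symm))
    · rw [if_neg hij]
      by_cases hc : ∃ k, σ k = i
      · obtain ⟨k, hk⟩ := hc
        have hkj : k ≠ j := fun hh => hij (hh ▸ hk)
        rw [Finset.prod_eq_zero (Finset.mem_erase.mpr ⟨hkj, Finset.mem_univ k⟩), mul_zero]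
        rw [hk, Matrix.updateRow_self, Pi.single_eq_of_ne hkj]
      · exact absurd ⟨σ.symm i, by simp⟩ hc
  simp only [h2, Finset.sum_mul]
  symm
  rw [show (∑ i, ∑ j, ∑ σ : Equiv.Perm ι, (((Equiv.Perm.sign σ : ℤ) : ℝ) *
      if σ j = i then ∏ k ∈ Finset.univ.erase j, M e (σ k) k else 0) *
        fderiv ℝ (fun e => M e i j) e w) = ∑ σ : Equiv.Perm ι, ∑ j, ∑ i,
      (((Equiv.Perm.sign σ : ℤ) : ℝ) *
      if σ j = i then ∏ k ∈ Finset.univ.erase j, M e (σ k) k else 0) *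
        fderiv ℝ (fun e => M e i j) e w by
    rw [Finset.sum_comm]
    simp only [Finset.sum_comm (γ := Equiv.Perm ι)]]
  refine Finset.sum_congr rfl fun σ _ => ?_
  rw [Finset.mul_sum]
  refine Finset.sum_congr rfl fun j _ => ?_
  rw [Finset.sum_eq_single (σ j)]
  · simp [mul_assoc]
  · intro b _ hb
    rw [if_neg (Ne.symm hb)]
    simp
  · simp

/-- Jacobi's formula for the density of a frame. -/
lemma FrameOn.dirDeriv_det (h : FrameOn O v x) (w : E) {e : E} (he : e ∈ O) :
    dirDeriv w (fun e => (frameJac v x e).det) e =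
      (frameJac v x e).det * ∑ k, frame v x k (dirDeriv w (x k)) e := by
  have dJ : ∀ a b, DifferentiableAt ℝ (fun e => frameJac v x e a b) e := fun a b =>
    differentiableAt_of_contDiffOn h.isOpen (h.jac_smooth a b) he
  rw [hasDerivAt_update_det dJ, Finset.mul_sum]
  refine Finset.sum_congr rfl fun k _ => ?_
  rw [frame_eq_sum, Finset.mul_sum]
  refine Finset.sum_congr rfl fun j _ => ?_
  have h1 : (frameJac v x e).adjugate j k = (frameJac v x e).det * (frameJac v x e)⁻¹ j k := by
    rw [Matrix.inv_def, Ring.inverse_eq_inv, Matrix.smul_apply, smul_eq_mul, ← mul_assoc,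
      mul_inv_cancel₀ (h.det_ne e he), one_mul]
  rw [h1, mul_assoc]
  congr 2
  exact dirDeriv_comm h.isOpen (h.smooth k) w (v j) he

/-- The Piola identity. -/
lemma FrameOn.piola (h : FrameOn O v x) (k : Fin n) {e : E} (he : e ∈ O) :
    ∑ j, dirDeriv (v j) (fun e => (frameJac v x e).det * (frameJac v x e)⁻¹ j k) e = 0 := by
  have dZ : ∀ a b, DifferentiableAt ℝ (fun e => (frameJac v x e)⁻¹ a b) e := fun a b =>
    differentiableAt_of_contDiffOn h.isOpen (h.inv_smooth a b) he
  have dd : DifferentiableAt ℝ (fun e => (frameJac v x e).det) e :=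
    differentiableAt_of_contDiffOn h.isOpen (contDiffOn_det h.jac_smooth) he
  -- The derivative of the density and that of the inverse matrix contribute the same triple sum
  -- with opposite signs, once the two constant directions are interchanged.
  simp only [dirDeriv_mul dd (dZ _ k), h.dirDeriv_det _ he, h.dirDeriv_inv _ he,
    Finset.sum_add_distrib]
  have h1 : ∑ j, ((frameJac v x e).det * ∑ l, frame v x l (dirDeriv (v j) (x l)) e) *
      (frameJac v x e)⁻¹ j k = (frameJac v x e).det * ∑ l, ∑ j, ∑ b, (frameJac v x e)⁻¹ b l *
        (frameJac v x e)⁻¹ j k * dirDeriv (v b) (dirDeriv (v j) (x l)) e := by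
    rw [Finset.sum_comm]
    simp only [Finset.mul_sum, Finset.sum_mul, frame_eq_sum]
    refine Finset.sum_congr rfl fun l _ => Finset.sum_congr rfl fun j _ =>
      Finset.sum_congr rfl fun b _ => by ring
  have h2 : ∑ j, (frameJac v x e).det * -∑ l, (frameJac v x e)⁻¹ j l *
      frame v x k (dirDeriv (v j) (x l)) e = -((frameJac v x e).det * ∑ l, ∑ j, ∑ b,
        (frameJac v x e)⁻¹ b l *
        (frameJac v x e)⁻¹ j k * dirDeriv (v b) (dirDeriv (v j) (x l)) e) := by
    simp only [mul_neg, Finset.sum_neg_distrib]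
    congr 1
    rw [← Finset.mul_sum, Finset.sum_comm]
    congr 1
    refine Finset.sum_congr rfl fun l _ => ?_
    simp only [Finset.mul_sum, frame_eq_sum]
    rw [Finset.sum_comm]
    refine Finset.sum_congr rfl fun j _ => Finset.sum_congr rfl fun b _ => ?_
    rw [dirDeriv_comm h.isOpen (h.smooth l) (v b) (v j) he]
    ring
  rw [h1, h2]
  ring

/-! Lists of frame derivatives -/

lemma opList_append {F : Type*} (D : Fin n → F → F) (l l' : List (Fin n)) (f : F) :
    opList D (l ++ l') f = opList D l (opList D l' f) := by
  simp [opList]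

@[simp] lemma opList_nil {F : Type*} (D : Fin n → F → F) (f : F) : opList D [] f = f := rfl

@[simp] lemma opList_cons {F : Type*} (D : Fin n → F → F) (i : Fin n) (l : List (Fin n)) (f : F) :
    opList D (i :: l) f = D i (opList D l f) := rfl

lemma FrameOn.contDiffOn_opList (h : FrameOn O v x) {f : E → ℝ} (hf : ContDiffOn ℝ ∞ f O)
    (l : List (Fin n)) : ContDiffOn ℝ ∞ (opList (frame v x) l f) O := by
  induction l with
  | nil => exact hf
  | cons i l ih => exact h.contDiffOn ih i

lemma opList_frame_congr (hO : IsOpen O) {f g : E → ℝ} (hfg : Set.EqOn f g O)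
    (l : List (Fin n)) : Set.EqOn (opList (frame v x) l f) (opList (frame v x) l g) O := by
  induction l with
  | nil => exact hfg
  | cons i l ih => exact frame_congr hO i ih

lemma FrameOn.opList_perm (h : FrameOn O v x) {f : E → ℝ} (hf : ContDiffOn ℝ ∞ f O)
    {l l' : List (Fin n)} (hl : l.Perm l') :
    Set.EqOn (opList (frame v x) l f) (opList (frame v x) l' f) O := by
  induction hl with
  | nil => exact fun _ _ => rfl
  | cons i _ ih => exact frame_congr h.isOpen i ih
  | swap i k l => exact h.comm (h.contDiffOn_opList hf l) k i
  | trans _ _ ih ih' => exact ih.trans ih'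

/-- Iterated naturality. With `A` the Jacobian of a reparametrisation it gives independence of the
parametrisation; with `A = 1` it compares a family of germs with its slices. -/
lemma opList_frame_comp {v₁ : Fin n → E₁} {α : E₁ → E} {O₁ : Set E₁} (hO₁ : IsOpen O₁)
    (h : FrameOn O v x) (hm : Set.MapsTo α O₁ O) (hα : ∀ t ∈ O₁, DifferentiableAt ℝ α t)
    (A : E₁ → Matrix (Fin n) (Fin n) ℝ)
    (hA : ∀ t ∈ O₁, ∀ j, fderiv ℝ α t (v₁ j) = ∑ b, A t b j • v b)
    (hAd : ∀ t ∈ O₁, (A t).det ≠ 0) {f : E → ℝ} (hf : ContDiffOn ℝ ∞ f O) (l : List (Fin n)) :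
    Set.EqOn (opList (frame v₁ (fun i => x i ∘ α)) l (f ∘ α)) (opList (frame v x) l f ∘ α) O₁ := by
  induction l with
  | nil => exact fun _ _ => rfl
  | cons i l ih =>
    intro t ht
    rw [opList_cons, frame_congr hO₁ i ih ht]
    exact frame_comp (hα t ht) (A t) (hA t ht) (hAd t ht)
      (fun i => differentiableAt_of_contDiffOn h.isOpen (h.smooth i) (hm ht))
      (differentiableAt_of_contDiffOn h.isOpen (h.contDiffOn_opList hf l) (hm ht)) i

end Frame

/-! ### Partial derivatives and jets of functions on `ℝⁿ` -/

/-! ### Linearity and product rule for frame derivatives -/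

section Linear

variable {E : Type*} [NormedAddCommGroup E] [NormedSpace ℝ E] {n : ℕ}
  {O : Set E} {v : Fin n → E} {x : Fin n → E → ℝ}

lemma frame_add (i : Fin n) {f g : E → ℝ} {e : E} (hf : DifferentiableAt ℝ f e)
    (hg : DifferentiableAt ℝ g e) :
    frame v x i (fun e => f e + g e) e = frame v x i f e + frame v x i g e := by
  simp only [frame]
  rw [fderiv_fun_add hf hg]
  rfl

lemma frame_const_mul (i : Fin n) (c : ℝ) {f : E → ℝ} {e : E} (hf : DifferentiableAt ℝ f e) :
    frame v x i (fun e => c * f e) e = c * frame v x i f e := by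
  simp only [frame]
  rw [fderiv_const_mul hf]
  rfl

lemma frame_mul (i : Fin n) {f g : E → ℝ} {e : E} (hf : DifferentiableAt ℝ f e)
    (hg : DifferentiableAt ℝ g e) :
    frame v x i (fun e => f e * g e) e = frame v x i f e * g e + f e * frame v x i g e :=
  dirDeriv_mul hf hg _

lemma frame_sum {ι : Type*} (s : Finset ι) (i : Fin n) {f : ι → E → ℝ} {e : E}
    (h : ∀ k ∈ s, DifferentiableAt ℝ (f k) e) :
    frame v x i (fun e => ∑ k ∈ s, f k e) e = ∑ k ∈ s, frame v x i (f k) e :=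
  dirDeriv_sum s h _

lemma FrameOn.opList_add (h : FrameOn O v x) {f g : E → ℝ} (hf : ContDiffOn ℝ ∞ f O)
    (hg : ContDiffOn ℝ ∞ g O) (l : List (Fin n)) :
    Set.EqOn (opList (frame v x) l (fun e => f e + g e))
      (fun e => opList (frame v x) l f e + opList (frame v x) l g e) O := by
  induction l with
  | nil => exact fun _ _ => rfl
  | cons i l ih =>
    intro e he
    rw [opList_cons, frame_congr h.isOpen i ih he]
    exact frame_add i (differentiableAt_of_contDiffOn h.isOpen (h.contDiffOn_opList hf l) he)
      (differentiableAt_of_contDiffOn h.isOpen (h.contDiffOn_opList hg l) he)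

lemma FrameOn.opList_const_mul (h : FrameOn O v x) (c : ℝ) {f : E → ℝ}
    (hf : ContDiffOn ℝ ∞ f O) (l : List (Fin n)) :
    Set.EqOn (opList (frame v x) l (fun e => c * f e))
      (fun e => c * opList (frame v x) l f e) O := by
  induction l with
  | nil => exact fun _ _ => rfl
  | cons i l ih =>
    intro e he
    rw [opList_cons, frame_congr h.isOpen i ih he]
    exact frame_const_mul i c
      (differentiableAt_of_contDiffOn h.isOpen (h.contDiffOn_opList hf l) he)

lemma FrameOn.opList_sum (h : FrameOn O v x) {ι : Type*} (s : Finset ι) {f : ι → E → ℝ}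
    (hf : ∀ k ∈ s, ContDiffOn ℝ ∞ (f k) O) (l : List (Fin n)) :
    Set.EqOn (opList (frame v x) l (fun e => ∑ k ∈ s, f k e))
      (fun e => ∑ k ∈ s, opList (frame v x) l (f k) e) O := by
  induction l with
  | nil => exact fun _ _ => rfl
  | cons i l ih =>
    intro e he
    rw [opList_cons, frame_congr h.isOpen i ih he]
    exact frame_sum s i fun k hk =>
      differentiableAt_of_contDiffOn h.isOpen (h.contDiffOn_opList (hf k hk) l) he

end Linear

/-! ### Partial derivatives as a frame, multi-indices and jets -/

section Std

variable {n : ℕ}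

/-- The standard basis vectors of `ℝⁿ`. -/
def stdVec (n : ℕ) (j : Fin n) : Fin n → ℝ := Pi.single j 1

/-- The coordinate functions of `ℝⁿ`. -/
def stdCoord (n : ℕ) (i : Fin n) : (Fin n → ℝ) → ℝ := fun t => t i

lemma fderiv_stdCoord (i : Fin n) (t : Fin n → ℝ) :
    fderiv ℝ (stdCoord n i) t = ContinuousLinearMap.proj i :=
  (ContinuousLinearMap.proj (R := ℝ) (φ := fun _ : Fin n => ℝ) i).hasFDerivAt.fderiv

lemma frameJac_std (t : Fin n → ℝ) : frameJac (stdVec n) (stdCoord n) t = 1 := by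
  ext i j
  simp [frameJac, fderiv_stdCoord, stdVec, Matrix.one_apply, Pi.single_apply]

lemma frameVec_std (i : Fin n) (t : Fin n → ℝ) :
    frameVec (stdVec n) (stdCoord n) i t = stdVec n i := by
  simp [frameVec, frameJac_std, Matrix.one_apply]

lemma pd_eq_frame : pd = frame (stdVec n) (stdCoord n) := by
  funext i f t
  simp [pd, frame, frameVec_std, stdVec]

lemma frameOn_std {O : Set (Fin n → ℝ)} (hO : IsOpen O) :
    FrameOn O (stdVec n) (stdCoord n) where
  isOpen := hO
  smooth i := (contDiff_apply ℝ ℝ i).contDiffOn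
  det_ne t _ := by simp [frameJac_std]

lemma contDiffOn_pd {O : Set (Fin n → ℝ)} (hO : IsOpen O) {f : (Fin n → ℝ) → ℝ}
    (hf : ContDiffOn ℝ ∞ f O) (i : Fin n) : ContDiffOn ℝ ∞ (pd i f) O :=
  contDiffOn_dirDeriv hO hf _

lemma opList_pd_perm {O : Set (Fin n → ℝ)} (hO : IsOpen O) {f : (Fin n → ℝ) → ℝ}
    (hf : ContDiffOn ℝ ∞ f O) {l l' : List (Fin n)} (hl : l.Perm l') :
    Set.EqOn (opList pd l f) (opList pd l' f) O := by
  rw [pd_eq_frame]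
  exact (frameOn_std hO).opList_perm hf hl

lemma opList_pd_congr {O : Set (Fin n → ℝ)} (hO : IsOpen O) {f g : (Fin n → ℝ) → ℝ}
    (hfg : Set.EqOn f g O) (l : List (Fin n)) :
    Set.EqOn (opList pd l f) (opList pd l g) O := by
  rw [pd_eq_frame]
  exact opList_frame_congr hO hfg l

/-! Multi-indices and lists -/

lemma idxList_count (J : Fin n → ℕ) (i : Fin n) : (idxList J).count i = J i := by
  rw [idxList, List.count_flatMap]
  simp only [Function.comp_def, List.count_replicate]
  have : (List.map (fun k => if (k == i) = true then J k else 0) (List.finRange n)).sum =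
      ∑ k, if k = i then J k else 0 := by
    rw [← List.sum_ofFn, List.ofFn_eq_map]
    simp
  rw [this]
  simp

lemma idxList_perm (J : Fin n → ℕ) {l : List (Fin n)} (h : ∀ i, l.count i = J i) :
    (idxList J).Perm l :=
  List.perm_iff_count.mpr fun i => by rw [idxList_count, h]

lemma sum_count (l : List (Fin n)) : ∑ i, l.count i = l.length := by
  simpa using Multiset.sum_count_eq_card (s := Finset.univ) (m := (l : Multiset (Fin n)))
    (fun _ _ => Finset.mem_univ _)

lemma idxList_length (J : Fin n → ℕ) : (idxList J).length = ∑ i, J i := by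
  rw [← sum_count]
  simp [idxList_count]

lemma idxList_zero : idxList (0 : Fin n → ℕ) = [] := by
  apply List.eq_nil_of_length_eq_zero
  simp [idxList_length]

lemma idxList_add_unit (J : Fin n → ℕ) (i : Fin n) :
    (idxList (J + unitIdx i)).Perm (i :: idxList J) :=
  idxList_perm _ fun k => by
    rw [List.count_cons, idxList_count]
    by_cases h : i = k
    · subst h; simp [unitIdx]
    · simp [unitIdx, h]

lemma idxList_unit (i : Fin n) : idxList (unitIdx i) = [i] := by
  have := idxList_add_unit 0 i
  rw [idxList_zero, zero_add] at this
  exact List.perm_singleton.mp this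

lemma sum_unitIdx (i : Fin n) : ∑ k, unitIdx i k = 1 := by simp [unitIdx]

/-! Jets -/

/-- Equality of all partial derivatives up to order `r` at `t`. -/
def JetEq (r : ℕ) (t : Fin n → ℝ) (f g : (Fin n → ℝ) → ℝ) : Prop :=
  ∀ l : List (Fin n), l.length ≤ r → opList pd l f t = opList pd l g t

variable {O : Set (Fin n → ℝ)} {t : Fin n → ℝ} {r : ℕ}

lemma jetEq_zero {f g : (Fin n → ℝ) → ℝ} : JetEq 0 t f g ↔ f t = g t := by
  refine ⟨fun h => h [] le_rfl, fun h l hl => ?_⟩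
  rw [List.eq_nil_of_length_eq_zero (Nat.le_zero.mp hl)]
  exact h

/-- The last entry of a list acts first, so splitting it off reduces the order by one without
commuting derivatives. This makes induction on the order possible for products and compositions. -/
lemma jetEq_succ {f g : (Fin n → ℝ) → ℝ} :
    JetEq (r + 1) t f g ↔ f t = g t ∧ ∀ a, JetEq r t (pd a f) (pd a g) := by
  constructor
  · refine fun h => ⟨h [] (Nat.zero_le _), fun a l hl => ?_⟩
    have := h (l ++ [a]) (by simpa using hl)
    rwa [opList_append, opList_append] at this
  · rintro ⟨h0, h1⟩ l hl
    rcases List.eq_nil_or_concat l with rfl | ⟨l, a, rfl⟩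
    · exact h0
    · rw [List.concat_eq_append, opList_append, opList_append]
      exact h1 a l (by simpa using hl)

lemma JetEq.mono {r' : ℕ} (h : r' ≤ r) {f g : (Fin n → ℝ) → ℝ} (hfg : JetEq r t f g) :
    JetEq r' t f g := fun l hl => hfg l (hl.trans h)

lemma JetEq.refl (r : ℕ) (t : Fin n → ℝ) (f : (Fin n → ℝ) → ℝ) : JetEq r t f f := fun _ _ => rfl

lemma JetEq.congr (hO : IsOpen O) (ht : t ∈ O) {f g f' g' : (Fin n → ℝ) → ℝ}
    (h : JetEq r t f g) (hf : Set.EqOn f' f O) (hg : Set.EqOn g' g O) : JetEq r t f' g' :=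
  fun l hl => by rw [opList_pd_congr hO hf l ht, opList_pd_congr hO hg l ht, h l hl]

lemma jetEq_of_multiIdx (hO : IsOpen O) (ht : t ∈ O) {f g : (Fin n → ℝ) → ℝ}
    (hf : ContDiffOn ℝ ∞ f O) (hg : ContDiffOn ℝ ∞ g O)
    (h : ∀ J : Fin n → ℕ, ∑ i, J i ≤ r → opList pd (idxList J) f t = opList pd (idxList J) g t) :
    JetEq r t f g := fun l hl => by
  have hp : (idxList fun i => l.count i).Perm l := idxList_perm _ fun _ => rfl
  rw [← opList_pd_perm hO hf hp ht, ← opList_pd_perm hO hg hp ht]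
  exact h _ (by rw [sum_count]; exact hl)

lemma JetEq.add (hO : IsOpen O) (ht : t ∈ O) {f g f' g' : (Fin n → ℝ) → ℝ}
    (hf : ContDiffOn ℝ ∞ f O) (hg : ContDiffOn ℝ ∞ g O) (hf' : ContDiffOn ℝ ∞ f' O)
    (hg' : ContDiffOn ℝ ∞ g' O) (h : JetEq r t f g) (h' : JetEq r t f' g') :
    JetEq r t (fun e => f e + f' e) (fun e => g e + g' e) := fun l hl => by
  have h1 := h l hl
  have h2 := h' l hl
  rw [pd_eq_frame] at h1 h2 ⊢
  rw [(frameOn_std hO).opList_add hf hf' l ht, (frameOn_std hO).opList_add hg hg' l ht]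
  exact congrArg₂ (· + ·) h1 h2

lemma JetEq.sum (hO : IsOpen O) (ht : t ∈ O) {ι : Type*} (s : Finset ι)
    {f g : ι → (Fin n → ℝ) → ℝ}
    (hf : ∀ k ∈ s, ContDiffOn ℝ ∞ (f k) O) (hg : ∀ k ∈ s, ContDiffOn ℝ ∞ (g k) O)
    (h : ∀ k ∈ s, JetEq r t (f k) (g k)) :
    JetEq r t (fun e => ∑ k ∈ s, f k e) (fun e => ∑ k ∈ s, g k e) := fun l hl => by
  have h1 := fun k hk => h k hk l hl
  rw [pd_eq_frame] at h1 ⊢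
  rw [(frameOn_std hO).opList_sum s hf l ht, (frameOn_std hO).opList_sum s hg l ht]
  exact Finset.sum_congr rfl h1

lemma JetEq.mul (hO : IsOpen O) (ht : t ∈ O) {f g f' g' : (Fin n → ℝ) → ℝ}
    (hf : ContDiffOn ℝ ∞ f O) (hg : ContDiffOn ℝ ∞ g O) (hf' : ContDiffOn ℝ ∞ f' O)
    (hg' : ContDiffOn ℝ ∞ g' O) (h : JetEq r t f g) (h' : JetEq r t f' g') :
    JetEq r t (fun e => f e * f' e) (fun e => g e * g' e) := by
  induction r generalizing f g f' g' with
  | zero =>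
    rw [jetEq_zero] at h h' ⊢
    rw [h, h']
  | succ r ih =>
    have hr := h.mono r.le_succ
    have hr' := h'.mono r.le_succ
    rw [jetEq_succ] at h h' ⊢
    refine ⟨by rw [h.1, h'.1], fun a => ?_⟩
    have hd : ∀ f f' : (Fin n → ℝ) → ℝ, ContDiffOn ℝ ∞ f O → ContDiffOn ℝ ∞ f' O →
        Set.EqOn (pd a fun e => f e * f' e) (fun e => pd a f e * f' e + f e * pd a f' e) O :=
      fun f f' hf hf' e he => dirDeriv_mul (differentiableAt_of_contDiffOn hO hf he)
        (differentiableAt_of_contDiffOn hO hf' he) _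
    refine JetEq.congr hO ht ?_ (hd f f' hf hf') (hd g g' hg hg')
    exact JetEq.add hO ht ((contDiffOn_pd hO hf a).mul hf') ((contDiffOn_pd hO hg a).mul hg')
      (hf.mul (contDiffOn_pd hO hf' a)) (hg.mul (contDiffOn_pd hO hg' a))
      (ih (contDiffOn_pd hO hf a) (contDiffOn_pd hO hg a) hf' hg' (h.2 a) hr')
      (ih hf hg (contDiffOn_pd hO hf' a) (contDiffOn_pd hO hg' a) hr (h'.2 a))

/-- Chain rule for a function of finitely many functions. -/
lemma fderiv_comp_pi {E : Type*} [NormedAddCommGroup E] [NormedSpace ℝ E] {ι : Type*} [Fintype ι]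
    [DecidableEq ι] {φ : (ι → ℝ) → ℝ} {f : E → ι → ℝ} {e : E} (hφ : DifferentiableAt ℝ φ (f e))
    (hf : DifferentiableAt ℝ f e) (w : E) :
    fderiv ℝ (fun e => φ (f e)) e w =
      ∑ A, fderiv ℝ φ (f e) (Pi.single A 1) * fderiv ℝ (fun e => f e A) e w := by
  have h1 : fderiv ℝ (fun e => φ (f e)) e = (fderiv ℝ φ (f e)).comp (fderiv ℝ f e) :=
    fderiv_comp e hφ hf
  rw [h1, ContinuousLinearMap.comp_apply]
  have h2 : ∀ A, fderiv ℝ (fun e => f e A) e w = fderiv ℝ f e w A := fun A => by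
    rw [fderiv_apply hf]
    rfl
  simp only [h2]
  conv_lhs => rw [pi_eq_sum_univ' (fderiv ℝ f e w)]
  rw [map_sum]
  refine Finset.sum_congr rfl fun A _ => ?_
  rw [map_smul, smul_eq_mul, mul_comm]

/-- Induction on the order replaces the higher chain rule: one derivative turns the composite into a
sum of products, whose factors are handled by the hypothesis of induction applied to the partial
derivatives of `φ`. -/
lemma JetEq.comp (hO : IsOpen O) (ht : t ∈ O) {ι : Type*} [Fintype ι] {Ω : Set (ι → ℝ)}
    (hΩ : IsOpen Ω) {φ : (ι → ℝ) → ℝ} (hφ : ContDiffOn ℝ ∞ φ Ω) {f g : (Fin n → ℝ) → ι → ℝ}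
    (hf : ∀ A, ContDiffOn ℝ ∞ (fun e => f e A) O) (hg : ∀ A, ContDiffOn ℝ ∞ (fun e => g e A) O)
    (hfΩ : Set.MapsTo f O Ω) (hgΩ : Set.MapsTo g O Ω)
    (h : ∀ A, JetEq r t (fun e => f e A) (fun e => g e A)) :
    JetEq r t (fun e => φ (f e)) (fun e => φ (g e)) := by
  classical
  induction r generalizing φ with
  | zero =>
    simp only [jetEq_zero] at h ⊢
    rw [show f t = g t from funext h]
  | succ r ih =>
    have hr := fun A => (h A).mono r.le_succ
    simp only [jetEq_succ] at h
    rw [jetEq_succ]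
    refine ⟨by rw [show f t = g t from funext fun A => (h A).1], fun a => ?_⟩
    have hd : ∀ f : (Fin n → ℝ) → ι → ℝ, (∀ A, ContDiffOn ℝ ∞ (fun e => f e A) O) →
        Set.MapsTo f O Ω → Set.EqOn (pd a fun e => φ (f e))
          (fun e => ∑ A, dirDeriv (Pi.single A 1) φ (f e) * pd a (fun e => f e A) e) O :=
      fun f hf hfΩ e he => fderiv_comp_pi (differentiableAt_of_contDiffOn hΩ hφ (hfΩ he))
        (differentiableAt_of_contDiffOn hO (contDiffOn_pi.mpr hf) he) _
    have hs : ∀ f : (Fin n → ℝ) → ι → ℝ, (∀ A, ContDiffOn ℝ ∞ (fun e => f e A) O) →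
        Set.MapsTo f O Ω → ∀ A, ContDiffOn ℝ ∞ (fun e => dirDeriv (Pi.single A 1) φ (f e)) O :=
      fun f hf hfΩ A => (contDiffOn_dirDeriv hΩ hφ _).comp (contDiffOn_pi.mpr hf) hfΩ
    refine JetEq.congr hO ht ?_ (hd f hf hfΩ) (hd g hg hgΩ)
    refine JetEq.sum hO ht _ (fun A _ => (hs f hf hfΩ A).mul (contDiffOn_pd hO (hf A) a))
      (fun A _ => (hs g hg hgΩ A).mul (contDiffOn_pd hO (hg A) a)) fun A _ => ?_
    exact JetEq.mul hO ht (hs f hf hfΩ A) (hs g hg hgΩ A) (contDiffOn_pd hO (hf A) a)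
      (contDiffOn_pd hO (hg A) a) (ih (contDiffOn_dirDeriv hΩ hφ _) hr) ((h A).2 a)

/-! Monomials -/

/-- The divided power `t ↦ tᴶ / J!`. -/
def monomialFun (J : Fin n → ℕ) : (Fin n → ℝ) → ℝ := fun t => ∏ i, t i ^ J i / (J i).factorial

lemma contDiff_monomialFun (J : Fin n → ℕ) : ContDiff ℝ ∞ (monomialFun J) :=
  contDiff_prod fun i _ => ((contDiff_apply ℝ ℝ i).pow _).div_const _

lemma monomialFun_zero (J : Fin n → ℕ) : monomialFun J 0 = if J = 0 then 1 else 0 := by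
  split_ifs with h
  · subst h; simp [monomialFun]
  · obtain ⟨i, hi⟩ : ∃ i, J i ≠ 0 := by
      by_contra! hc
      exact h (funext hc)
    exact Finset.prod_eq_zero (Finset.mem_univ i) (by simp [hi])

/-- Dividing by the factorials makes differentiation a pure shift of exponents, so the coefficients
in `taylorFun` are the derivatives at `0` themselves. -/
lemma pd_monomialFun (J : Fin n → ℕ) (a : Fin n) :
    pd a (monomialFun J) = if J a = 0 then 0 else monomialFun (J - unitIdx a) := by
  funext t
  have h1 : ∀ i, HasFDerivAt (fun t : Fin n → ℝ => t i ^ J i / (J i).factorial)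
      ((((J i : ℝ) * t i ^ (J i - 1)) / (J i).factorial) •
        (ContinuousLinearMap.proj (R := ℝ) (φ := fun _ : Fin n => ℝ) i)) t := fun i => by
    have h2 := ((ContinuousLinearMap.proj (R := ℝ) (φ := fun _ : Fin n => ℝ) i).hasFDerivAt
      (x := t)).pow (J i)
    have h3 := h2.mul_const (((J i).factorial : ℝ)⁻¹)
    refine h3.congr_fderiv ?_
    ext
    simp
    ring
  have h4 : HasFDerivAt (monomialFun J) _ t := HasFDerivAt.finsetProd fun i _ => h1 i
  simp only [pd]
  rw [h4.fderiv]
  simp only [sum_apply, smul_apply, ContinuousLinearMap.proj_apply, smul_eq_mul,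
    Pi.single_apply, mul_ite, mul_one, mul_zero, Finset.sum_ite_eq', Finset.mem_univ, if_true]
  split_ifs with h
  · simp [h]
  · simp only [monomialFun]
    rw [← Finset.prod_erase_mul _ _ (Finset.mem_univ a)]
    congr 1
    · refine Finset.prod_congr rfl fun i hi => ?_
      simp [unitIdx, Pi.single_eq_of_ne (Finset.ne_of_mem_erase hi)]
    · simp only [Pi.sub_apply, unitIdx, Pi.single_eq_same]
      obtain ⟨k, hk⟩ := Nat.exists_eq_succ_of_ne_zero h
      rw [hk, Nat.factorial_succ]
      simp only [Nat.succ_eq_add_one, Nat.add_sub_cancel]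
      push_cast
      field_simp

lemma opList_pd_zero (l : List (Fin n)) :
    opList pd l (0 : (Fin n → ℝ) → ℝ) = 0 := by
  induction l with
  | nil => rfl
  | cons i l ih =>
    rw [opList_cons, ih]
    funext t
    simp [pd]

lemma opList_monomialFun (l : List (Fin n)) (J : Fin n → ℕ) :
    opList pd l (monomialFun J) 0 = if (fun i => l.count i) = J then 1 else 0 := by
  -- The last index is removed because it is the one that differentiates the monomial first.
  induction l using List.reverseRecOn generalizing J with
  | nil =>
    rw [opList_nil, monomialFun_zero]
    simp [eq_comm, funext_iff]
  | append_singleton l a ih =>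
    rw [opList_append, opList_cons, opList_nil, pd_monomialFun]
    split_ifs with h h' h'
    · have := congrFun h' a
      simp [h] at this
    · rw [opList_pd_zero]
      rfl
    · rw [ih, if_pos]
      rw [← h']
      funext i
      by_cases hi : a = i
      · subst hi; simp [unitIdx]
      · simp [unitIdx, hi, List.count_singleton]
    · rw [ih, if_neg]
      rintro hh
      apply h'
      funext i
      have := congrFun hh i
      by_cases hi : a = i
      · subst hi
        simp only [unitIdx, Pi.sub_apply, Pi.single_eq_same] at this
        simp only [List.count_append, List.count_singleton_self]
        omega
      · simpa [unitIdx, hi, Pi.single_eq_of_ne (Ne.symm hi), List.count_singleton] using this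

/-- The polynomial with prescribed derivatives at `0`. -/
def taylorFun {m s : ℕ} (y : MultiIdx n s → Fin m → ℝ) (t : Fin n → ℝ) (σ : Fin m) : ℝ :=
  ∑ J, y J σ * monomialFun J.1 t

lemma contDiff_taylorFun {m s : ℕ} (y : MultiIdx n s → Fin m → ℝ) :
    ContDiff ℝ ∞ (taylorFun y) :=
  contDiff_pi.mpr fun _ => ContDiff.sum fun J _ => contDiff_const.mul (contDiff_monomialFun J.1)

lemma opList_taylorFun {m s : ℕ} (y : MultiIdx n s → Fin m → ℝ) (σ : Fin m) (l : List (Fin n))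
    (hl : l.length ≤ s) :
    opList pd l (fun t => taylorFun y t σ) 0 = y ⟨fun i => l.count i, by rwa [sum_count]⟩ σ := by
  have h1 : ∀ J : MultiIdx n s, ContDiffOn ℝ ∞ (fun t => y J σ * monomialFun J.1 t) Set.univ :=
    fun J => (contDiff_const.mul (contDiff_monomialFun J.1)).contDiffOn
  have h3 := opList_monomialFun (n := n) l
  rw [pd_eq_frame] at h3 ⊢
  simp only [taylorFun]
  rw [(frameOn_std isOpen_univ).opList_sum _ (fun J _ => h1 J) l (Set.mem_univ _)]
  have h2 : ∀ J : MultiIdx n s, opList (frame (stdVec n) (stdCoord n)) l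
      (fun t => y J σ * monomialFun J.1 t) 0 =
      if J = ⟨fun i => l.count i, by rwa [sum_count]⟩ then y J σ else 0 := fun J => by
    rw [(frameOn_std isOpen_univ).opList_const_mul _ (contDiff_monomialFun J.1).contDiffOn l
      (Set.mem_univ _)]
    simp only [h3]
    simp [Subtype.ext_iff, eq_comm]
  simp only [h2]
  simp

lemma taylorFun_zero {m s : ℕ} (y : MultiIdx n s → Fin m → ℝ) (σ : Fin m) :
    taylorFun y 0 σ = y (zeroIdx n s) σ :=
  opList_taylorFun y σ [] (Nat.zero_le _)

lemma opList_idxList_taylorFun {m s : ℕ} (y : MultiIdx n s → Fin m → ℝ) (σ : Fin m)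
    (J : MultiIdx n s) : opList pd (idxList J.1) (fun t => taylorFun y t σ) 0 = y J σ := by
  rw [opList_taylorFun y σ _ (by rw [idxList_length]; exact J.2)]
  congr 1
  exact Subtype.ext (funext fun i => idxList_count _ _)

end Std

/-! ### Germs of immersions in charts -/

lemma det_fderiv_eq {n : ℕ} {f : (Fin n → ℝ) → Fin n → ℝ} {t : Fin n → ℝ}
    (hf : DifferentiableAt ℝ f t) :
    (fderiv ℝ f t).det = (frameJac (stdVec n) (fun i t => f t i) t).det := by
  rw [ContinuousLinearMap.det, ← LinearMap.det_toMatrix']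
  congr 1
  ext i j
  rw [LinearMap.toMatrix'_apply]
  simp only [frameJac, Matrix.of_apply, fderiv_apply hf]
  simp [stdVec]

lemma fderiv_stdVec_eq_sum {n : ℕ} {f : (Fin n → ℝ) → Fin n → ℝ} {t : Fin n → ℝ}
    (hf : DifferentiableAt ℝ f t) (j : Fin n) :
    fderiv ℝ f t (stdVec n j) =
      ∑ b, frameJac (stdVec n) (fun i t => f t i) t b j • stdVec n b := by
  conv_lhs => rw [pi_eq_sum_univ' (fderiv ℝ f t (stdVec n j))]
  refine Finset.sum_congr rfl fun b _ => ?_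
  simp only [frameJac, Matrix.of_apply, fderiv_apply hf]
  congr 1

lemma frame_eq_of_fderiv_coord_eq {E : Type*} [NormedAddCommGroup E] [NormedSpace ℝ E] {n : ℕ}
    {v : Fin n → E} {x x' : Fin n → E → ℝ} {e : E}
    (hx : ∀ i, fderiv ℝ (x i) e = fderiv ℝ (x' i) e) (i : Fin n) (f : E → ℝ) :
    frame v x i f e = frame v x' i f e := by
  have : frameJac v x e = frameJac v x' e := by
    ext a b
    simp [frameJac, hx]
  simp [frame, frameVec, this]

/-- A frame sees the coordinate functions only through their differentials. In particular,
translated standard coordinates give ordinary partial derivatives; this is how adapted coordinates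
of graphs are computed. -/
lemma opList_frame_eq_of_fderiv_coord_eq {E : Type*} [NormedAddCommGroup E] [NormedSpace ℝ E]
    {n : ℕ} {O : Set E} (hO : IsOpen O) {v : Fin n → E} {x x' : Fin n → E → ℝ}
    (hx : ∀ e ∈ O, ∀ i, fderiv ℝ (x i) e = fderiv ℝ (x' i) e) {f f' : E → ℝ}
    (hf : Set.EqOn f f' O) (l : List (Fin n)) :
    Set.EqOn (opList (frame v x) l f) (opList (frame v x') l f') O := by
  induction l with
  | nil => exact hf
  | cons i l ih =>
    intro e he
    rw [opList_cons, frame_congr hO i ih he]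
    exact frame_eq_of_fderiv_coord_eq (hx e he) i _

variable {n m : ℕ} {X : Type*} [TopologicalSpace X] [ChartedSpace (Fin (n + m) → ℝ) X]

lemma zd_eq_frame (ψ : Chart n m X) (γ : ImmGerm n m X) :
    zd ψ γ = frame (stdVec n) (fun i => coordFun ψ γ (Fin.castAdd m i)) := by
  funext i f t
  rw [frame_eq_sum]
  rfl

lemma contMDiffAt_chart (ψ : Chart n m X) {x : X} (hx : x ∈ ψ.1.source) :
    ContMDiffAt 𝓘(ℝ, Fin (n + m) → ℝ) 𝓘(ℝ, Fin (n + m) → ℝ) ∞ ψ.1 x :=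
  contMDiffAt_of_mem_maximalAtlas ψ.2 hx

lemma contMDiffAt_chart_symm (ψ : Chart n m X) {u : Fin (n + m) → ℝ} (hu : u ∈ ψ.1.target) :
    ContMDiffAt 𝓘(ℝ, Fin (n + m) → ℝ) 𝓘(ℝ, Fin (n + m) → ℝ) ∞ ψ.1.symm u :=
  contMDiffAt_symm_of_mem_maximalAtlas ψ.2 hu

/-- The change of coordinates on `X`. -/
def chartChange (ψ ψ' : Chart n m X) (u : Fin (n + m) → ℝ) : Fin (n + m) → ℝ :=
  ψ'.1 (ψ.1.symm u)

/-- The domain of the change of coordinates on `X`. -/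
def chartOverlap (ψ ψ' : Chart n m X) : Set (Fin (n + m) → ℝ) :=
  ψ.1.target ∩ ψ.1.symm ⁻¹' ψ'.1.source

lemma isOpen_chartOverlap (ψ ψ' : Chart n m X) : IsOpen (chartOverlap ψ ψ') :=
  ψ.1.isOpen_inter_preimage_symm ψ'.1.open_source

lemma contDiffOn_chartChange (ψ ψ' : Chart n m X) :
    ContDiffOn ℝ ∞ (chartChange ψ ψ') (chartOverlap ψ ψ') := fun _ hu =>
  (((contMDiffAt_chart ψ' hu.2).comp _ (contMDiffAt_chart_symm ψ hu.1)).contDiffAt).contDiffWithinAt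

lemma contDiffOn_chartChange_apply (ψ ψ' : Chart n m X) (A : Fin (n + m)) :
    ContDiffOn ℝ ∞ (fun u => chartChange ψ ψ' u A) (chartOverlap ψ ψ') :=
  contDiffOn_pi.mp (contDiffOn_chartChange ψ ψ') A

/-- A germ is smooth in a chart on a neighbourhood of `0`. -/
lemma ImmGerm.exists_nhd (γ : ImmGerm n m X) (ψ : Chart n m X) (h : γ.toFun 0 ∈ ψ.1.source) :
    ∃ O : Set (Fin n → ℝ), IsOpen O ∧ 0 ∈ O ∧ (∀ A, ContDiffOn ℝ ∞ (coordFun ψ γ A) O) ∧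
      ∀ t ∈ O, γ.toFun t ∈ ψ.1.source := by
  have h1 : ∀ᶠ t in 𝓝 0, γ.toFun t ∈ ψ.1.source :=
    γ.smooth.self_of_nhds.continuousAt.eventually (ψ.1.open_source.mem_nhds h)
  obtain ⟨O, hO, hOo, h0⟩ := eventually_nhds_iff.mp (γ.smooth.and h1)
  refine ⟨O, hOo, h0, fun A t ht => ?_, fun t ht => (hO t ht).2⟩
  have h2 := ((contMDiffAt_chart ψ (hO t ht).2).comp t (hO t ht).1).contDiffAt
  exact (contDiffAt_pi.mp h2 A).contDiffWithinAt

lemma coordFun_eq_chartChange {ψ ψ' : Chart n m X} {γ : ImmGerm n m X} {t : Fin n → ℝ}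
    (h : γ.toFun t ∈ ψ.1.source) (A : Fin (n + m)) :
    coordFun ψ' γ A t = chartChange ψ ψ' (fun B => coordFun ψ γ B t) A := by
  change ψ'.1 _ A = ψ'.1 (ψ.1.symm (ψ.1 (γ.toFun t))) A
  rw [ψ.1.left_inv h]

lemma coordFun_mem_chartOverlap {ψ ψ' : Chart n m X} {γ : ImmGerm n m X} {t : Fin n → ℝ}
    (h : γ.toFun t ∈ ψ.1.source) (h' : γ.toFun t ∈ ψ'.1.source) :
    (fun B => coordFun ψ γ B t) ∈ chartOverlap ψ ψ' := by
  refine ⟨ψ.1.map_source h, ?_⟩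
  change ψ.1.symm (ψ.1 (γ.toFun t)) ∈ ψ'.1.source
  rwa [ψ.1.left_inv h]

/-- Jets may be compared in a single chart. -/
lemma jet_eq_of_chart {r : ℕ} {γ δ : ImmGerm n m X} (ψ : Chart n m X)
    (h : γ.toFun 0 ∈ ψ.1.source) (h0 : γ.toFun 0 = δ.toFun 0)
    (hj : ∀ A, JetEq r 0 (coordFun ψ γ A) (coordFun ψ δ A)) : jet r γ = jet r δ := by
  refine Quotient.sound ⟨h0, fun ψ' h' A => ?_⟩
  obtain ⟨O₁, ho₁, z₁, s₁, m₁⟩ := γ.exists_nhd ψ h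
  obtain ⟨O₂, ho₂, z₂, s₂, m₂⟩ := δ.exists_nhd ψ (h0 ▸ h)
  obtain ⟨O₃, ho₃, z₃, -, m₃⟩ := γ.exists_nhd ψ' h'
  obtain ⟨O₄, ho₄, z₄, -, m₄⟩ := δ.exists_nhd ψ' (h0 ▸ h')
  have hO : IsOpen (O₁ ∩ O₂ ∩ (O₃ ∩ O₄)) := (ho₁.inter ho₂).inter (ho₃.inter ho₄)
  have z : (0 : Fin n → ℝ) ∈ O₁ ∩ O₂ ∩ (O₃ ∩ O₄) := ⟨⟨z₁, z₂⟩, z₃, z₄⟩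
  refine JetEq.congr hO z (JetEq.comp hO z (isOpen_chartOverlap ψ ψ')
    (contDiffOn_chartChange_apply ψ ψ' A) (f := fun t B => coordFun ψ γ B t)
    (g := fun t B => coordFun ψ δ B t)
    (fun B => (s₁ B).mono fun t ht => ht.1.1) (fun B => (s₂ B).mono fun t ht => ht.1.2)
    (fun t ht => coordFun_mem_chartOverlap (m₁ t ht.1.1) (m₃ t ht.2.1))
    (fun t ht => coordFun_mem_chartOverlap (m₂ t ht.1.2) (m₄ t ht.2.2)) hj) ?_ ?_
  · exact fun t ht => coordFun_eq_chartChange (m₁ t ht.1.1) A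
  · exact fun t ht => coordFun_eq_chartChange (m₂ t ht.1.2) A

lemma jet_eq_iff {r : ℕ} {γ δ : ImmGerm n m X} : jet r γ = jet r δ ↔
    γ.toFun 0 = δ.toFun 0 ∧ ∀ ψ : Chart n m X, γ.toFun 0 ∈ ψ.1.source →
      ∀ A, JetEq r 0 (coordFun ψ γ A) (coordFun ψ δ A) :=
  ⟨fun h => Quotient.exact h, fun h => Quotient.sound h⟩

/-- Around a germ in the domain of the adapted chart, the first coordinates give a frame. -/
lemma InDom.exists_frameOn {ψ : Chart n m X} {γ : ImmGerm n m X} (h : InDom ψ γ) :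
    ∃ O : Set (Fin n → ℝ), 0 ∈ O ∧
      FrameOn O (stdVec n) (fun i => coordFun ψ γ (Fin.castAdd m i)) ∧
      (∀ A, ContDiffOn ℝ ∞ (coordFun ψ γ A) O) ∧ ∀ t ∈ O, γ.toFun t ∈ ψ.1.source := by
  obtain ⟨O, ho, z, s, m⟩ := γ.exists_nhd ψ h.1
  have hd : ContinuousOn (fun t => (jac ψ γ t).det) O :=
    (contDiffOn_det (k := ∞) fun i j => contDiffOn_pd ho (s _) j).continuousOn
  have ho' := hd.isOpen_inter_preimage ho (isOpen_compl_singleton (x := (0 : ℝ)))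
  refine ⟨O ∩ (fun t => (jac ψ γ t).det) ⁻¹' {0}ᶜ, ⟨z, h.2⟩,
      ⟨ho', fun i => (s _).mono Set.inter_subset_left, fun t ht => ht.2⟩,
    fun A => (s A).mono Set.inter_subset_left, fun t ht => m t ht.1⟩

/-- Transversality is a condition on first derivatives, so it is visible in the jet only from order
one on. -/
lemma InDom.of_jet_eq {s : ℕ} (hs : 1 ≤ s) {ψ : Chart n m X} {γ δ : ImmGerm n m X}
    (h : InDom ψ γ) (hj : jet s γ = jet s δ) : InDom ψ δ := by
  obtain ⟨h0, hj⟩ := jet_eq_iff.mp hj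
  refine ⟨h0 ▸ h.1, ?_⟩
  have : jac ψ δ 0 = jac ψ γ 0 := by
    ext i j
    exact (hj ψ h.1 (Fin.castAdd m i) [j] (by simpa using hs)).symm
  rw [this]
  exact h.2

/-- Each frame derivative uses up one order of agreement: `k` is the order that remains after `l`
has acted. This gives dependence of the adapted coordinates on the jet alone. -/
lemma JetEq.opList_frame {s : ℕ} {O : Set (Fin n → ℝ)} {t : Fin n → ℝ} (ht : t ∈ O)
    {x x' : Fin n → (Fin n → ℝ) → ℝ} {f f' : (Fin n → ℝ) → ℝ}
    (h : FrameOn O (stdVec n) x) (h' : FrameOn O (stdVec n) x')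
    (hf : ContDiffOn ℝ ∞ f O) (hf' : ContDiffOn ℝ ∞ f' O)
    (hx : ∀ i, JetEq s t (x i) (x' i)) (hff : JetEq s t f f') (l : List (Fin n)) (k : ℕ)
    (hk : l.length + k ≤ s) :
    JetEq k t (opList (frame (stdVec n) x) l f) (opList (frame (stdVec n) x') l f') := by
  induction l generalizing k with
  | nil => exact hff.mono (by simpa using hk)
  | cons i l ih =>
    simp only [List.length_cons] at hk
    have ih' := ih (k + 1) (by omega)
    have hz : ∀ j, JetEq k t (fun e => (frameJac (stdVec n) x e)⁻¹ j i)
        (fun e => (frameJac (stdVec n) x' e)⁻¹ j i) := by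
      intro j
      -- An entry of the inverse is a smooth function of the finitely many Jacobian entries, so its
      -- jet is controlled by composition.
      let toMat : (Fin n × Fin n → ℝ) → Matrix (Fin n) (Fin n) ℝ :=
        fun p => Matrix.of fun a b => p (a, b)
      have hc : ∀ a b, ContDiff ℝ ∞ (fun p => toMat p a b) := fun a b => contDiff_apply ℝ ℝ (a, b)
      have hΩ : IsOpen {p : Fin n × Fin n → ℝ | (toMat p).det ≠ 0} := by
        have : Continuous fun p => (toMat p).det :=
          (contDiffOn_univ.mp (contDiffOn_det (k := ∞)
            fun a b => (hc a b).contDiffOn)).continuous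
        exact isOpen_compl_singleton.preimage this
      have hφ : ContDiffOn ℝ ∞ (fun p => (toMat p)⁻¹ j i)
          {p : Fin n × Fin n → ℝ | (toMat p).det ≠ 0} :=
        contDiffOn_inv_apply (fun a b => (hc a b).contDiffOn) (fun p hp => hp) j i
      exact JetEq.comp h.isOpen ht hΩ hφ
        (f := fun e p => frameJac (stdVec n) x e p.1 p.2)
        (g := fun e p => frameJac (stdVec n) x' e p.1 p.2)
        (fun p => h.jac_smooth p.1 p.2) (fun p => h'.jac_smooth p.1 p.2)
        (fun e he => h.det_ne e he) (fun e he => h'.det_ne e he)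
        fun p => (jetEq_succ.mp ((hx p.1).mono (show k + 1 ≤ s by omega))).2 p.2
    refine JetEq.congr h.isOpen ht (f := fun e => ∑ j, (frameJac (stdVec n) x e)⁻¹ j i *
        pd j (opList (frame (stdVec n) x) l f) e)
      (g := fun e => ∑ j, (frameJac (stdVec n) x' e)⁻¹ j i *
        pd j (opList (frame (stdVec n) x') l f') e) ?_
      (fun e _ => frame_eq_sum _ _ _ _ _) (fun e _ => frame_eq_sum _ _ _ _ _)
    have s1 := fun j => contDiffOn_pd h.isOpen (h.contDiffOn_opList hf l) j
    have s2 := fun j => contDiffOn_pd h.isOpen (h'.contDiffOn_opList hf' l) j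
    exact JetEq.sum h.isOpen ht _ (fun j _ => (h.inv_smooth j i).mul (s1 j))
      (fun j _ => (h'.inv_smooth j i).mul (s2 j)) fun j _ =>
      JetEq.mul h.isOpen ht (h.inv_smooth j i) (h'.inv_smooth j i) (s1 j) (s2 j) (hz j)
        ((jetEq_succ.mp ih').2 j)

lemma FrameOn.mono {E : Type*} [NormedAddCommGroup E] [NormedSpace ℝ E] {O O' : Set E}
    {v : Fin n → E} {x : Fin n → E → ℝ} (h : FrameOn O v x) (hO' : IsOpen O') (hs : O' ⊆ O) :
    FrameOn O' v x :=
  ⟨hO', fun i => (h.smooth i).mono hs, fun e he => h.det_ne e (hs he)⟩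

lemma adapted_eq_of_jet_eq {s : ℕ} (hs : 1 ≤ s) {ψ : Chart n m X} {γ δ : ImmGerm n m X}
    (h : InDom ψ γ) (hj : jet s γ = jet s δ) : adapted s ψ γ = adapted s ψ δ := by
  obtain ⟨O₁, z₁, f₁, s₁, -⟩ := h.exists_frameOn
  obtain ⟨O₂, z₂, f₂, s₂, -⟩ := (h.of_jet_eq hs hj).exists_frameOn
  obtain ⟨h0, hj⟩ := jet_eq_iff.mp hj
  have hO := f₁.isOpen.inter f₂.isOpen
  refine Prod.ext (funext fun i => hj ψ h.1 _ [] (Nat.zero_le _)) ?_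
  funext J σ
  change opList (zd ψ γ) _ _ 0 = opList (zd ψ δ) _ _ 0
  rw [zd_eq_frame, zd_eq_frame]
  have := JetEq.opList_frame (s := s) (O := O₁ ∩ O₂) (t := 0) ⟨z₁, z₂⟩ (f₁.mono hO Set.inter_subset_left)
    (f₂.mono hO Set.inter_subset_right) ((s₁ (Fin.natAdd n σ)).mono Set.inter_subset_left)
    ((s₂ (Fin.natAdd n σ)).mono Set.inter_subset_right) (fun i => hj ψ h.1 _) (hj ψ h.1 _)
    (idxList J.1) 0 (by simpa [idxList_length] using J.2)
  exact jetEq_zero.mp this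

lemma DiffGerm.exists_nhd (α : DiffGerm n) : ∃ O : Set (Fin n → ℝ), 0 ∈ O ∧
    FrameOn O (stdVec n) (fun i t => α.toFun t i) := by
  obtain ⟨O, hO, ho, z⟩ := eventually_nhds_iff.mp α.smooth
  have s : ContDiffOn ℝ ∞ α.toFun O := fun t ht => (hO t ht).contDiffWithinAt
  have s' : ∀ i, ContDiffOn ℝ ∞ (fun t => α.toFun t i) O := contDiffOn_pi.mp s
  have hd : ContinuousOn (fun t => (frameJac (stdVec n) (fun i t => α.toFun t i) t).det) O :=
    (contDiffOn_det (k := ∞) fun i j => contDiffOn_pd ho (s' _) j).continuousOn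
  have ho' := hd.isOpen_inter_preimage ho (isOpen_compl_singleton (x := (0 : ℝ)))
  refine ⟨O ∩ (fun t => (frameJac (stdVec n) (fun i t => α.toFun t i) t).det) ⁻¹' {0}ᶜ,
    ⟨z, ?_⟩, ⟨ho', fun i => (s' i).mono Set.inter_subset_left, fun t ht => ht.2⟩⟩
  have := α.det_ne_zero
  rwa [det_fderiv_eq (differentiableAt_of_contDiffOn ho s z)] at this

lemma jac_comp {ψ : Chart n m X} {γ : ImmGerm n m X} (h : γ.toFun 0 ∈ ψ.1.source)
    (α : DiffGerm n) : (jac ψ (γ.comp α) 0).det = (jac ψ γ 0).det * (fderiv ℝ α.toFun 0).det := by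
  obtain ⟨O, ho, z, s, -⟩ := γ.exists_nhd ψ h
  have hα := α.smooth.self_of_nhds.differentiableAt (by simp)
  rw [det_fderiv_eq hα, ← Matrix.det_mul]
  congr 1
  ext i j
  have hd := differentiableAt_of_contDiffOn ho (s (Fin.castAdd m i))
    (show α.toFun 0 ∈ O by rwa [α.map_zero])
  change fderiv ℝ (coordFun ψ γ (Fin.castAdd m i) ∘ α.toFun) 0 (stdVec n j) = _
  rw [fderiv_comp _ hd hα, ContinuousLinearMap.comp_apply, fderiv_stdVec_eq_sum hα, α.map_zero,
    map_sum, Matrix.mul_apply]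
  refine Finset.sum_congr rfl fun b _ => ?_
  rw [map_smul, smul_eq_mul, mul_comm]
  rfl

lemma inDom_comp_iff {ψ : Chart n m X} {γ : ImmGerm n m X} (α : DiffGerm n) :
    InDom ψ (γ.comp α) ↔ InDom ψ γ := by
  have h0 : (γ.comp α).toFun 0 = γ.toFun 0 := congrArg γ.toFun α.map_zero
  simp only [InDom, h0]
  refine and_congr_right fun h => ?_
  rw [jac_comp h, mul_ne_zero_iff, and_iff_left α.det_ne_zero]

/-- The operators `z^j_i d_j` are derivatives with respect to the functions `xⁱ` along the germ and
do not see its parametrisation: the Jacobian of `α` cancels against `𝐱⁻¹`. -/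
lemma opList_zd_comp {ψ : Chart n m X} {γ : ImmGerm n m X} (h : InDom ψ γ) (α : DiffGerm n) :
    ∃ O, IsOpen O ∧ (0 : Fin n → ℝ) ∈ O ∧ ∀ A l, Set.EqOn
      (opList (zd ψ (γ.comp α)) l (coordFun ψ (γ.comp α) A))
      (opList (zd ψ γ) l (coordFun ψ γ A) ∘ α.toFun) O := by
  obtain ⟨O₁, z₁, f₁, s₁, -⟩ := h.exists_frameOn
  obtain ⟨O₂, z₂, f₂⟩ := α.exists_nhd
  have sα : ContDiffOn ℝ ∞ α.toFun O₂ := contDiffOn_pi.mpr f₂.smooth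
  have ho := sα.continuousOn.isOpen_inter_preimage f₂.isOpen f₁.isOpen
  refine ⟨_, ho, ⟨z₂, by rwa [Set.mem_preimage, α.map_zero]⟩, fun A l => ?_⟩
  have hd := fun t (ht : t ∈ O₂) => differentiableAt_of_contDiffOn f₂.isOpen sα ht
  rw [zd_eq_frame, zd_eq_frame]
  exact opList_frame_comp ho f₁ (fun t ht => ht.2) (fun t ht => hd t ht.1)
    (frameJac (stdVec n) (fun i t => α.toFun t i))
    (fun t ht j => fderiv_stdVec_eq_sum (hd t ht.1) j) (fun t ht => f₂.det_ne t ht.1) (s₁ A) l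

lemma adapted_comp {s : ℕ} {ψ : Chart n m X} {γ : ImmGerm n m X} (h : InDom ψ γ)
    (α : DiffGerm n) : adapted s ψ (γ.comp α) = adapted s ψ γ := by
  obtain ⟨O, -, z, hO⟩ := opList_zd_comp h α
  refine Prod.ext (funext fun i => ?_) (funext fun J => funext fun σ => ?_)
  · exact congrArg (coordFun ψ γ (Fin.castAdd m i)) α.map_zero
  · change opList (zd ψ (γ.comp α)) _ _ 0 = opList (zd ψ γ) _ _ 0
    rw [hO _ _ z, Function.comp_apply, α.map_zero]

/-- Invariants of germs that depend only on the class in the Grassmann bundle. -/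
lemma eq_of_proj_eq {β : Type*} {s : ℕ} (F : ImmGerm n m X → β)
    (h₁ : ∀ γ δ, jet s γ = jet s δ → F γ = F δ) (h₂ : ∀ γ α, F (γ.comp α) = F γ)
    {γ δ : ImmGerm n m X} (h : proj (jet s γ) = proj (jet s δ)) : F γ = F δ := by
  let G : ImmVel n m X s → β := Quotient.lift F fun a b hab => h₁ a b (Quotient.sound hab)
  let G' : Grass n m X s → β := Quot.lift G (by
    rintro v w ⟨γ, α, rfl, rfl⟩
    exact (h₂ γ α).symm)
  exact congrArg G' h

lemma InDom.of_proj_eq {s : ℕ} (hs : 1 ≤ s) {ψ : Chart n m X} {γ δ : ImmGerm n m X}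
    (h : InDom ψ γ) (hp : proj (jet s γ) = proj (jet s δ)) : InDom ψ δ := by
  have := eq_of_proj_eq (InDom ψ)
    (fun γ δ hj => propext ⟨fun h => h.of_jet_eq hs hj, fun h => h.of_jet_eq hs hj.symm⟩)
    (fun γ α => propext (inDom_comp_iff α)) hp
  exact this ▸ h

lemma adapted_eq_of_proj_eq {s : ℕ} (hs : 1 ≤ s) {ψ : Chart n m X} {γ δ : ImmGerm n m X}
    (h : InDom ψ γ) (hp : proj (jet s γ) = proj (jet s δ)) :
    adapted s ψ γ = adapted s ψ δ := by
  classical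
  -- The value `0` off the domain only serves to define the invariant on all germs, as passage to
  -- the quotient demands.
  have := eq_of_proj_eq (fun γ => if InDom ψ γ then adapted s ψ γ else 0)
    (fun γ δ hj => by
      by_cases hγ : InDom ψ γ
      · simp only [hγ, hγ.of_jet_eq hs hj, if_true, adapted_eq_of_jet_eq hs hγ hj]
      · have hδ : ¬ InDom ψ δ := fun hδ => hγ (hδ.of_jet_eq hs hj.symm)
        simp [hγ, hδ])
    (fun γ α => by
      by_cases hγ : InDom ψ γ
      · simp only [hγ, (inDom_comp_iff α).mpr hγ, if_true, adapted_comp hγ]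
      · simp [hγ, (inDom_comp_iff α).not.mpr hγ]) hp
  simpa [h, h.of_proj_eq hs hp] using this

lemma chart_proj_jet {s : ℕ} (hs : 1 ≤ s) {ψ : Chart n m X} {γ : ImmGerm n m X}
    (h : InDom ψ γ) : chart s ψ (proj (jet s γ)) = adapted s ψ γ := by
  have hex : ∃ δ, InDom ψ δ ∧ proj (jet s δ) = proj (jet s γ) := ⟨γ, h, rfl⟩
  rw [chart, dif_pos hex]
  exact adapted_eq_of_proj_eq hs hex.choose_spec.1 hex.choose_spec.2

lemma mem_chartDom_iff {s : ℕ} (hs : 1 ≤ s) {ψ : Chart n m X} {γ : ImmGerm n m X} :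
    proj (jet s γ) ∈ chartDom s ψ ↔ InDom ψ γ :=
  ⟨fun ⟨_, h, hp⟩ => h.of_proj_eq hs hp, fun h => ⟨γ, h, rfl⟩⟩

/-! ### Graphs as representatives -/

section Append

variable {n m : ℕ}

/-- `Fin.append` as a continuous linear map. -/
def appendL (n m : ℕ) : ((Fin n → ℝ) × (Fin m → ℝ)) →L[ℝ] (Fin (n + m) → ℝ) :=
  LinearMap.toContinuousLinearMap
    { toFun := fun p => Fin.append p.1 p.2
      map_add' := fun p q => by
        funext A
        refine Fin.addCases (fun i => ?_) (fun σ => ?_) A <;> simp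
      map_smul' := fun c p => by
        funext A
        refine Fin.addCases (fun i => ?_) (fun σ => ?_) A <;> simp }

@[simp] lemma appendL_apply (p : (Fin n → ℝ) × (Fin m → ℝ)) :
    appendL n m p = Fin.append p.1 p.2 := rfl

lemma contDiffOn_append {E : Type*} [NormedAddCommGroup E] [NormedSpace ℝ E] {k : WithTop ℕ∞}
    {f : E → Fin n → ℝ} {g : E → Fin m → ℝ} {O : Set E} (hf : ContDiffOn ℝ k f O)
    (hg : ContDiffOn ℝ k g O) : ContDiffOn ℝ k (fun e => Fin.append (f e) (g e)) O :=
  (appendL n m).contDiff.comp_contDiffOn (hf.prodMk hg)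

lemma hasFDerivAt_append {E : Type*} [NormedAddCommGroup E] [NormedSpace ℝ E]
    {f : E → Fin n → ℝ} {g : E → Fin m → ℝ} {e : E} {f' : E →L[ℝ] Fin n → ℝ}
    {g' : E →L[ℝ] Fin m → ℝ} (hf : HasFDerivAt f f' e) (hg : HasFDerivAt g g' e) :
    HasFDerivAt (fun e => Fin.append (f e) (g e)) ((appendL n m).comp (f'.prod g')) e :=
  (appendL n m).hasFDerivAt.comp e (hf.prodMk hg)

end Append

variable {n m : ℕ} {X : Type*} [TopologicalSpace X] [ChartedSpace (Fin (n + m) → ℝ) X]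

lemma contDiff_graph {x : Fin n → ℝ} {g : (Fin n → ℝ) → Fin m → ℝ} (hg : ContDiff ℝ ∞ g) :
    ContDiff ℝ ∞ (fun t => Fin.append (x + t) (g t)) :=
  contDiffOn_univ.mp (contDiffOn_append (contDiff_const.add contDiff_id).contDiffOn hg.contDiffOn)

/-- The germ whose coordinate expression is the graph `t ↦ (x + t, g t)`. -/
def graphGerm (ψ : Chart n m X) (x : Fin n → ℝ) (g : (Fin n → ℝ) → Fin m → ℝ)
    (hg : ContDiff ℝ ∞ g) (h : Fin.append x (g 0) ∈ ψ.1.target) : ImmGerm n m X where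
  toFun t := ψ.1.symm (Fin.append (x + t) (g t))
  smooth := by
    have hc := contDiff_graph (x := x) hg
    have ho := ψ.1.open_target.preimage hc.continuous
    filter_upwards [ho.mem_nhds (show (0 : Fin n → ℝ) ∈ _ by simpa using h)] with t ht
    exact (contMDiffAt_chart_symm ψ ht).comp t hc.contDiffAt.contMDiffAt
  immersive := by
    have hc := contDiff_graph (x := x) hg
    have ho := ψ.1.open_target.preimage hc.continuous
    filter_upwards [ho.mem_nhds (show (0 : Fin n → ℝ) ∈ _ by simpa using h)] with t ht
    have h1 : MDifferentiableAt 𝓘(ℝ, Fin n → ℝ) 𝓘(ℝ, Fin (n + m) → ℝ)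
        (fun t => ψ.1.symm (Fin.append (x + t) (g t))) t :=
      ((contMDiffAt_chart_symm ψ ht).comp t hc.contDiffAt.contMDiffAt).mdifferentiableAt (by simp)
    have h2 : MDifferentiableAt 𝓘(ℝ, Fin (n + m) → ℝ) 𝓘(ℝ, Fin (n + m) → ℝ) ψ.1
        (ψ.1.symm (Fin.append (x + t) (g t))) :=
      (contMDiffAt_chart ψ (ψ.1.map_target ht)).mdifferentiableAt (by simp)
    have h3 := mfderiv_comp t h2 h1
    have h4 : (ψ.1 ∘ fun t => ψ.1.symm (Fin.append (x + t) (g t))) =ᶠ[𝓝 t]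
        fun t => Fin.append (x + t) (g t) := by
      filter_upwards [ho.mem_nhds ht] with u hu
      exact ψ.1.right_inv hu
    have h5 : HasFDerivAt (fun t => Fin.append (x + t) (g t)) _ t :=
      hasFDerivAt_append ((hasFDerivAt_id t).const_add x)
        ((hg.differentiable (by simp)) t).hasFDerivAt
    rw [h4.mfderiv_eq, mfderiv_eq_fderiv, h5.fderiv] at h3
    -- Composing with the chart turns the germ into a graph, whose differential has the identity as
    -- its first `n` components.
    refine Function.Injective.of_comp (f := mfderiv 𝓘(ℝ, Fin (n + m) → ℝ)
      𝓘(ℝ, Fin (n + m) → ℝ) ψ.1 (ψ.1.symm (Fin.append (x + t) (g t)))) ?_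
    intro a b hab
    have h6 := fun w => congrArg (fun L => L w) h3
    have h7 := (h6 a).trans (hab.trans (h6 b).symm)
    funext i
    have h8 : ∀ w : Fin n → ℝ, ((appendL n m).comp
        ((ContinuousLinearMap.id ℝ (Fin n → ℝ)).prod (fderiv ℝ g t))) w (Fin.castAdd m i) = w i :=
      fun w => by simp
    exact (h8 a).symm.trans ((congrFun h7 _).trans (h8 b))

section Graph

variable {ψ : Chart n m X} {x : Fin n → ℝ} {g : (Fin n → ℝ) → Fin m → ℝ} {hg : ContDiff ℝ ∞ g}
  {h : Fin.append x (g 0) ∈ ψ.1.target}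

lemma isOpen_graph_mem (hg : ContDiff ℝ ∞ g) :
    IsOpen {t | Fin.append (x + t) (g t) ∈ ψ.1.target} :=
  ψ.1.open_target.preimage (contDiff_graph hg).continuous

lemma coordFun_graphGerm {t : Fin n → ℝ} (ht : Fin.append (x + t) (g t) ∈ ψ.1.target)
    (A : Fin (n + m)) : coordFun ψ (graphGerm ψ x g hg h) A t = Fin.append (x + t) (g t) A :=
  congrFun (ψ.1.right_inv ht) A

lemma graphGerm_zero : (graphGerm ψ x g hg h).toFun 0 = ψ.1.symm (Fin.append x (g 0)) := by
  simp [graphGerm]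

lemma fderiv_coordFun_graphGerm {t : Fin n → ℝ} (ht : Fin.append (x + t) (g t) ∈ ψ.1.target)
    (i : Fin n) : fderiv ℝ (coordFun ψ (graphGerm ψ x g hg h) (Fin.castAdd m i)) t =
      fderiv ℝ (stdCoord n i) t := by
  have h1 : coordFun ψ (graphGerm ψ x g hg h) (Fin.castAdd m i) =ᶠ[𝓝 t]
      fun t => x i + stdCoord n i t := by
    filter_upwards [(isOpen_graph_mem hg).mem_nhds ht] with u hu
    rw [coordFun_graphGerm hu]
    simp [stdCoord]
  rw [h1.fderiv_eq, fderiv_const_add]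

lemma jac_graphGerm : jac ψ (graphGerm ψ x g hg h) 0 = 1 := by
  rw [← frameJac_std (0 : Fin n → ℝ)]
  ext i j
  change fderiv ℝ _ _ _ = fderiv ℝ _ _ _
  rw [fderiv_coordFun_graphGerm (by simpa using h)]
  rfl

lemma inDom_graphGerm : InDom ψ (graphGerm ψ x g hg h) :=
  ⟨by rw [graphGerm_zero]; exact ψ.1.map_target h, by rw [jac_graphGerm]; simp⟩

lemma opList_zd_graphGerm (l : List (Fin n)) (A : Fin (n + m)) :
    Set.EqOn (opList (zd ψ (graphGerm ψ x g hg h)) l (coordFun ψ (graphGerm ψ x g hg h) A))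
      (opList pd l fun t => Fin.append (x + t) (g t) A)
      {t | Fin.append (x + t) (g t) ∈ ψ.1.target} := by
  rw [zd_eq_frame, pd_eq_frame]
  exact opList_frame_eq_of_fderiv_coord_eq (isOpen_graph_mem hg)
    (fun t ht i => fderiv_coordFun_graphGerm ht i) (fun t ht => coordFun_graphGerm ht A) l

lemma adapted_graphGerm (s : ℕ) : adapted s ψ (graphGerm ψ x g hg h) =
    (x, fun J σ => opList pd (idxList J.1) (fun t => g t σ) 0) := by
  have h0 : (0 : Fin n → ℝ) ∈ {t | Fin.append (x + t) (g t) ∈ ψ.1.target} := by simpa using h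
  refine Prod.ext (funext fun i => ?_) (funext fun J => funext fun σ => ?_)
  · change coordFun ψ _ _ 0 = _
    rw [coordFun_graphGerm h0]
    simp
  · change opList (zd ψ _) _ _ 0 = _
    rw [opList_zd_graphGerm _ _ h0]
    simp

end Graph

/-- The base point, in the chart of `X`, of a point of the coordinate space. -/
def basePt {s : ℕ} (e : Coords n m s) : Fin (n + m) → ℝ := Fin.append e.1 (e.2 (zeroIdx n s))

/-- The germ of the polynomial graph with given adapted coordinates. -/
def polyGerm {s : ℕ} (ψ : Chart n m X) (e : Coords n m s) (h : basePt e ∈ ψ.1.target) :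
    ImmGerm n m X :=
  graphGerm ψ e.1 (taylorFun e.2) (contDiff_taylorFun e.2) (by
    rw [show taylorFun e.2 0 = e.2 (zeroIdx n s) from funext (taylorFun_zero e.2)]
    exact h)

lemma inDom_polyGerm {s : ℕ} {ψ : Chart n m X} {e : Coords n m s}
    {h : basePt e ∈ ψ.1.target} : InDom ψ (polyGerm ψ e h) := inDom_graphGerm

lemma adapted_polyGerm {s : ℕ} {ψ : Chart n m X} {e : Coords n m s}
    {h : basePt e ∈ ψ.1.target} : adapted s ψ (polyGerm ψ e h) = e := by
  rw [polyGerm, adapted_graphGerm]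
  exact Prod.ext rfl (funext fun J => funext fun σ => opList_idxList_taylorFun e.2 σ J)

lemma basePt_adapted {s : ℕ} (ψ : Chart n m X) (γ : ImmGerm n m X) :
    basePt (adapted s ψ γ) = ψ.1 (γ.toFun 0) := by
  funext A
  refine Fin.addCases (fun i => ?_) (fun σ => ?_) A
  · simp [basePt, adapted, coordFun]
  · simp [basePt, adapted, coordFun, zeroIdx, idxList_zero]

lemma basePt_adapted_mem {s : ℕ} {ψ : Chart n m X} {γ : ImmGerm n m X}
    (h : InDom ψ γ) : basePt (adapted s ψ γ) ∈ ψ.1.target := by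
  rw [basePt_adapted]
  exact ψ.1.map_source h.1

/-- Every germ in the domain of an adapted chart can be reparametrised to agree, to any given
order, with the polynomial graph with the same adapted coordinates. -/
lemma InDom.exists_normalisation {ψ : Chart n m X} {γ : ImmGerm n m X} (h : InDom ψ γ) :
    ∃ α : DiffGerm n, (jac ψ γ 0).det * (fderiv ℝ α.toFun 0).det = 1 ∧
      ∀ s, jet s (γ.comp α) =
        jet s (polyGerm ψ (adapted s ψ γ) (basePt_adapted_mem h)) := by
  obtain ⟨O, z, f, sm, hsrc⟩ := h.exists_frameOn
  -- The centred first coordinates along `γ`. They form a local diffeomorphism fixing `0`, and its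
  -- inverse is the required reparametrisation.
  let ξ : (Fin n → ℝ) → Fin n → ℝ := fun t i =>
    coordFun ψ γ (Fin.castAdd m i) t - coordFun ψ γ (Fin.castAdd m i) 0
  have hξ : ContDiffOn ℝ ∞ ξ O := contDiffOn_pi.mpr fun i => (f.smooth i).sub contDiffOn_const
  have hξd : ∀ t ∈ O, (fderiv ℝ ξ t).det ≠ 0 := fun t ht => by
    rw [det_fderiv_eq (differentiableAt_of_contDiffOn f.isOpen hξ ht)]
    have : frameJac (stdVec n) (fun i t => ξ t i) t =
        frameJac (stdVec n) (fun i => coordFun ψ γ (Fin.castAdd m i)) t := by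
      ext i j
      simp only [frameJac, Matrix.of_apply, ξ]
      rw [fderiv_sub_const]
    rw [this]
    exact f.det_ne t ht
  have hξe : ∀ t (ht : t ∈ O), HasFDerivAt ξ
      (((fderiv ℝ ξ t).toContinuousLinearEquivOfDetNeZero (hξd t ht) :
        (Fin n → ℝ) ≃L[ℝ] (Fin n → ℝ)) : (Fin n → ℝ) →L[ℝ] (Fin n → ℝ)) t := fun t ht => by
    rw [ContinuousLinearMap.coe_toContinuousLinearEquivOfDetNeZero]
    exact (differentiableAt_of_contDiffOn f.isOpen hξ ht).hasFDerivAt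
  have hξc := fun t (ht : t ∈ O) => hξ.contDiffAt (f.isOpen.mem_nhds ht)
  let Φ := (hξc 0 z).toOpenPartialHomeomorph ξ (hξe 0 z) (by simp)
  have hΦ : (Φ : (Fin n → ℝ) → Fin n → ℝ) = ξ := rfl
  have h0s : (0 : Fin n → ℝ) ∈ Φ.source :=
    (hξc 0 z).mem_toOpenPartialHomeomorph_source (hξe 0 z) (by simp)
  have hξ0 : ξ 0 = 0 := by funext i; simp [ξ]
  have h0t : (0 : Fin n → ℝ) ∈ Φ.target := by
    have := Φ.map_source h0s
    rwa [hΦ, hξ0] at this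
  have hs0 : Φ.symm 0 = 0 := by
    have := Φ.left_inv h0s
    rwa [hΦ, hξ0] at this
  let U : Set (Fin n → ℝ) := Φ.target ∩ Φ.symm ⁻¹' O
  have hU : IsOpen U := Φ.isOpen_inter_preimage_symm f.isOpen
  have h0U : (0 : Fin n → ℝ) ∈ U := ⟨h0t, by rwa [Set.mem_preimage, hs0]⟩
  have hsm : ∀ u ∈ U, ContDiffAt ℝ ∞ Φ.symm u := fun u hu =>
    Φ.contDiffAt_symm hu.1 (hξe _ hu.2) (hξc _ hu.2)
  have hinv : ∀ u ∈ U, ξ (Φ.symm u) = u := fun u hu => Φ.right_inv hu.1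
  have hdet : (fderiv ℝ ξ 0).det * (fderiv ℝ Φ.symm 0).det = 1 := by
    have h1 : (fun u => ξ (Φ.symm u)) =ᶠ[𝓝 0] id :=
      Filter.eventuallyEq_of_mem (hU.mem_nhds h0U) hinv
    have h2 : fderiv ℝ (fun u => ξ (Φ.symm u)) 0 = (fderiv ℝ ξ 0).comp (fderiv ℝ Φ.symm 0) := by
      have := fderiv_comp (0 : Fin n → ℝ) (g := ξ) (f := Φ.symm)
        (by rw [hs0]; exact (hξc 0 z).differentiableAt (by simp))
        ((hsm 0 h0U).differentiableAt (by simp))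
      rwa [hs0] at this
    rw [h1.fderiv_eq, fderiv_id] at h2
    have h3 := congrArg ContinuousLinearMap.det h2
    have h4 : ((fderiv ℝ ξ 0).comp (fderiv ℝ Φ.symm 0)).det =
        (fderiv ℝ ξ 0).det * (fderiv ℝ Φ.symm 0).det := LinearMap.det_comp _ _
    rw [← h4, ← h3]
    exact LinearMap.det_id
  let α : DiffGerm n :=
    { toFun := Φ.symm
      map_zero := hs0
      smooth := Filter.eventually_of_mem (hU.mem_nhds h0U) hsm
      det_ne_zero := right_ne_zero_of_mul_eq_one hdet }
  have hjac : (jac ψ γ 0).det = (fderiv ℝ ξ 0).det := by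
    rw [det_fderiv_eq ((hξc 0 z).differentiableAt (by simp))]
    congr 1
    ext i j
    change fderiv ℝ _ _ _ = fderiv ℝ (fun t => ξ t i) _ _
    simp only [ξ]
    rw [fderiv_sub_const]
    rfl
  refine ⟨α, by rw [hjac]; exact hdet, fun s => ?_⟩
  have hγα0 : (γ.comp α).toFun 0 = γ.toFun 0 := congrArg γ.toFun hs0
  have hdα : InDom ψ (γ.comp α) := (inDom_comp_iff α).mpr h
  have hp0 : (polyGerm ψ (adapted s ψ γ) (basePt_adapted_mem h)).toFun 0 = γ.toFun 0 := by
    rw [polyGerm, graphGerm_zero, show taylorFun (adapted s ψ γ).2 0 =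
      (adapted s ψ γ).2 (zeroIdx n s) from funext (taylorFun_zero _)]
    change ψ.1.symm (basePt (adapted s ψ γ)) = _
    rw [basePt_adapted, ψ.1.left_inv h.1]
  refine jet_eq_of_chart ψ hdα.1 (hγα0.trans hp0.symm) fun A => ?_
  obtain ⟨O₁, z₁, f₁, sm₁, -⟩ := hdα.exists_frameOn
  obtain ⟨O₂, z₂, f₂, sm₂, -⟩ := (inDom_polyGerm (h := basePt_adapted_mem (s := s) h)).exists_frameOn
  have hx : ∀ i : Fin n, ∀ t ∈ U, coordFun ψ (γ.comp α) (Fin.castAdd m i) t =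
      coordFun ψ γ (Fin.castAdd m i) 0 + t i := fun i t ht => by
    have := congrFun (hinv t ht) i
    simp only [ξ] at this
    rw [← this]
    change coordFun ψ γ (Fin.castAdd m i) (Φ.symm t) = _
    ring
  set T : Set (Fin n → ℝ) := {t | Fin.append ((adapted s ψ γ).1 + t)
    (taylorFun (adapted s ψ γ).2 t) ∈ ψ.1.target} with hT
  have hTo : IsOpen T := isOpen_graph_mem (contDiff_taylorFun _)
  have hT0 : (0 : Fin n → ℝ) ∈ T := by
    have := basePt_adapted_mem (s := s) h
    rw [basePt] at this
    simp only [hT, Set.mem_ofPred_eq, add_zero]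
    rwa [show taylorFun (adapted s ψ γ).2 0 = (adapted s ψ γ).2 (zeroIdx n s) from
      funext (taylorFun_zero _)]
  refine Fin.addCases (fun i => ?_) (fun σ => ?_) A
  -- Both germs have first coordinates equal to a constant plus `t`, exactly and not merely to
  -- finite order.
  · refine JetEq.congr (hU.inter hTo) ⟨h0U, hT0⟩
      (JetEq.refl s 0 fun t => coordFun ψ γ (Fin.castAdd m i) 0 + t i) (fun t ht => hx i t ht.1)
      fun t ht => ?_
    rw [polyGerm, coordFun_graphGerm ht.2]
    simp [adapted]
  -- For both germs the operators `z^j_i d_j` have become plain partial derivatives, so equality of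
  -- adapted coordinates is equality of derivatives.
  · refine jetEq_of_multiIdx (f₁.isOpen.inter f₂.isOpen) ⟨z₁, z₂⟩
      ((sm₁ _).mono Set.inter_subset_left) ((sm₂ _).mono Set.inter_subset_right) fun J hJ => ?_
    have e1 : adapted s ψ (γ.comp α) =
        adapted s ψ (polyGerm ψ (adapted s ψ γ) (basePt_adapted_mem h)) := by
      rw [adapted_comp h, adapted_polyGerm]
    have e2 : opList (zd ψ (γ.comp α)) (idxList J) (coordFun ψ (γ.comp α) (Fin.natAdd n σ)) 0 =
      opList (zd ψ (polyGerm ψ (adapted s ψ γ) (basePt_adapted_mem h))) (idxList J)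
        (coordFun ψ (polyGerm ψ (adapted s ψ γ) (basePt_adapted_mem h)) (Fin.natAdd n σ)) 0 :=
      congrFun (congrFun (congrArg Prod.snd e1) ⟨J, hJ⟩) σ
    have e3 : Set.EqOn (opList (zd ψ (γ.comp α)) (idxList J)
        (coordFun ψ (γ.comp α) (Fin.natAdd n σ)))
        (opList pd (idxList J) (coordFun ψ (γ.comp α) (Fin.natAdd n σ))) U := by
      rw [zd_eq_frame, pd_eq_frame]
      refine opList_frame_eq_of_fderiv_coord_eq hU (fun t ht i => ?_) (fun _ _ => rfl) _
      have : coordFun ψ (γ.comp α) (Fin.castAdd m i) =ᶠ[𝓝 t]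
          fun t => coordFun ψ γ (Fin.castAdd m i) 0 + stdCoord n i t :=
        Filter.eventuallyEq_of_mem (hU.mem_nhds ht) (hx i)
      rw [this.fderiv_eq, fderiv_const_add]
    have e4 : Set.EqOn (opList (zd ψ (polyGerm ψ (adapted s ψ γ) (basePt_adapted_mem h)))
        (idxList J) (coordFun ψ (polyGerm ψ (adapted s ψ γ) (basePt_adapted_mem h))
          (Fin.natAdd n σ)))
        (opList pd (idxList J) (coordFun ψ (polyGerm ψ (adapted s ψ γ) (basePt_adapted_mem h))
          (Fin.natAdd n σ))) T := by
      rw [zd_eq_frame, pd_eq_frame]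
      exact opList_frame_eq_of_fderiv_coord_eq hTo
        (fun t ht i => fderiv_coordFun_graphGerm ht i) (fun _ _ => rfl) _
    rw [← e3 h0U, ← e4 hT0, e2]

lemma proj_jet_eq_polyGerm {s : ℕ} {ψ : Chart n m X} {γ : ImmGerm n m X}
    (h : InDom ψ γ) : proj (jet s γ) =
      proj (jet s (polyGerm ψ (adapted s ψ γ) (basePt_adapted_mem h))) := by
  obtain ⟨α, -, hα⟩ := h.exists_normalisation
  rw [← hα s]
  exact Quot.sound ⟨γ, α, rfl, rfl⟩

lemma chart_polyGerm {s : ℕ} (hs : 1 ≤ s) {ψ : Chart n m X} {e : Coords n m s}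
    (h : basePt e ∈ ψ.1.target) : chart s ψ (proj (jet s (polyGerm ψ e h))) = e := by
  rw [chart_proj_jet hs inDom_polyGerm, adapted_polyGerm]

/-- Every coordinate point over the target of `ψ` is realised by its polynomial graph, so only the
base point is constrained and the derivative coordinates are free. -/
lemma chartTarget_eq {s : ℕ} (hs : 1 ≤ s) (ψ : Chart n m X) :
    chartTarget s ψ = {e | basePt e ∈ ψ.1.target} := by
  ext e
  constructor
  · rintro ⟨_, ⟨γ, h, rfl⟩, rfl⟩
    rw [chart_proj_jet hs h]
    exact basePt_adapted_mem h
  · intro h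
    exact ⟨_, ⟨_, inDom_polyGerm, rfl⟩, chart_polyGerm hs h⟩

lemma polyGerm_chart {s : ℕ} (hs : 1 ≤ s) {ψ : Chart n m X} {p : Grass n m X s}
    (hp : p ∈ chartDom s ψ) (h : basePt (chart s ψ p) ∈ ψ.1.target) :
    proj (jet s (polyGerm ψ (chart s ψ p) h)) = p := by
  obtain ⟨γ, hγ, rfl⟩ := hp
  -- The point is made a variable because the membership proof inside `polyGerm` depends on it and
  -- blocks rewriting.
  have key : ∀ (e : Coords n m s) (h : basePt e ∈ ψ.1.target), e = adapted s ψ γ →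
      proj (jet s (polyGerm ψ e h)) = proj (jet s γ) := by
    rintro e h rfl
    exact (proj_jet_eq_polyGerm hγ).symm
  exact key _ h (chart_proj_jet hs hγ)

lemma chart_injOn {s : ℕ} (hs : 1 ≤ s) {ψ : Chart n m X} {p q : Grass n m X s}
    (hp : p ∈ chartDom s ψ) (hq : q ∈ chartDom s ψ) (h : chart s ψ p = chart s ψ q) : p = q := by
  have ht : ∀ p ∈ chartDom s ψ, basePt (chart s ψ p) ∈ ψ.1.target := fun p hp => by
    have : chart s ψ p ∈ chartTarget s ψ := ⟨p, hp, rfl⟩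
    rwa [chartTarget_eq hs] at this
  rw [← polyGerm_chart hs hp (ht p hp), ← polyGerm_chart hs hq (ht q hq)]
  congr 3

lemma transition_chart {s : ℕ} (hs : 1 ≤ s) {ψ ψ' : Chart n m X} {p : Grass n m X s}
    (hp : p ∈ chartDom s ψ) : transition s ψ ψ' (chart s ψ p) = chart s ψ' p := by
  have hex : ∃ q ∈ chartDom s ψ, chart s ψ q = chart s ψ p := ⟨p, hp, rfl⟩
  rw [transition, dif_pos hex, chart_injOn hs hex.choose_spec.1 hp hex.choose_spec.2]

/-- `basePt` as a continuous linear map. -/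
def basePtL (n m s : ℕ) : Coords n m s →L[ℝ] (Fin (n + m) → ℝ) :=
  (appendL n m).comp ((ContinuousLinearMap.fst ℝ _ _).prod
    ((ContinuousLinearMap.proj (R := ℝ) (φ := fun _ : MultiIdx n s => Fin m → ℝ)
      (zeroIdx n s)).comp (ContinuousLinearMap.snd ℝ _ _)))

@[simp] lemma basePtL_apply {s : ℕ} (e : Coords n m s) : basePtL n m s e = basePt e := rfl

/-! ### The local Lagrangian -/

open Classical in
/-- The value of a homogeneous Lagrangian on polynomial graphs. -/
def localLagrangian {r : ℕ} (𝓛 : ImmVel n m X r → ℝ) (ψ : Chart n m X) (e : Coords n m r) : ℝ :=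
  if h : basePt e ∈ ψ.1.target then 𝓛 (jet r (polyGerm ψ e h)) else 0

/-- The normalising reparametrisation has determinant inverse to `det 𝐱`, so homogeneity restores
exactly the factor `det 𝐱`. -/
lemma isLocalLagrangian_localLagrangian {r : ℕ} (hr : 1 ≤ r) {𝓛 : ImmVel n m X r → ℝ}
    (h𝓛 : IsHomogeneousLagrangian 𝓛) (ψ : Chart n m X) :
    IsLocalLagrangian 𝓛 ψ (localLagrangian 𝓛 ψ) := by
  intro γ hγ
  obtain ⟨α, hd, hα⟩ := hγ.exists_normalisation
  have h1 := h𝓛.homogeneous γ α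
  rw [chart_proj_jet hr hγ, localLagrangian, dif_pos (basePt_adapted_mem hγ), ← hα r, h1,
    ← mul_assoc, hd, one_mul]

lemma velCoord_polyGerm {r : ℕ} {ψ : Chart n m X} {e : Coords n m r}
    (h : basePt e ∈ ψ.1.target) (J : MultiIdx n r) (A : Fin (n + m)) :
    velCoord r ψ (polyGerm ψ e h) J A = Fin.append
      (fun i => (if J.1 = 0 then e.1 i else 0) + opList pd (idxList J.1) (stdCoord n i) 0)
      (fun σ => e.2 J σ) A := by
  have hT0 : (0 : Fin n → ℝ) ∈ {t | Fin.append (e.1 + t) (taylorFun e.2 t) ∈ ψ.1.target} := by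
    simp only [Set.mem_ofPred_eq, add_zero]
    rw [show taylorFun e.2 0 = e.2 (zeroIdx n r) from funext (taylorFun_zero _)]
    exact h
  have h1 : velCoord r ψ (polyGerm ψ e h) J A =
      opList pd (idxList J.1) (fun t => Fin.append (e.1 + t) (taylorFun e.2 t) A) 0 :=
    opList_pd_congr (isOpen_graph_mem (contDiff_taylorFun e.2))
      (fun t ht => coordFun_graphGerm ht A) _ hT0
  rw [h1]
  refine Fin.addCases (fun i => ?_) (fun σ => ?_) A
  · simp only [Fin.append_left, Pi.add_apply]
    -- The constant is written as a multiple of the monomial of exponent `0`, whose derivatives at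
    -- `0` are already known.
    have h2 : (fun t : Fin n → ℝ => e.1 i + t i) =
        fun t => e.1 i * monomialFun 0 t + stdCoord n i t := by
      funext t
      simp [monomialFun, stdCoord]
    rw [h2]
    have h3 := opList_monomialFun (idxList J.1) 0
    rw [pd_eq_frame] at h3 ⊢
    have hm : ContDiff ℝ ∞ (monomialFun (0 : Fin n → ℕ)) := contDiff_monomialFun 0
    have h4 := (frameOn_std isOpen_univ).opList_add
      (contDiff_const (c := e.1 i) |>.mul hm).contDiffOn
      (contDiff_apply ℝ ℝ i).contDiffOn (idxList J.1) (Set.mem_univ (0 : Fin n → ℝ))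
    refine h4.trans ?_
    have h5 := (frameOn_std isOpen_univ).opList_const_mul (e.1 i) hm.contDiffOn (idxList J.1)
      (Set.mem_univ (0 : Fin n → ℝ))
    refine congrArg₂ (· + ·) (h5.trans ?_) rfl
    simp only [h3]
    simp [idxList_count]
  · simp only [Fin.append_right]
    exact opList_idxList_taylorFun e.2 σ J

/-- The polynomial graph of `e` has velocity coordinates `V e` that are affine in `e`, so the local
Lagrangian is the smooth coordinate expression of `𝓛` composed with `V`. -/
lemma contDiffOn_localLagrangian {r : ℕ} (hr : 1 ≤ r) {𝓛 : ImmVel n m X r → ℝ}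
    (h𝓛 : IsHomogeneousLagrangian 𝓛) (ψ : Chart n m X) :
    ContDiffOn ℝ ∞ (localLagrangian 𝓛 ψ) (chartTarget r ψ) := by
  obtain ⟨f, hf, hff⟩ := h𝓛.smooth ψ
  let V : Coords n m r → MultiIdx n r → Fin (n + m) → ℝ := fun e J => Fin.append
      (fun i => (if J.1 = 0 then e.1 i else 0) + opList pd (idxList J.1) (stdCoord n i) 0)
      (fun σ => e.2 J σ)
  have hV : ContDiff ℝ ∞ V := by
    refine contDiff_pi.mpr fun J => contDiffOn_univ.mp (contDiffOn_append ?_ ?_)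
    · refine (contDiff_pi.mpr fun i => ContDiff.add ?_ contDiff_const).contDiffOn
      split_ifs
      · exact (contDiff_apply ℝ ℝ i).comp contDiff_fst
      · exact contDiff_const
    · exact ((contDiff_apply ℝ (Fin m → ℝ) J).comp contDiff_snd).contDiffOn
  have hpoly : ∀ e (h : basePt e ∈ ψ.1.target), velCoord r ψ (polyGerm ψ e h) = V e :=
    fun e h => funext fun J => funext fun A => velCoord_polyGerm h J A
  rw [chartTarget_eq hr]
  refine (hf.comp hV.contDiffOn (s := {e | basePt e ∈ ψ.1.target}) fun e he => ?_).congr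
    fun e (he : basePt e ∈ ψ.1.target) => ?_
  · exact ⟨polyGerm ψ e he, inDom_polyGerm.1, hpoly e he⟩
  · rw [localLagrangian, dif_pos he, hff _ inDom_polyGerm.1, hpoly e he]
    rfl

lemma IsLocalLagrangian.eqOn {r : ℕ} {𝓛 : ImmVel n m X r → ℝ} {ψ : Chart n m X}
    {L L' : Coords n m r → ℝ} (h : IsLocalLagrangian 𝓛 ψ L) (h' : IsLocalLagrangian 𝓛 ψ L') :
    Set.EqOn L L' (chartTarget r ψ) := by
  rintro _ ⟨_, ⟨γ, hγ, rfl⟩, rfl⟩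
  exact mul_left_cancel₀ hγ.2 ((h γ hγ).symm.trans (h' γ hγ))

/-! ### Prolongations and total derivatives -/

section Prolong

variable {E : Type*} [NormedAddCommGroup E] [NormedSpace ℝ E] {n m s r k : ℕ}
  {O : Set E} {v : Fin n → E} {x : Fin n → E → ℝ} {y : Fin m → E → ℝ}

/-- The prolongation to order `s` of the functions `y`, with independent variables `x`. -/
def prolong (s : ℕ) (v : Fin n → E) (x : Fin n → E → ℝ) (y : Fin m → E → ℝ) (e : E) :
    Coords n m s :=
  (fun i => x i e, fun J σ => opList (frame v x) (idxList J.1) (y σ) e)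

lemma FrameOn.dirDeriv_eq_sum (h : FrameOn O v x) {e : E} (he : e ∈ O) (j : Fin n) (f : E → ℝ) :
    dirDeriv (v j) f e = ∑ i, frameJac v x e i j * frame v x i f e := by
  have h1 := h.inv_mul he
  simp only [frame_eq_sum, Finset.mul_sum]
  rw [Finset.sum_comm]
  have h2 : ∀ b, ∑ i, frameJac v x e i j * ((frameJac v x e)⁻¹ b i * dirDeriv (v b) f e) =
      (if b = j then 1 else 0) * dirDeriv (v b) f e := fun b => by
    rw [← Matrix.one_apply, ← h1, Matrix.mul_apply, Finset.sum_mul]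
    exact Finset.sum_congr rfl fun i _ => by ring
  simp [h2]

lemma FrameOn.contDiffOn_prolong (h : FrameOn O v x) (hy : ∀ σ, ContDiffOn ℝ ∞ (y σ) O) :
    ContDiffOn ℝ ∞ (prolong s v x y) O :=
  (contDiffOn_pi.mpr h.smooth).prodMk
    (contDiffOn_pi.mpr fun _ => contDiffOn_pi.mpr fun σ => h.contDiffOn_opList (hy σ) _)

lemma basePt_prolong (e : E) :
    basePt (prolong s v x y e) = Fin.append (fun i => x i e) (fun σ => y σ e) := by
  simp [basePt, prolong, zeroIdx, idxList_zero]

lemma yCoord_prolong {J : Fin n → ℕ} (hJ : ∑ i, J i ≤ s) (e : E) (σ : Fin m) :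
    yCoord (prolong s v x y e) J σ = opList (frame v x) (idxList J) (y σ) e := by
  simp [yCoord, hJ, prolong]

lemma trunc_prolong (hrs : r ≤ s) (e : E) :
    trunc r (prolong s v x y e) = prolong r v x y e :=
  Prod.ext rfl (funext fun J => funext fun σ => yCoord_prolong (J.2.trans hrs) e σ)

lemma basePt_trunc (e : Coords n m s) : basePt (trunc r e) = basePt e := by
  simp [basePt, trunc, yCoord, zeroIdx]

/-- The projection to lower order as a continuous linear map. -/
def truncL (n m s r : ℕ) : Coords n m s →L[ℝ] Coords n m r :=
  LinearMap.toContinuousLinearMap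
    { toFun := trunc r
      map_add' := fun e e' => by
        refine Prod.ext rfl (funext fun J => funext fun σ => ?_)
        simp only [trunc, yCoord, Prod.snd_add, Pi.add_apply]
        split_ifs <;> simp
      map_smul' := fun c e => by
        refine Prod.ext rfl (funext fun J => funext fun σ => ?_)
        simp only [trunc, yCoord, Prod.smul_snd, Pi.smul_apply, smul_eq_mul, RingHom.id_apply]
        split_ifs <;> simp }

@[simp] lemma truncL_apply (e : Coords n m s) : truncL n m s r e = trunc r e := rfl

/-- `F` depends only on the coordinates of order at most `k`. -/
def DependsOnOrder (k : ℕ) (F : Coords n m s → ℝ) : Prop :=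
  ∀ e e', trunc k e = trunc k e' → F e = F e'

lemma DependsOnOrder.fderiv_eq_zero {F : Coords n m s → ℝ} (hF : DependsOnOrder k F)
    (e : Coords n m s) {w : Coords n m s} (hw : trunc k w = 0) : fderiv ℝ F e w = 0 := by
  by_cases hd : DifferentiableAt ℝ F e
  · have h1 := hd.hasFDerivAt.hasLineDerivAt w
    have h2 : (fun τ : ℝ => F (e + τ • w)) = fun _ => F e := by
      funext τ
      apply hF
      rw [← truncL_apply, map_add, map_smul, truncL_apply, truncL_apply, hw, smul_zero, add_zero]
    unfold HasLineDerivAt at h1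
    rw [h2] at h1
    exact h1.unique (hasDerivAt_const _ _)
  -- Without differentiability `fderiv` is zero by convention, so the conclusion holds for arbitrary
  -- `F`.
  · rw [fderiv_zero_of_not_differentiableAt hd]
    rfl

/-- The function is invariant under translation by `e' - e`, whose coordinates of order at most `k`
vanish; hence so is its differential. -/
lemma DependsOnOrder.fderiv_eq {F : Coords n m s → ℝ} (hF : DependsOnOrder k F)
    {e e' : Coords n m s} (h : trunc k e = trunc k e') : fderiv ℝ F e = fderiv ℝ F e' := by
  have h1 : F = fun u => F (u + (e' - e)) := by
    funext u
    apply hF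
    rw [← truncL_apply, ← truncL_apply, map_add, map_sub, truncL_apply, truncL_apply,
      truncL_apply, h, sub_self, add_zero]
  conv_lhs => rw [h1]
  rw [fderiv_comp_add_right]
  congr 1
  abel

lemma trunc_eq_of_trunc_succ_eq {e e' : Coords n m s} (h : trunc (k + 1) e = trunc (k + 1) e') :
    trunc k e = trunc k e' :=
  Prod.ext (Prod.ext_iff.mp h).1 (funext fun J => congrFun (Prod.ext_iff.mp h).2
    ⟨J.1, J.2.trans k.le_succ⟩)

lemma trunc_sub_eq_zero {e e' : Coords n m s} (h : trunc k e = trunc k e') :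
    trunc k (e - e') = 0 := by
  rw [← truncL_apply, map_sub, truncL_apply, truncL_apply, h, sub_self]

lemma sum_add_unitIdx (J : Fin n → ℕ) (i : Fin n) :
    ∑ l, (J + unitIdx i) l = ∑ l, J l + 1 := by
  simp [Finset.sum_add_distrib, sum_unitIdx]

/-- Only the components of `totalVec` of order at most `k` pair with the differential of `F`, and
they involve coordinates of one order more. -/
lemma DependsOnOrder.totalD {F : Coords n m s → ℝ} (hF : DependsOnOrder k F) (i : Fin n) :
    DependsOnOrder (k + 1) (totalD i F) := by
  intro e e' h
  simp only [GrassmannBundle.totalD]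
  rw [hF.fderiv_eq (trunc_eq_of_trunc_succ_eq h), ← sub_eq_zero, ← map_sub]
  refine hF.fderiv_eq_zero _ (trunc_sub_eq_zero ?_)
  refine Prod.ext rfl (funext fun J => funext fun σ => ?_)
  simp only [trunc, totalVec, yCoord]
  split_ifs with h1 h2
  · have hJ : ∑ l, (J.1 + unitIdx i) l ≤ k + 1 := by
      rw [sum_add_unitIdx]
      exact Nat.succ_le_succ J.2
    have := congrFun (congrFun (congrArg Prod.snd h) ⟨_, hJ⟩) σ
    simpa only [trunc, yCoord, h2, dif_pos] using this
  all_goals rfl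

lemma contDiffOn_totalD {T : Set (Coords n m s)} (hT : IsOpen T) {F : Coords n m s → ℝ}
    (hF : ContDiffOn ℝ ∞ F T) (i : Fin n) : ContDiffOn ℝ ∞ (totalD i F) T := by
  refine (hF.fderiv_of_isOpen hT (m := ∞) (by simp)).clm_apply (ContDiff.contDiffOn ?_)
  refine contDiff_const.prodMk (contDiff_pi.mpr fun J => contDiff_pi.mpr fun σ => ?_)
  simp only [yCoord]
  split_ifs with h
  · exact (contDiff_apply_apply ℝ ℝ _ σ).comp contDiff_snd
  · exact contDiff_const

lemma FrameOn.fderiv_prolong (h : FrameOn O v x) (hy : ∀ σ, ContDiffOn ℝ ∞ (y σ) O) {e : E}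
    (he : e ∈ O) (w : E) : fderiv ℝ (prolong s v x y) e w =
      (fun i => dirDeriv w (x i) e,
        fun J σ => dirDeriv w (opList (frame v x) (idxList J.1) (y σ)) e) := by
  have h1 : HasFDerivAt (prolong s v x y)
      ((ContinuousLinearMap.pi fun i => fderiv ℝ (x i) e).prod (ContinuousLinearMap.pi fun J =>
        ContinuousLinearMap.pi fun σ =>
          fderiv ℝ (opList (frame v x) (idxList J.1) (y σ)) e)) e := by
    refine HasFDerivAt.prodMk (hasFDerivAt_pi.mpr fun i => ?_)
      (hasFDerivAt_pi.mpr fun J => hasFDerivAt_pi.mpr fun σ => ?_)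
    · exact (differentiableAt_of_contDiffOn h.isOpen (h.smooth i) he).hasFDerivAt
    · exact (differentiableAt_of_contDiffOn h.isOpen (h.contDiffOn_opList (hy σ) _) he).hasFDerivAt
  rw [h1.fderiv]
  rfl

/-- A prolongation sends the frame field to the total derivative field except in the components of
top order `s`, where `totalVec` is cut off to `0`. The bound `k < s` keeps `F` from seeing them. -/
lemma FrameOn.frame_comp_prolong (h : FrameOn O v x) (hy : ∀ σ, ContDiffOn ℝ ∞ (y σ) O)
    {e : E} (he : e ∈ O) {F : Coords n m s → ℝ} (hF : DifferentiableAt ℝ F (prolong s v x y e))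
    (hk : DependsOnOrder k F) (hks : k < s) (i : Fin n) :
    frame v x i (F ∘ prolong s v x y) e = totalD i F (prolong s v x y e) := by
  simp only [frame, totalD]
  rw [fderiv_comp e hF (differentiableAt_of_contDiffOn h.isOpen (h.contDiffOn_prolong hy) he),
    ContinuousLinearMap.comp_apply, ← sub_eq_zero, ← map_sub, h.fderiv_prolong hy he]
  refine hk.fderiv_eq_zero _ (trunc_sub_eq_zero ?_)
  refine Prod.ext (funext fun l => ?_) (funext fun J => funext fun σ => ?_)
  · change frame v x i (x l) e = (Pi.single i 1 : Fin n → ℝ) l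
    rw [h.frame_coord he, Pi.single_apply]
  · have hJ : ∑ l, J.1 l ≤ s := J.2.trans hks.le
    have hJ' : ∑ l, (J.1 + unitIdx i) l ≤ s := by
      rw [sum_add_unitIdx]
      exact (Nat.succ_le_succ J.2).trans hks
    simp only [trunc, totalVec]
    rw [yCoord, yCoord, dif_pos hJ, dif_pos hJ]
    simp only [yCoord_prolong hJ']
    rw [h.opList_perm (hy σ) (idxList_add_unit J.1 i) he]
    rfl

lemma FrameOn.opList_comp_prolong (h : FrameOn O v x) (hy : ∀ σ, ContDiffOn ℝ ∞ (y σ) O)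
    {T : Set (Coords n m s)} (hT : IsOpen T) (hm : Set.MapsTo (prolong s v x y) O T)
    {F : Coords n m s → ℝ} (hF : ContDiffOn ℝ ∞ F T) (hk : DependsOnOrder k F)
    (l : List (Fin n)) (hl : k + l.length ≤ s) :
    Set.EqOn (opList (frame v x) l (F ∘ prolong s v x y))
      (opList totalD l F ∘ prolong s v x y) O := by
  have key : ∀ l : List (Fin n), ContDiffOn ℝ ∞ (opList totalD l F) T ∧
      DependsOnOrder (k + l.length) (opList totalD l F) := by
    intro l
    induction l with
    | nil => exact ⟨hF, hk⟩
    | cons i l ih => exact ⟨contDiffOn_totalD hT ih.1 i, ih.2.totalD i⟩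
  induction l with
  | nil => exact fun _ _ => rfl
  | cons i l ih =>
    simp only [List.length_cons] at hl
    intro e he
    rw [opList_cons, frame_congr h.isOpen i (ih (by omega)) he]
    exact h.frame_comp_prolong hy he (differentiableAt_of_contDiffOn hT (key l).1 (hm he))
      (key l).2 (by omega) i

/-- The points of the coordinate space over an open set. -/
def overSet (n m s : ℕ) (Ω : Set (Fin (n + m) → ℝ)) : Set (Coords n m s) :=
  {e | basePt e ∈ Ω}

lemma isOpen_overSet {Ω : Set (Fin (n + m) → ℝ)} (hΩ : IsOpen Ω) : IsOpen (overSet n m s Ω) :=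
  hΩ.preimage (basePtL n m s).continuous

lemma contDiffOn_fderiv_trunc {Ω : Set (Fin (n + m) → ℝ)} (hΩ : IsOpen Ω)
    {L : Coords n m r → ℝ} (hL : ContDiffOn ℝ ∞ L (overSet n m r Ω)) (w : Coords n m r) :
    ContDiffOn ℝ ∞ (fun e' => fderiv ℝ L (trunc r e') w) (overSet n m s Ω) := by
  have h1 := contDiffOn_dirDeriv (isOpen_overSet hΩ) hL w
  refine h1.comp (truncL n m s r).contDiff.contDiffOn fun e he => ?_
  change basePt (trunc r e) ∈ Ω
  rw [basePt_trunc]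
  exact he

lemma contDiffOn_opList_totalD {T : Set (Coords n m s)} (hT : IsOpen T) {F : Coords n m s → ℝ}
    (hF : ContDiffOn ℝ ∞ F T) (l : List (Fin n)) : ContDiffOn ℝ ∞ (opList totalD l F) T := by
  induction l with
  | nil => exact hF
  | cons i l ih => exact contDiffOn_totalD hT ih i

lemma contDiffOn_eulerLagrange {Ω : Set (Fin (n + m) → ℝ)} (hΩ : IsOpen Ω)
    {L : Coords n m r → ℝ} (hL : ContDiffOn ℝ ∞ L (overSet n m r Ω)) (σ : Fin m) :
    ContDiffOn ℝ ∞ (eulerLagrange s L σ) (overSet n m s Ω) :=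
  ContDiffOn.sum fun _ _ => contDiffOn_const.mul
    (contDiffOn_opList_totalD (isOpen_overSet hΩ) (contDiffOn_fderiv_trunc hΩ hL _) _)

lemma opList_totalD_congr {T : Set (Coords n m s)} (hT : IsOpen T) {F F' : Coords n m s → ℝ}
    (hF : Set.EqOn F F' T) (l : List (Fin n)) :
    Set.EqOn (opList totalD l F) (opList totalD l F') T := by
  induction l with
  | nil => exact hF
  | cons i l ih =>
    intro e he
    simp only [opList_cons, totalD]
    rw [(Filter.eventuallyEq_of_mem (hT.mem_nhds he) ih).fderiv_eq]

lemma eulerLagrange_congr {Ω : Set (Fin (n + m) → ℝ)} (hΩ : IsOpen Ω)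
    {L L' : Coords n m r → ℝ} (hL : Set.EqOn L L' (overSet n m r Ω)) (σ : Fin m) :
    Set.EqOn (eulerLagrange s L σ) (eulerLagrange s L' σ) (overSet n m s Ω) := by
  intro e he
  simp only [eulerLagrange]
  refine Finset.sum_congr rfl fun J _ => ?_
  congr 1
  refine opList_totalD_congr (isOpen_overSet hΩ) (fun e' he' => ?_) _ he
  have : trunc r e' ∈ overSet n m r Ω := by
    change basePt (trunc r e') ∈ Ω
    rw [basePt_trunc]
    exact he'
  exact dirDeriv_congr (isOpen_overSet hΩ) hL _ this

/-- A partial derivative of `L` has order at most `r` and is hit by at most `r` total derivatives,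
so `2 * r ≤ s` keeps the truncation of `totalVec` invisible. -/
lemma FrameOn.eulerLagrange_prolong (h : FrameOn O v x) (hy : ∀ σ, ContDiffOn ℝ ∞ (y σ) O)
    (hs : 2 * r ≤ s) {Ω : Set (Fin (n + m) → ℝ)} (hΩ : IsOpen Ω)
    (hm : ∀ e ∈ O, Fin.append (fun i => x i e) (fun σ => y σ e) ∈ Ω)
    {L : Coords n m r → ℝ} (hL : ContDiffOn ℝ ∞ L (overSet n m r Ω)) (σ : Fin m) {e : E}
    (he : e ∈ O) : eulerLagrange s L σ (prolong s v x y e) =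
      ∑ J : MultiIdx n r, (-1 : ℝ) ^ (∑ i, J.1 i) * opList (frame v x) (idxList J.1)
        (fun e => fderiv ℝ L (prolong r v x y e) (yVec J σ)) e := by
  refine Finset.sum_congr rfl fun J _ => ?_
  congr 1
  have h1 := h.opList_comp_prolong hy (isOpen_overSet hΩ) (s := s)
    (fun e he => by
      change basePt (prolong s v x y e) ∈ Ω
      rw [basePt_prolong]
      exact hm e he)
    (contDiffOn_fderiv_trunc hΩ hL (yVec J σ)) (k := r)
    (fun e e' hee => by simp only [hee]) (idxList J.1)
    (by rw [idxList_length]; have := J.2; omega) he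
  have h2 : (fun e' => fderiv ℝ L (trunc r e') (yVec J σ)) ∘ prolong s v x y =
      fun e => fderiv ℝ L (prolong r v x y e) (yVec J σ) := by
    funext e
    simp only [Function.comp_apply]
    rw [trunc_prolong (by omega)]
  rw [← h2]
  exact h1.symm

end Prolong

/-! ### Families of germs seen in a second chart -/

variable {n m : ℕ} {X : Type*} [TopologicalSpace X] [ChartedSpace (Fin (n + m) → ℝ) X]

section Family

variable {E : Type*} [NormedAddCommGroup E] [NormedSpace ℝ E]

/-- The first coordinates, in the chart `ψ'`, of a family of points given in the chart `ψ`. -/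
def famX (ψ ψ' : Chart n m X) (c : E → Fin (n + m) → ℝ) (i : Fin n) (e : E) : ℝ :=
  chartChange ψ ψ' (c e) (Fin.castAdd m i)

/-- The last coordinates, in the chart `ψ'`, of a family of points given in the chart `ψ`. -/
def famY (ψ ψ' : Chart n m X) (c : E → Fin (n + m) → ℝ) (σ : Fin m) (e : E) : ℝ :=
  chartChange ψ ψ' (c e) (Fin.natAdd n σ)

/-- The parameters at which the family lies in the domain of `ψ'` and is transverse there. -/
def famDom (ψ ψ' : Chart n m X) (v : Fin n → E) (c : E → Fin (n + m) → ℝ) : Set E :=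
  {e | c e ∈ chartOverlap ψ ψ' ∧ (frameJac v (famX ψ ψ' c) e).det ≠ 0}

variable {ψ ψ' : Chart n m X} {v : Fin n → E} {c : E → Fin (n + m) → ℝ}

lemma contDiffOn_fam (hc : ContDiff ℝ ∞ c) (A : Fin (n + m)) :
    ContDiffOn ℝ ∞ (fun e => chartChange ψ ψ' (c e) A) (c ⁻¹' chartOverlap ψ ψ') :=
  (contDiffOn_chartChange_apply ψ ψ' A).comp hc.contDiffOn fun _ h => h

lemma frameOn_famDom (hc : ContDiff ℝ ∞ c) : FrameOn (famDom ψ ψ' v c) v (famX ψ ψ' c) := by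
  have ho : IsOpen (c ⁻¹' chartOverlap ψ ψ') :=
    (isOpen_chartOverlap ψ ψ').preimage hc.continuous
  have hd : ContinuousOn (fun e => (frameJac v (famX ψ ψ' c) e).det)
      (c ⁻¹' chartOverlap ψ ψ') :=
    (contDiffOn_det (k := ∞) fun i j =>
      contDiffOn_dirDeriv ho (contDiffOn_fam hc (Fin.castAdd m i)) (v j)).continuousOn
  exact ⟨hd.isOpen_inter_preimage ho (isOpen_compl_singleton (x := (0 : ℝ))),
    fun i => (contDiffOn_fam hc _).mono fun e he => he.1, fun e he => he.2⟩

lemma contDiffOn_famY (hc : ContDiff ℝ ∞ c) (σ : Fin m) :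
    ContDiffOn ℝ ∞ (famY ψ ψ' c σ) (famDom ψ ψ' v c) :=
  (contDiffOn_fam hc _).mono fun _ he => he.1

/-- The germ along an affine slice of a family, seen in the chart `ψ'`. -/
lemma adapted_slice (hc : ContDiff ℝ ∞ c) {α : (Fin n → ℝ) → E} (hα : Differentiable ℝ α)
    (hv : ∀ u j, fderiv ℝ α u (stdVec n j) = v j) {γ : ImmGerm n m X}
    (hγ : ∀ u, γ.toFun u = ψ.1.symm (c (α u))) (h0 : α 0 ∈ famDom ψ ψ' v c) :
    InDom ψ' γ ∧ (jac ψ' γ 0).det = (frameJac v (famX ψ ψ' c) (α 0)).det ∧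
      ∀ s, adapted s ψ' γ = prolong s v (famX ψ ψ' c) (famY ψ ψ' c) (α 0) := by
  have f := frameOn_famDom (ψ := ψ) (ψ' := ψ') (v := v) hc
  have hx : ∀ A, coordFun ψ' γ A = (fun e => chartChange ψ ψ' (c e) A) ∘ α := fun A => by
    funext u
    change ψ'.1 (γ.toFun u) A = _
    rw [hγ]
    rfl
  have hX : ∀ i, coordFun ψ' γ (Fin.castAdd m i) = famX ψ ψ' c i ∘ α := fun i => hx _
  have hj : jac ψ' γ 0 = frameJac v (famX ψ ψ' c) (α 0) := by
    ext i j
    change fderiv ℝ (coordFun ψ' γ (Fin.castAdd m i)) 0 (stdVec n j) = _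
    rw [hX, fderiv_comp _ (differentiableAt_of_contDiffOn f.isOpen (f.smooth i) h0) (hα 0),
      ContinuousLinearMap.comp_apply, hv]
    rfl
  have ho : IsOpen (α ⁻¹' famDom ψ ψ' v c) := f.isOpen.preimage hα.continuous
  refine ⟨⟨?_, ?_⟩, by rw [hj], fun s => Prod.ext (funext fun i => ?_)
    (funext fun J => funext fun σ => ?_)⟩
  · rw [hγ]
    exact h0.1.2
  · rw [hj]
    exact h0.2
  · exact congrFun (hX i) 0
  · change opList (zd ψ' γ) _ _ 0 = _
    rw [zd_eq_frame]
    simp only [hX]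
    rw [hx]
    refine opList_frame_comp ho f (fun t ht => ht) (fun t _ => hα t) (fun _ => 1)
      (fun t _ j => ?_) (fun t _ => by simp) (contDiffOn_famY hc σ) _ h0
    simp [hv, Matrix.one_apply]

end Family

/-! ### Changes of adapted coordinates -/

/-- The directions of the second factor of a product. -/
def sndVec (E : Type*) [Zero E] (n : ℕ) (j : Fin n) : E × (Fin n → ℝ) := (0, stdVec n j)

lemma fderiv_slice {E : Type*} [NormedAddCommGroup E] [NormedSpace ℝ E] (e : E) (t u : Fin n → ℝ)
    (j : Fin n) : fderiv ℝ (fun u : Fin n → ℝ => (e, t + u)) u (stdVec n j) = sndVec E n j := by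
  have : HasFDerivAt (fun u : Fin n → ℝ => (e, t + u))
      ((0 : (Fin n → ℝ) →L[ℝ] E).prod (ContinuousLinearMap.id ℝ (Fin n → ℝ))) u :=
    (hasFDerivAt_const e u).prodMk ((hasFDerivAt_id u).const_add t)
  rw [this.fderiv]
  rfl

lemma differentiable_slice {E : Type*} [NormedAddCommGroup E] [NormedSpace ℝ E] (e : E)
    (t : Fin n → ℝ) : Differentiable ℝ (fun u : Fin n → ℝ => (e, t + u)) :=
  (differentiable_const e).prodMk (differentiable_id.const_add t)

/-- The family of all polynomial graphs. -/
def polyFam (n m s : ℕ) (p : Coords n m s × (Fin n → ℝ)) : Fin (n + m) → ℝ :=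
  Fin.append (p.1.1 + p.2) (taylorFun p.1.2 p.2)

lemma contDiff_polyFam (n m s : ℕ) : ContDiff ℝ ∞ (polyFam n m s) := by
  refine contDiffOn_univ.mp (contDiffOn_append (ContDiff.contDiffOn ?_) (ContDiff.contDiffOn ?_))
  · exact (contDiff_fst.comp contDiff_fst).add contDiff_snd
  · refine contDiff_pi.mpr fun σ => ContDiff.sum fun J _ => ContDiff.mul ?_ ?_
    · exact (contDiff_apply_apply ℝ ℝ J σ).comp (contDiff_snd.comp contDiff_fst)
    · exact (contDiff_monomialFun J.1).comp contDiff_snd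

lemma polyFam_zero {s : ℕ} (e : Coords n m s) : polyFam n m s (e, 0) = basePt e := by
  simp only [polyFam, add_zero]
  rw [show taylorFun e.2 0 = e.2 (zeroIdx n s) from funext (taylorFun_zero e.2)]
  rfl

/-- The image, in the chart of `ψ`, of the overlap of two adapted charts. -/
def adaptedOverlap (s : ℕ) (ψ ψ' : Chart n m X) : Set (Coords n m s) :=
  {e | (e, 0) ∈ famDom ψ ψ' (sndVec _ n) (polyFam n m s)}

section Transition

variable {s : ℕ} {ψ ψ' : Chart n m X}

lemma isOpen_adaptedOverlap : IsOpen (adaptedOverlap s ψ ψ') :=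
  (frameOn_famDom (contDiff_polyFam n m s)).isOpen.preimage
    (continuous_id.prodMk continuous_const)

lemma basePt_mem_of_adaptedOverlap {e : Coords n m s} (he : e ∈ adaptedOverlap s ψ ψ') :
    basePt e ∈ chartOverlap ψ ψ' := by
  have := he.1
  rwa [polyFam_zero] at this

lemma polyGerm_slice {e : Coords n m s} (h : basePt e ∈ ψ.1.target)
    (he : e ∈ adaptedOverlap s ψ ψ') : InDom ψ' (polyGerm ψ e h) ∧
      (jac ψ' (polyGerm ψ e h) 0).det =
        (frameJac (sndVec _ n) (famX ψ ψ' (polyFam n m s)) (e, 0)).det ∧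
      ∀ k, adapted k ψ' (polyGerm ψ e h) = prolong k (sndVec _ n) (famX ψ ψ' (polyFam n m s))
        (famY ψ ψ' (polyFam n m s)) (e, 0) := by
  have := adapted_slice (ψ := ψ) (ψ' := ψ') (contDiff_polyFam n m s) (differentiable_slice e 0)
    (fderiv_slice e 0) (γ := polyGerm ψ e h) (fun u => by simp [polyGerm, graphGerm, polyFam])
    (by rw [add_zero]; exact he)
  simpa using this

lemma adaptedOverlap_of_inDom {e : Coords n m s} (h : basePt e ∈ ψ.1.target)
    (hd : InDom ψ' (polyGerm ψ e h)) : e ∈ adaptedOverlap s ψ ψ' := by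
  have hmem : basePt e ∈ chartOverlap ψ ψ' := by
    refine ⟨h, ?_⟩
    have := hd.1
    rw [polyGerm, graphGerm_zero,
      show taylorFun e.2 0 = e.2 (zeroIdx n s) from funext (taylorFun_zero e.2)] at this
    exact this
  refine ⟨by rwa [polyFam_zero], ?_⟩
  have hj : frameJac (sndVec _ n) (famX ψ ψ' (polyFam n m s)) (e, 0) =
      jac ψ' (polyGerm ψ e h) 0 := by
    ext i j
    have hx : coordFun ψ' (polyGerm ψ e h) (Fin.castAdd m i) =
        famX ψ ψ' (polyFam n m s) i ∘ fun u => (e, 0 + u) := by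
      funext u
      simp only [zero_add, Function.comp_apply]
      rfl
    change _ = fderiv ℝ (coordFun ψ' (polyGerm ψ e h) (Fin.castAdd m i)) 0 (stdVec n j)
    have ho : IsOpen (polyFam n m s ⁻¹' chartOverlap ψ ψ') :=
      (isOpen_chartOverlap ψ ψ').preimage (contDiff_polyFam n m s).continuous
    have hd : DifferentiableAt ℝ (famX ψ ψ' (polyFam n m s) i) (e, 0 + 0) :=
      differentiableAt_of_contDiffOn ho (contDiffOn_fam (contDiff_polyFam n m s) _)
        (by rw [add_zero, Set.mem_preimage, polyFam_zero]; exact hmem)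
    rw [hx, fderiv_comp (0 : Fin n → ℝ) (f := fun u : Fin n → ℝ => (e, 0 + u)) hd
      (differentiable_slice e 0 0), ContinuousLinearMap.comp_apply,
      fderiv_slice, add_zero]
    rfl
  rw [hj]
  exact hd.2

lemma chart_mem_chartTarget {p : Grass n m X s} (hp : p ∈ chartDom s ψ) :
    chart s ψ p ∈ chartTarget s ψ := ⟨p, hp, rfl⟩

lemma chart_mem_adaptedOverlap (hs : 1 ≤ s) {p : Grass n m X s} (hp : p ∈ chartDom s ψ)
    (hp' : p ∈ chartDom s ψ') : chart s ψ p ∈ adaptedOverlap s ψ ψ' := by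
  have h : basePt (chart s ψ p) ∈ ψ.1.target := by
    have := chart_mem_chartTarget hp
    rwa [chartTarget_eq hs] at this
  refine adaptedOverlap_of_inDom h ?_
  rw [← mem_chartDom_iff hs, polyGerm_chart hs hp]
  exact hp'

lemma exists_of_mem_adaptedOverlap (hs : 1 ≤ s) {e : Coords n m s}
    (he : e ∈ adaptedOverlap s ψ ψ') :
    ∃ p ∈ chartDom s ψ ∩ chartDom s ψ', chart s ψ p = e ∧
      chart s ψ' p = prolong s (sndVec _ n) (famX ψ ψ' (polyFam n m s))
        (famY ψ ψ' (polyFam n m s)) (e, 0) := by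
  have h := (basePt_mem_of_adaptedOverlap he).1
  obtain ⟨h1, -, h2⟩ := polyGerm_slice h he
  exact ⟨_, ⟨⟨_, inDom_polyGerm, rfl⟩, ⟨_, h1, rfl⟩⟩, chart_polyGerm hs h,
    (chart_proj_jet hs h1).trans (h2 s)⟩

/-- Since `polyFam` depends smoothly on `e` and `t` together, prolonging it once on the product
makes smoothness of the change of coordinates in `e` evident. -/
lemma transition_eq_prolong (hs : 1 ≤ s) {e : Coords n m s} (he : e ∈ adaptedOverlap s ψ ψ') :
    transition s ψ ψ' e = prolong s (sndVec _ n) (famX ψ ψ' (polyFam n m s))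
        (famY ψ ψ' (polyFam n m s)) (e, 0) := by
  obtain ⟨p, hp, h1, h2⟩ := exists_of_mem_adaptedOverlap hs he
  rw [← h1, transition_chart hs hp.1, h2, h1]

lemma contDiffOn_transition (hs : 1 ≤ s) :
    ContDiffOn ℝ ∞ (transition s ψ ψ') (adaptedOverlap s ψ ψ') := by
  refine ContDiffOn.congr ?_ fun e he => transition_eq_prolong hs he
  have h := (frameOn_famDom (ψ := ψ) (ψ' := ψ') (v := sndVec _ n)
    (contDiff_polyFam n m s)).contDiffOn_prolong (s := s)
    fun σ => contDiffOn_famY (contDiff_polyFam n m s) σ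
  exact h.comp (contDiff_id.prodMk contDiff_const).contDiffOn fun e he => he

lemma basePt_transition (hs : 1 ≤ s) {e : Coords n m s} (he : e ∈ adaptedOverlap s ψ ψ') :
    basePt (transition s ψ ψ' e) = chartChange ψ ψ' (basePt e) := by
  rw [transition_eq_prolong hs he, basePt_prolong]
  funext A
  refine Fin.addCases (fun i => ?_) (fun σ => ?_) A
  · simp [famX, polyFam_zero]
  · simp [famY, polyFam_zero]

lemma basePt_castAdd (e : Coords n m s) (i : Fin n) : basePt e (Fin.castAdd m i) = e.1 i := by
  simp [basePt]

lemma basePt_natAdd (e : Coords n m s) (σ : Fin m) :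
    basePt e (Fin.natAdd n σ) = yCoord e 0 σ := by
  simp [basePt, yCoord, zeroIdx]

/-- The tangent map `t ↦ (t, yᵢ tⁱ)` of the contact element with coordinates `e`. -/
def tangentL (e : Coords n m s) : (Fin n → ℝ) →ₗ[ℝ] (Fin (n + m) → ℝ) where
  toFun t := Fin.append t fun σ => ∑ i, t i * yCoord e (unitIdx i) σ
  map_add' a b := by
    funext A
    refine Fin.addCases (fun i => ?_) (fun σ => ?_) A
    · simp
    · simp [add_mul, Finset.sum_add_distrib]
  map_smul' c a := by
    funext A
    refine Fin.addCases (fun i => ?_) (fun σ => ?_) A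
    · simp
    · simp [Finset.mul_sum, mul_assoc]

@[simp] lemma tangentL_castAdd (e : Coords n m s) (t : Fin n → ℝ) (i : Fin n) :
    tangentL e t (Fin.castAdd m i) = t i := by simp [tangentL]

@[simp] lemma tangentL_natAdd (e : Coords n m s) (t : Fin n → ℝ) (σ : Fin m) :
    tangentL e t (Fin.natAdd n σ) = ∑ i, t i * yCoord e (unitIdx i) σ := by simp [tangentL]

lemma basePt_totalVec (e : Coords n m s) (i : Fin n) :
    basePt (totalVec i e) = tangentL e (stdVec n i) := by
  funext A
  refine Fin.addCases (fun k => ?_) (fun σ => ?_) A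
  · simp [basePt, totalVec, stdVec]
  · simp [basePt, totalVec, stdVec, zeroIdx, Pi.single_apply]

lemma fderiv_polyFam (hs : 1 ≤ s) (e : Coords n m s) (j : Fin n) :
    fderiv ℝ (polyFam n m s) (e, 0) (sndVec _ n j) = tangentL e (stdVec n j) := by
  have h1 : HasFDerivAt (fun u : Fin n → ℝ => polyFam n m s (e, 0 + u))
      ((fderiv ℝ (polyFam n m s) (e, 0 + 0)).comp
        (fderiv ℝ (fun u : Fin n → ℝ => (e, 0 + u)) 0)) 0 :=
    HasFDerivAt.comp (0 : Fin n → ℝ) (f := fun u : Fin n → ℝ => (e, 0 + u))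
      (((contDiff_polyFam n m s).differentiable (by simp)) (e, 0 + 0)).hasFDerivAt
      (differentiable_slice e 0 0).hasFDerivAt
  have h2 : HasFDerivAt (fun u : Fin n → ℝ => polyFam n m s (e, 0 + u)) ((appendL n m).comp
      ((ContinuousLinearMap.id ℝ (Fin n → ℝ)).prod (fderiv ℝ (taylorFun e.2) 0))) 0 := by
    simp only [zero_add]
    exact hasFDerivAt_append ((hasFDerivAt_id (0 : Fin n → ℝ)).const_add e.1)
      (((contDiff_taylorFun e.2).differentiable (by simp)) 0).hasFDerivAt
  have h3 := congrArg (fun L => L (stdVec n j)) (h1.unique h2)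
  simp only [ContinuousLinearMap.comp_apply, fderiv_slice, add_zero] at h3
  rw [h3]
  funext A
  refine Fin.addCases (fun k => ?_) (fun σ => ?_) A
  · simp
  · have h4 := opList_taylorFun e.2 σ [j] (by simpa using hs)
    rw [opList_cons, opList_nil, pd, fderiv_apply
      (((contDiff_taylorFun e.2).differentiable (by simp)) 0)] at h4
    simp only [ContinuousLinearMap.prod_apply, appendL_apply,
      Fin.append_right, tangentL_natAdd]
    refine Eq.trans h4 ?_
    have h5 : (fun i => List.count i [j]) = unitIdx j := by
      funext i
      rw [← idxList_unit, idxList_count]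
    simp only [h5, stdVec, Pi.single_apply, ite_mul, one_mul, zero_mul, Finset.sum_ite_eq',
      Finset.mem_univ, if_true, yCoord]
    rw [dif_pos]

/-- The differential of a change of coordinates respects the tangent maps. -/
lemma fderiv_chartChange_tangentL (hs : 1 ≤ s) {e : Coords n m s}
    (he : e ∈ adaptedOverlap s ψ ψ') (t : Fin n → ℝ) :
    fderiv ℝ (chartChange ψ ψ') (basePt e) (tangentL e t) =
      tangentL (transition s ψ ψ' e)
        (fun i => fderiv ℝ (chartChange ψ ψ') (basePt e) (tangentL e t) (Fin.castAdd m i)) := by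
  have hf := frameOn_famDom (ψ := ψ) (ψ' := ψ') (v := sndVec (Coords n m s) n)
    (contDiff_polyFam n m s)
  have hcc : DifferentiableAt ℝ (chartChange ψ ψ') (basePt e) :=
    differentiableAt_of_contDiffOn (isOpen_chartOverlap ψ ψ') (contDiffOn_chartChange ψ ψ')
      (basePt_mem_of_adaptedOverlap he)
  have hder : ∀ A j, dirDeriv (sndVec _ n j) (fun p => chartChange ψ ψ' (polyFam n m s p) A)
      (e, 0) = fderiv ℝ (chartChange ψ ψ') (basePt e) (tangentL e (stdVec n j)) A := by
    intro A j
    have hp : DifferentiableAt ℝ (polyFam n m s) (e, 0) :=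
      ((contDiff_polyFam n m s).differentiable (by simp)) _
    have h1 : HasFDerivAt (fun p => chartChange ψ ψ' (polyFam n m s p))
        ((fderiv ℝ (chartChange ψ ψ') (basePt e)).comp
          (fderiv ℝ (polyFam n m s) (e, 0))) (e, 0) := by
      refine HasFDerivAt.comp (e, (0 : Fin n → ℝ)) (f := polyFam n m s)
        (g := chartChange ψ ψ') ?_ hp.hasFDerivAt
      rw [polyFam_zero]
      exact hcc.hasFDerivAt
    have h2 := (hasFDerivAt_pi'.mp h1 A).fderiv
    simp only [dirDeriv]
    rw [h2]
    simp only [ContinuousLinearMap.comp_apply, fderiv_polyFam hs]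
    rfl
  have key : ∀ j, fderiv ℝ (chartChange ψ ψ') (basePt e) (tangentL e (stdVec n j)) =
      tangentL (transition s ψ ψ' e) (fun i =>
        fderiv ℝ (chartChange ψ ψ') (basePt e) (tangentL e (stdVec n j)) (Fin.castAdd m i)) := by
    intro j
    funext A
    refine Fin.addCases (fun i => ?_) (fun σ => ?_) A
    · rw [tangentL_castAdd]
    -- Expanding the direction of the graph in the frame exhibits the coefficients `ȳ^σ_i` as the
    -- first order coordinates of the image.
    · rw [tangentL_natAdd, ← hder, hf.dirDeriv_eq_sum he]
      refine Finset.sum_congr rfl fun i _ => ?_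
      rw [← hder, transition_eq_prolong hs he, yCoord_prolong (by rw [sum_unitIdx]; exact hs),
        idxList_unit]
      rfl
  let R : (Fin (n + m) → ℝ) →ₗ[ℝ] (Fin n → ℝ) := LinearMap.funLeft ℝ ℝ (Fin.castAdd m)
  let P₁ : (Fin n → ℝ) →ₗ[ℝ] (Fin (n + m) → ℝ) :=
    (fderiv ℝ (chartChange ψ ψ') (basePt e) : (Fin (n + m) → ℝ) →ₗ[ℝ] (Fin (n + m) → ℝ)) ∘ₗ
      tangentL e
  change P₁ t = ((tangentL (transition s ψ ψ' e)) ∘ₗ R ∘ₗ P₁) t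
  have : P₁ = (tangentL (transition s ψ ψ' e)) ∘ₗ R ∘ₗ P₁ := by
    refine (Pi.basisFun ℝ (Fin n)).ext fun j => ?_
    rw [Pi.basisFun_apply]
    exact key j
  exact congrArg (fun L => L t) this

/-- A change of adapted coordinates covers the change of coordinates on `X`. Hence `𝒥` and `P` are
computed on the base, without the higher order part of the transition. -/
lemma fderiv_transition_fst (hs : 1 ≤ s) {e : Coords n m s} (he : e ∈ adaptedOverlap s ψ ψ')
    (w : Coords n m s) : basePt (fderiv ℝ (transition s ψ ψ') e w) =
      fderiv ℝ (chartChange ψ ψ') (basePt e) (basePt w) := by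
  have hcc : DifferentiableAt ℝ (chartChange ψ ψ') (basePt e) :=
    differentiableAt_of_contDiffOn (isOpen_chartOverlap ψ ψ') (contDiffOn_chartChange ψ ψ')
      (basePt_mem_of_adaptedOverlap he)
  have htr : DifferentiableAt ℝ (transition s ψ ψ') e :=
    differentiableAt_of_contDiffOn isOpen_adaptedOverlap (contDiffOn_transition hs) he
  have h1 : (fun e => basePt (transition s ψ ψ' e)) =ᶠ[𝓝 e]
      fun e => chartChange ψ ψ' (basePt e) :=
    Filter.eventuallyEq_of_mem (isOpen_adaptedOverlap.mem_nhds he)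
      fun e he => basePt_transition hs he
  have h2 : HasFDerivAt (fun e => basePt (transition s ψ ψ' e))
      ((basePtL n m s).comp (fderiv ℝ (transition s ψ ψ') e)) e :=
    (basePtL n m s).hasFDerivAt.comp e htr.hasFDerivAt
  have h3 : HasFDerivAt (fun e => chartChange ψ ψ' (basePt e))
      ((fderiv ℝ (chartChange ψ ψ') (basePt e)).comp (basePtL n m s)) e :=
    hcc.hasFDerivAt.comp e (basePtL n m s).hasFDerivAt
  have h4 := (h2.congr_of_eventuallyEq h1.symm).unique h3
  exact congrArg (fun L => L w) h4

lemma fderiv_transition_basePt_apply (hs : 1 ≤ s) {e : Coords n m s}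
    (he : e ∈ adaptedOverlap s ψ ψ') (w : Coords n m s) (A : Fin (n + m)) :
    fderiv ℝ (fun e' => basePt (transition s ψ ψ' e') A) e w =
      fderiv ℝ (chartChange ψ ψ') (basePt e) (basePt w) A := by
  have htr : DifferentiableAt ℝ (transition s ψ ψ') e :=
    differentiableAt_of_contDiffOn isOpen_adaptedOverlap (contDiffOn_transition hs) he
  rw [← fderiv_transition_fst hs he]
  have h2 : HasFDerivAt (fun e => basePt (transition s ψ ψ' e))
      ((basePtL n m s).comp (fderiv ℝ (transition s ψ ψ') e)) e :=
    (basePtL n m s).hasFDerivAt.comp e htr.hasFDerivAt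
  rw [(hasFDerivAt_pi'.mp h2 A).fderiv]
  rfl

/-- The matrix of the differential of a change of coordinates, restricted to tangent vectors. -/
def tangentMatrix (ψ ψ' : Chart n m X) (e : Coords n m s) : Matrix (Fin n) (Fin n) ℝ :=
  Matrix.of fun i j => fderiv ℝ (chartChange ψ ψ') (basePt e) (tangentL e (stdVec n j))
    (Fin.castAdd m i)

lemma jacobianDet_eq (hs : 1 ≤ s) {e : Coords n m s} (he : e ∈ adaptedOverlap s ψ ψ') :
    jacobianDet s ψ ψ' e = (tangentMatrix ψ ψ' e).det := by
  rw [jacobianDet, ← Matrix.det_transpose]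
  congr 1
  ext i j
  simp only [Matrix.transpose_apply, Matrix.of_apply, totalD, tangentMatrix]
  simp only [← basePt_castAdd]
  rw [fderiv_transition_basePt_apply hs he, basePt_totalVec]

lemma basePt_yVec_zeroIdx (σ : Fin m) :
    basePt (yVec (zeroIdx n s) σ) = Fin.append (0 : Fin n → ℝ) (Pi.single σ 1) := by
  simp [basePt, yVec]

lemma pMatrix_eq (hs : 1 ≤ s) {e : Coords n m s} (he : e ∈ adaptedOverlap s ψ ψ')
    (ν σ : Fin m) : pMatrix s ψ ψ' ν σ e =
      fderiv ℝ (chartChange ψ ψ') (basePt e) (Fin.append 0 (Pi.single σ 1)) (Fin.natAdd n ν) -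
      ∑ i : Fin n, yCoord (transition s ψ ψ' e) (unitIdx i) ν *
        fderiv ℝ (chartChange ψ ψ') (basePt e) (Fin.append 0 (Pi.single σ 1))
          (Fin.castAdd m i) := by
  simp only [pMatrix, ← basePt_natAdd, ← basePt_castAdd]
  simp only [fderiv_transition_basePt_apply hs he, basePt_yVec_zeroIdx]

end Transition

/-! ### Test functions and integration by parts -/

section Test

open MeasureTheory

variable {n : ℕ} {U : Set (Fin n → ℝ)}

/-- Smooth functions with compact support in `U`. -/
structure TestOn (U : Set (Fin n → ℝ)) (h : (Fin n → ℝ) → ℝ) : Prop where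
  smooth : ContDiff ℝ ∞ h
  compact : HasCompactSupport h
  subset : tsupport h ⊆ U

/-- A function smooth only on `U` is smooth everywhere if it vanishes off the support of a test
function. This allows multiplication by coefficients that are uncontrolled outside `U`. -/
lemma TestOn.of_eq_zero (hU : IsOpen U) {h g : (Fin n → ℝ) → ℝ} (hh : TestOn U h)
    (hg : ContDiffOn ℝ ∞ g U) (h0 : ∀ t ∉ tsupport h, g t = 0) : TestOn U g := by
  have hs : tsupport g ⊆ tsupport h :=
    closure_minimal (fun t ht => by_contra fun hc => ht (h0 t hc)) (isClosed_tsupport h)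
  refine ⟨contDiff_iff_contDiffAt.mpr fun t => ?_, hh.compact.of_isClosed_subset
    (isClosed_tsupport g) hs, hs.trans hh.subset⟩
  by_cases ht : t ∈ U
  · exact hg.contDiffAt (hU.mem_nhds ht)
  · have ht' : t ∈ (tsupport h)ᶜ := fun hc => ht (hh.subset hc)
    refine (contDiffAt_const (c := (0 : ℝ))).congr_of_eventuallyEq ?_
    filter_upwards [(isClosed_tsupport h).isOpen_compl.mem_nhds ht'] with u hu
    exact h0 u hu

lemma TestOn.eq_zero {h : (Fin n → ℝ) → ℝ} {t : Fin n → ℝ} (ht : t ∉ tsupport h) : h t = 0 :=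
  image_eq_zero_of_notMem_tsupport ht

lemma TestOn.fderiv_eq_zero {h : (Fin n → ℝ) → ℝ} {t : Fin n → ℝ} (ht : t ∉ tsupport h) :
    fderiv ℝ h t = 0 :=
  image_eq_zero_of_notMem_tsupport fun hc => ht (tsupport_fderiv_subset ℝ hc)

lemma TestOn.mul (hU : IsOpen U) {h a : (Fin n → ℝ) → ℝ} (hh : TestOn U h)
    (ha : ContDiffOn ℝ ∞ a U) : TestOn U (fun t => h t * a t) :=
  hh.of_eq_zero hU (hh.smooth.contDiffOn.mul ha) fun t ht => by rw [eq_zero ht, zero_mul]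

lemma TestOn.integrable {h : (Fin n → ℝ) → ℝ} (hh : TestOn U h) : Integrable h :=
  hh.smooth.continuous.integrable_of_hasCompactSupport hh.compact

lemma TestOn.dirDeriv (hU : IsOpen U) {h : (Fin n → ℝ) → ℝ} (hh : TestOn U h)
    (w : Fin n → ℝ) : TestOn U (dirDeriv w h) :=
  hh.of_eq_zero hU (contDiffOn_dirDeriv hU hh.smooth.contDiffOn w) fun t ht => by
    simp [GrassmannBundle.dirDeriv, fderiv_eq_zero ht]

/-- Integration by parts against the constant `1`. -/
lemma TestOn.integral_dirDeriv (hU : IsOpen U) {h : (Fin n → ℝ) → ℝ} (hh : TestOn U h)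
    (w : Fin n → ℝ) : ∫ t, GrassmannBundle.dirDeriv w h t = 0 := by
  have := integral_mul_fderiv_eq_neg_fderiv_mul_of_integrable (μ := (volume : Measure (Fin n → ℝ)))
    (f := fun _ : Fin n → ℝ => (1 : ℝ)) (g := h) (v := w) (by simp)
    (by simpa using! (hh.dirDeriv hU w).integrable) (by simpa using hh.integrable)
    (fun _ _ => differentiableAt_const _) (fun t _ => hh.smooth.differentiable (by simp) t)
  simpa using! this

variable {x : Fin n → (Fin n → ℝ) → ℝ}

lemma FrameOn.testOn_frame (hf : FrameOn U (stdVec n) x) {h : (Fin n → ℝ) → ℝ} (hh : TestOn U h)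
    (i : Fin n) : TestOn U (frame (stdVec n) x i h) :=
  hh.of_eq_zero hf.isOpen (hf.contDiffOn hh.smooth.contDiffOn i) fun t ht => by
    simp [frame, TestOn.fderiv_eq_zero ht]

lemma FrameOn.testOn_opList (hf : FrameOn U (stdVec n) x) {h : (Fin n → ℝ) → ℝ}
    (hh : TestOn U h) (l : List (Fin n)) : TestOn U (opList (frame (stdVec n) x) l h) := by
  induction l with
  | nil => exact hh
  | cons i l ih => exact hf.testOn_frame ih i

/-- The density of a frame makes its vector fields divergence free. -/
lemma FrameOn.integral_frame (hf : FrameOn U (stdVec n) x) {h : (Fin n → ℝ) → ℝ}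
    (hh : TestOn U h) (i : Fin n) :
    ∫ t, frame (stdVec n) x i h t * (frameJac (stdVec n) x t).det = 0 := by
  -- The components of the frame field times the density. Their divergence vanishes by the Piola
  -- identity, so the integrand is the divergence of `h` times this field.
  let a : Fin n → (Fin n → ℝ) → ℝ := fun j t =>
    (frameJac (stdVec n) x t).det * (frameJac (stdVec n) x t)⁻¹ j i
  have ha : ∀ j, ContDiffOn ℝ ∞ (a j) U := fun j =>
    (contDiffOn_det hf.jac_smooth).mul (hf.inv_smooth j i)
  have ht : ∀ j, TestOn U (fun t => h t * a j t) := fun j => hh.mul hf.isOpen (ha j)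
  have key : ∀ t, frame (stdVec n) x i h t * (frameJac (stdVec n) x t).det =
      ∑ j, dirDeriv (stdVec n j) (fun t => h t * a j t) t := by
    intro t
    by_cases htU : t ∈ U
    · have h1 : ∀ j, dirDeriv (stdVec n j) (fun t => h t * a j t) t =
          dirDeriv (stdVec n j) h t * a j t + h t * dirDeriv (stdVec n j) (a j) t := fun j =>
        dirDeriv_mul (hh.smooth.differentiable (by simp) t)
          (differentiableAt_of_contDiffOn hf.isOpen (ha j) htU) _
      simp only [h1, Finset.sum_add_distrib, ← Finset.mul_sum]
      rw [hf.piola i htU, mul_zero, add_zero, frame_eq_sum, Finset.sum_mul]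
      exact Finset.sum_congr rfl fun j _ => by ring
    · have ht' : t ∉ tsupport h := fun hc => htU (hh.subset hc)
      have h1 : ∀ j, dirDeriv (stdVec n j) (fun t => h t * a j t) t = 0 := fun j => by
        have : t ∉ tsupport (fun t => h t * a j t) := fun hc => htU ((ht j).subset hc)
        simp [dirDeriv, TestOn.fderiv_eq_zero this]
      simp [h1, frame, TestOn.fderiv_eq_zero ht']
  simp only [key]
  rw [integral_finsetSum _ fun j _ => ((ht j).dirDeriv hf.isOpen _).integrable]
  exact Finset.sum_eq_zero fun j _ => (ht j).integral_dirDeriv hf.isOpen _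

lemma FrameOn.integral_frame_mul (hf : FrameOn U (stdVec n) x) {h a : (Fin n → ℝ) → ℝ}
    (hh : TestOn U h) (ha : ContDiffOn ℝ ∞ a U) (i : Fin n) :
    ∫ t, frame (stdVec n) x i h t * a t * (frameJac (stdVec n) x t).det =
      -∫ t, h t * frame (stdVec n) x i a t * (frameJac (stdVec n) x t).det := by
  have hd : ContDiffOn ℝ ∞ (fun t => (frameJac (stdVec n) x t).det) U :=
    contDiffOn_det hf.jac_smooth
  have h0 := hf.integral_frame (hh.mul hf.isOpen ha) i
  have h1 : ∀ t, frame (stdVec n) x i (fun t => h t * a t) t * (frameJac (stdVec n) x t).det =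
      frame (stdVec n) x i h t * a t * (frameJac (stdVec n) x t).det +
        h t * frame (stdVec n) x i a t * (frameJac (stdVec n) x t).det := by
    intro t
    by_cases htU : t ∈ U
    · rw [frame_mul i (hh.smooth.differentiable (by simp) t)
        (differentiableAt_of_contDiffOn hf.isOpen ha htU)]
      ring
    · have ht' : t ∉ tsupport h := fun hc => htU (hh.subset hc)
      have ht'' : t ∉ tsupport (fun t => h t * a t) :=
        fun hc => htU ((hh.mul hf.isOpen ha).subset hc)
      simp [frame, TestOn.fderiv_eq_zero ht', TestOn.fderiv_eq_zero ht'', TestOn.eq_zero ht']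
  simp only [h1] at h0
  rw [integral_add (((hf.testOn_frame hh i).mul hf.isOpen ha).mul hf.isOpen hd).integrable
    ((hh.mul hf.isOpen (hf.contDiffOn ha i)).mul hf.isOpen hd).integrable] at h0
  exact eq_neg_of_add_eq_zero_left h0

/-- Repeated integration by parts along a frame. -/
lemma FrameOn.integral_opList_mul (hf : FrameOn U (stdVec n) x) {h a : (Fin n → ℝ) → ℝ}
    (hh : TestOn U h) (ha : ContDiffOn ℝ ∞ a U) (l : List (Fin n)) :
    ∫ t, opList (frame (stdVec n) x) l h t * a t * (frameJac (stdVec n) x t).det =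
      (-1) ^ l.length * ∫ t, h t * opList (frame (stdVec n) x) l a t *
        (frameJac (stdVec n) x t).det := by
  induction l generalizing a with
  | nil => simp
  | cons i l ih =>
    rw [opList_cons, hf.integral_frame_mul (hf.testOn_opList hh l) ha i,
      ih (hf.contDiffOn ha i), List.length_cons, pow_succ, mul_neg_one, neg_mul]
    congr 3
    funext t
    by_cases htU : t ∈ U
    -- Moving the outermost derivative onto `a` first makes it act innermost there; commutation of
    -- the frame restores the order of the list.
    · have h1 := hf.opList_perm ha (List.perm_append_singleton i l) htU
      rw [opList_append] at h1
      rw [← h1]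
      rfl
    · have ht' : t ∉ tsupport h := fun hc => htU (hh.subset hc)
      simp [TestOn.eq_zero ht']

/-- The fundamental lemma of the calculus of variations. -/
lemma eqOn_zero_of_integral_test (hU : IsOpen U) {f : (Fin n → ℝ) → ℝ} (hf : ContDiffOn ℝ ∞ f U)
    (h : ∀ η, TestOn U η → ∫ t, η t * f t = 0) : Set.EqOn f 0 U := by
  have h1 := hU.ae_eq_zero_of_integral_contDiff_smul_eq_zero (μ := volume)
    (hf.continuousOn.locallyIntegrableOn hU.measurableSet)
    (fun g hg hc hs => h g ⟨hg, hc, hs⟩)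
  refine Measure.eqOn_open_of_ae_eq (μ := volume) ?_ hU hf.continuousOn continuousOn_const
  exact (ae_restrict_iff' hU.measurableSet).mpr h1

end Test

/-! ### The first variation along a frame -/

section Variation

variable {E : Type*} [NormedAddCommGroup E] [NormedSpace ℝ E] {n m r : ℕ}
  {O : Set E} {v : Fin n → E} {x : Fin n → E → ℝ}

/-- The vertical part of the variation of `f` in the direction `w`. -/
def vertVar (v : Fin n → E) (x : Fin n → E → ℝ) (w : E) (f : E → ℝ) : E → ℝ :=
  fun e => dirDeriv w f e - ∑ k, dirDeriv w (x k) e * frame v x k f e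

lemma FrameOn.contDiffOn_vertVar (h : FrameOn O v x) {f : E → ℝ} (hf : ContDiffOn ℝ ∞ f O)
    (w : E) : ContDiffOn ℝ ∞ (vertVar v x w f) O :=
  (contDiffOn_dirDeriv h.isOpen hf w).sub (ContDiffOn.sum fun k _ =>
    (contDiffOn_dirDeriv h.isOpen (h.smooth k) w).mul (h.contDiffOn hf k))

/-- The prolongation formula for a variation: its vertical part commutes with the frame. The
commutator of `w` with the new frame derivative cancels the derivatives of the horizontal
coefficients `dirDeriv w (x k)`. -/
lemma FrameOn.dirDeriv_opList (h : FrameOn O v x) {f : E → ℝ} (hf : ContDiffOn ℝ ∞ f O) (w : E)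
    (l : List (Fin n)) : Set.EqOn (dirDeriv w (opList (frame v x) l f))
      (fun e => opList (frame v x) l (vertVar v x w f) e +
        ∑ k, dirDeriv w (x k) e * frame v x k (opList (frame v x) l f) e) O := by
  induction l with
  | nil =>
    intro e he
    simp [vertVar]
  | cons i l ih =>
    intro e he
    have hg := h.contDiffOn_opList hf l
    have hq := h.contDiffOn_opList (h.contDiffOn_vertVar hf w) l
    have hξ := fun k => contDiffOn_dirDeriv h.isOpen (h.smooth k) w
    have d : ∀ {g : E → ℝ}, ContDiffOn ℝ ∞ g O → DifferentiableAt ℝ g e := fun hg =>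
      differentiableAt_of_contDiffOn h.isOpen hg he
    simp only [opList_cons]
    rw [h.dirDeriv_frame hg w i he, frame_congr h.isOpen i ih he]
    rw [frame_add i (d hq) (d (ContDiffOn.sum fun k _ => (hξ k).mul (h.contDiffOn hg k))),
      frame_sum _ i fun k _ => (d (hξ k)).fun_mul (d (h.contDiffOn hg k))]
    simp only [frame_mul i (d (hξ _)) (d (h.contDiffOn hg _)), Finset.sum_add_distrib]
    rw [add_sub_assoc, add_sub_cancel_left]
    congr 1
    exact Finset.sum_congr rfl fun k _ => by rw [h.comm hg i k he]

lemma sum_yVec {s : ℕ} (a : MultiIdx n s → Fin m → ℝ) :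
    ((0, a) : Coords n m s) = ∑ J, ∑ ν, a J ν • yVec J ν := by
  refine Prod.ext ?_ ?_
  · simp [yVec, Prod.fst_sum]
  · funext J ν
    simp [yVec, Prod.snd_sum, Finset.sum_apply, Pi.single_apply, ite_apply, Finset.sum_ite_eq]

/-- The variation of a density along a frame is, up to divergence terms, given by the vertical
parts of the variations. -/
lemma FrameOn.dirDeriv_density (h : FrameOn O v x) {y : Fin m → E → ℝ}
    (hy : ∀ σ, ContDiffOn ℝ ∞ (y σ) O) {T : Set (Coords n m r)} (hT : IsOpen T)
    (hm : Set.MapsTo (prolong r v x y) O T) {L : Coords n m r → ℝ} (hL : ContDiffOn ℝ ∞ L T)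
    (w : E) {e : E} (he : e ∈ O) :
    dirDeriv w (fun e => (frameJac v x e).det * L (prolong r v x y e)) e =
      (∑ J, ∑ ν, opList (frame v x) (idxList J.1) (vertVar v x w (y ν)) e *
          fderiv ℝ L (prolong r v x y e) (yVec J ν) +
        ∑ k, frame v x k (fun e => dirDeriv w (x k) e * L (prolong r v x y e)) e) *
        (frameJac v x e).det := by
  have d : ∀ {g : E → ℝ}, ContDiffOn ℝ ∞ g O → DifferentiableAt ℝ g e := fun hg =>
    differentiableAt_of_contDiffOn h.isOpen hg he
  have hpr := h.contDiffOn_prolong (s := r) hy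
  have hℓ : ContDiffOn ℝ ∞ (fun e => L (prolong r v x y e)) O := hL.comp hpr hm
  have hξ := fun k => contDiffOn_dirDeriv h.isOpen (h.smooth k) w
  have hLd : DifferentiableAt ℝ L (prolong r v x y e) :=
    differentiableAt_of_contDiffOn hT hL (hm he)
  have hprd : DifferentiableAt ℝ (prolong r v x y) e :=
    differentiableAt_of_contDiffOn h.isOpen hpr he
  have chain : ∀ u : E, fderiv ℝ (fun e => L (prolong r v x y e)) e u =
      fderiv ℝ L (prolong r v x y e) (fderiv ℝ (prolong r v x y) e u) := fun u => by
    have : fderiv ℝ (fun e => L (prolong r v x y e)) e = _ := fderiv_comp e hLd hprd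
    rw [this, ContinuousLinearMap.comp_apply]
  have hw : dirDeriv w (fun e => L (prolong r v x y e)) e =
      ∑ J, ∑ ν, opList (frame v x) (idxList J.1) (vertVar v x w (y ν)) e *
          fderiv ℝ L (prolong r v x y e) (yVec J ν) +
        ∑ k, dirDeriv w (x k) e * frame v x k (fun e => L (prolong r v x y e)) e := by
    -- The velocity of the prolongation splits into the prolonged vertical variation and a
    -- combination of frame directions. The latter produces the divergence terms.
    have e1 : fderiv ℝ (prolong r v x y) e w =
        ((0, fun J ν => opList (frame v x) (idxList J.1) (vertVar v x w (y ν)) e) :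
          Coords n m r) +
        ∑ k, dirDeriv w (x k) e • fderiv ℝ (prolong r v x y) e (frameVec v x k e) := by
      simp only [h.fderiv_prolong hy he]
      refine Prod.ext (funext fun i => ?_) (funext fun J => funext fun σ => ?_)
      · simp only [Prod.fst_add, Prod.fst_sum, Prod.smul_fst, zero_add, Finset.sum_apply,
          Pi.smul_apply, smul_eq_mul]
        have : ∀ k, dirDeriv (frameVec v x k e) (x i) e = if i = k then 1 else 0 :=
          fun k => h.frame_coord he k i
        simp [this]
      · simp only [Prod.snd_add, Prod.snd_sum, Prod.smul_snd, Finset.sum_apply,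
          Pi.smul_apply, smul_eq_mul, Pi.add_apply]
        exact h.dirDeriv_opList (hy σ) w (idxList J.1) he
    simp only [dirDeriv, chain, frame] at e1 ⊢
    rw [e1, map_add, map_sum, sum_yVec]
    simp only [map_sum, map_smul, smul_eq_mul]
  -- Jacobi's formula supplies the frame divergence of the horizontal coefficients, which completes
  -- the horizontal terms to full divergences.
  rw [dirDeriv_mul (d (contDiffOn_det h.jac_smooth)) (d hℓ), hw, h.dirDeriv_det w he]
  simp only [frame_mul _ (d (hξ _)) (d hℓ), Finset.sum_add_distrib, ← Finset.sum_mul]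
  ring

end Variation

/-! ### Transformation of the Euler–Lagrange expressions -/

variable {n m : ℕ} {X : Type*} [TopologicalSpace X] [ChartedSpace (Fin (n + m) → ℝ) X]

lemma chartTarget_eq_overSet {s : ℕ} (hs : 1 ≤ s) (ψ : Chart n m X) :
    chartTarget s ψ = overSet n m s ψ.1.target := chartTarget_eq hs ψ

lemma opList_pd_translate (f : (Fin n → ℝ) → ℝ) (t : Fin n → ℝ) (l : List (Fin n)) :
    opList pd l (fun u => f (t + u)) = fun u => opList pd l f (t + u) := by
  induction l with
  | nil => rfl
  | cons i l ih =>
    rw [opList_cons, ih]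
    funext u
    simp only [pd, opList_cons]
    rw [fderiv_comp_add_left]

/-! ### Variations of polynomial graphs -/

section Vary

variable {ψ ψ' : Chart n m X} {s : ℕ}

/-- The variation of the polynomial graph of `e` by `ε η` in the direction `σ`. -/
def varFam (e : Coords n m s) (η : (Fin n → ℝ) → ℝ) (σ : Fin m) (p : ℝ × (Fin n → ℝ)) :
    Fin (n + m) → ℝ :=
  Fin.append (e.1 + p.2) (taylorFun e.2 p.2 + (p.1 * η p.2) • Pi.single σ 1)

lemma contDiff_varFam (e : Coords n m s) {η : (Fin n → ℝ) → ℝ} (hη : ContDiff ℝ ∞ η)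
    (σ : Fin m) : ContDiff ℝ ∞ (varFam e η σ) := by
  refine contDiffOn_univ.mp (contDiffOn_append (ContDiff.contDiffOn ?_) (ContDiff.contDiffOn ?_))
  · exact contDiff_const.add contDiff_snd
  · exact ((contDiff_taylorFun e.2).comp contDiff_snd).add
      ((contDiff_fst.mul (hη.comp contDiff_snd)).smul contDiff_const)

/-- The polynomial graph with coordinates `e`, as a curve in the chart. -/
def polyCurve (e : Coords n m s) (t : Fin n → ℝ) : Fin (n + m) → ℝ := polyFam n m s (e, t)

lemma contDiff_polyCurve (e : Coords n m s) : ContDiff ℝ ∞ (polyCurve e) :=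
  (contDiff_polyFam n m s).comp (contDiff_const.prodMk contDiff_id)

lemma varFam_zero (e : Coords n m s) (η : (Fin n → ℝ) → ℝ) (σ : Fin m) (t : Fin n → ℝ) :
    varFam e η σ (0, t) = polyCurve e t := by
  simp [varFam, polyCurve, polyFam]

section Slice

variable {E : Type*} [NormedAddCommGroup E] [NormedSpace ℝ E]

lemma hasFDerivAt_slice (e : E) (t : Fin n → ℝ) :
    HasFDerivAt (fun t : Fin n → ℝ => (e, t))
      ((0 : (Fin n → ℝ) →L[ℝ] E).prod (ContinuousLinearMap.id ℝ (Fin n → ℝ))) t :=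
  (hasFDerivAt_const e t).prodMk (hasFDerivAt_id t)

variable {c : E × (Fin n → ℝ) → Fin (n + m) → ℝ}

lemma frameJac_slice (hc : ContDiff ℝ ∞ c) {e : E} {t : Fin n → ℝ}
    (ht : c (e, t) ∈ chartOverlap ψ ψ') :
    frameJac (stdVec n) (famX ψ ψ' fun t => c (e, t)) t =
      frameJac (sndVec E n) (famX ψ ψ' c) (e, t) := by
  ext i j
  have ho : IsOpen (c ⁻¹' chartOverlap ψ ψ') :=
    (isOpen_chartOverlap ψ ψ').preimage hc.continuous
  have hd : DifferentiableAt ℝ (famX ψ ψ' c i) (e, t) :=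
    differentiableAt_of_contDiffOn ho (contDiffOn_fam hc _) ht
  have h1 : HasFDerivAt (famX ψ ψ' (fun t => c (e, t)) i) _ t :=
    HasFDerivAt.comp t (f := fun t : Fin n → ℝ => (e, t)) hd.hasFDerivAt (hasFDerivAt_slice e t)
  simp only [frameJac, Matrix.of_apply]
  rw [h1.fderiv]
  rfl

/-- The frame directions lie in the second factor, so freezing the parameter `e` commutes with all
frame derivatives. -/
lemma opList_slice (hc : ContDiff ℝ ∞ c) {f : E × (Fin n → ℝ) → ℝ}
    (hf : ContDiffOn ℝ ∞ f (famDom ψ ψ' (sndVec E n) c)) (l : List (Fin n)) (e : E) :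
    Set.EqOn (opList (frame (stdVec n) (famX ψ ψ' fun t => c (e, t))) l fun t => f (e, t))
      (fun t => opList (frame (sndVec E n) (famX ψ ψ' c)) l f (e, t))
      {t | (e, t) ∈ famDom ψ ψ' (sndVec E n) c} := by
  have h := frameOn_famDom (ψ := ψ) (ψ' := ψ') (v := sndVec E n) hc
  have ho : IsOpen {t : Fin n → ℝ | (e, t) ∈ famDom ψ ψ' (sndVec E n) c} :=
    h.isOpen.preimage (continuous_const.prodMk continuous_id)
  refine opList_frame_comp (α := fun t : Fin n → ℝ => (e, t)) ho h (fun t ht => ht)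
    (fun t _ => (hasFDerivAt_slice e t).differentiableAt) (fun _ => 1) (fun t _ j => ?_)
    (fun t _ => by simp) hf l
  rw [(hasFDerivAt_slice e t).fderiv]
  simp [Matrix.one_apply, sndVec]

lemma prolong_slice (hc : ContDiff ℝ ∞ c) (k : ℕ) {e : E} {t : Fin n → ℝ}
    (ht : (e, t) ∈ famDom ψ ψ' (sndVec E n) c) :
    prolong k (stdVec n) (famX ψ ψ' fun t => c (e, t)) (famY ψ ψ' fun t => c (e, t)) t =
      prolong k (sndVec E n) (famX ψ ψ' c) (famY ψ ψ' c) (e, t) :=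
  Prod.ext rfl (funext fun J => funext fun σ =>
    opList_slice hc (contDiffOn_famY hc σ) (idxList J.1) e ht)

lemma mem_famDom_slice (hc : ContDiff ℝ ∞ c) {e : E} {t : Fin n → ℝ} :
    t ∈ famDom ψ ψ' (stdVec n) (fun t => c (e, t)) ↔ (e, t) ∈ famDom ψ ψ' (sndVec E n) c :=
  and_congr_right fun h => by rw [← frameJac_slice hc h]

end Slice

/-- The coordinates, of order `k`, of the polynomial graph at the parameter `t`. -/
def polyJet (k : ℕ) (e : Coords n m s) (t : Fin n → ℝ) : Coords n m k :=
  prolong k (stdVec n) (fun i t => e.1 i + t i) (fun σ t => taylorFun e.2 t σ) t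

lemma frameOn_translate {O : Set (Fin n → ℝ)} (hO : IsOpen O) (a : Fin n → ℝ) :
    FrameOn O (stdVec n) (fun i t => a i + t i) where
  isOpen := hO
  smooth i := (contDiff_const.add (contDiff_apply ℝ ℝ i)).contDiffOn
  det_ne t _ := by
    have : frameJac (stdVec n) (fun i (t : Fin n → ℝ) => a i + t i) t = 1 := by
      rw [← frameJac_std t]
      ext i j
      simp only [frameJac, Matrix.of_apply, fderiv_const_add]
      rfl
    rw [this]
    simp

lemma opList_frame_translate (a : Fin n → ℝ) (f : (Fin n → ℝ) → ℝ) (l : List (Fin n))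
    (t : Fin n → ℝ) : opList (frame (stdVec n) fun i t => a i + t i) l f t = opList pd l f t := by
  rw [pd_eq_frame]
  refine opList_frame_eq_of_fderiv_coord_eq isOpen_univ (fun e _ i => ?_) (fun _ _ => rfl) l
    (Set.mem_univ t)
  simp only [fderiv_const_add]
  rfl

lemma basePt_polyJet (k : ℕ) (e : Coords n m s) (t : Fin n → ℝ) :
    basePt (polyJet k e t) = polyCurve e t := by
  rw [polyJet, basePt_prolong]
  rfl

lemma polyJet_zero (e : Coords n m s) : polyJet s e 0 = e := by
  refine Prod.ext (funext fun i => ?_) (funext fun J => funext fun σ => ?_)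
  · simp [polyJet, prolong]
  · simp only [polyJet, prolong]
    rw [opList_frame_translate]
    exact opList_idxList_taylorFun e.2 σ J

/-- The two local expressions of the Lagrangian along a variation. -/
lemma lagrangian_varFam {r : ℕ} (hr : 1 ≤ r) {𝓛 : ImmVel n m X r → ℝ}
    {L L' : Coords n m r → ℝ} (hL : IsLocalLagrangian 𝓛 ψ L) (hL' : IsLocalLagrangian 𝓛 ψ' L')
    (e : Coords n m s) {η : (Fin n → ℝ) → ℝ} (hη : ContDiff ℝ ∞ η) (σ : Fin m) {ε : ℝ}
    {t : Fin n → ℝ} (h : (ε, t) ∈ famDom ψ ψ' (sndVec ℝ n) (varFam e η σ)) :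
    L (polyJet r e t + ε • (0, fun J => Pi.single σ (opList pd (idxList J.1) η t))) =
      (frameJac (sndVec ℝ n) (famX ψ ψ' (varFam e η σ)) (ε, t)).det *
        L' (prolong r (sndVec ℝ n) (famX ψ ψ' (varFam e η σ)) (famY ψ ψ' (varFam e η σ))
          (ε, t)) := by
  -- The perturbed graph recentred at `t`, so that its jet at `0` is the jet of the variation at
  -- `t`. Being a graph in `ψ`, it has `det 𝐱 = 1` there, and only the chart `ψ'` contributes a
  -- determinant.
  let g : (Fin n → ℝ) → Fin m → ℝ := fun u =>
    taylorFun e.2 (t + u) + (ε * η (t + u)) • Pi.single σ 1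
  have hg : ContDiff ℝ ∞ g :=
    ((contDiff_taylorFun e.2).comp (contDiff_const.add contDiff_id)).add
      ((contDiff_const.mul (hη.comp (contDiff_const.add contDiff_id))).smul contDiff_const)
  have hmem : Fin.append (e.1 + t) (g 0) ∈ ψ.1.target := by
    have := h.1.1
    simpa [g, varFam] using this
  let γ := graphGerm ψ (e.1 + t) g hg hmem
  obtain ⟨h1, h2, h3⟩ := adapted_slice (ψ := ψ) (ψ' := ψ') (contDiff_varFam e hη σ)
    (α := fun u => (ε, t + u)) (differentiable_slice ε t) (fderiv_slice ε t) (γ := γ)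
    (fun u => by simp [γ, graphGerm, varFam, g, add_assoc]) (by rw [add_zero]; exact h)
  simp only [add_zero] at h2 h3
  have h4 := hL γ inDom_graphGerm
  have h5 := hL' γ h1
  rw [chart_proj_jet hr inDom_graphGerm, jac_graphGerm, Matrix.det_one, one_mul] at h4
  rw [chart_proj_jet hr h1, h2, h3] at h5
  rw [← h5, h4]
  congr 1
  rw [adapted_graphGerm]
  refine Prod.ext (funext fun i => ?_) (funext fun J => funext fun τ => ?_)
  · simp [polyJet, prolong]
  · simp only [polyJet, prolong, Prod.snd_add, Prod.smul_snd, Pi.add_apply, Pi.smul_apply,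
      smul_eq_mul]
    rw [opList_frame_translate]
    have e1 : (fun u => g u τ) =
        fun u => (fun u => taylorFun e.2 u τ + (ε * (Pi.single σ (1 : ℝ) : Fin m → ℝ) τ) * η u)
          (t + u) := by
      funext u
      simp only [g, Pi.add_apply, Pi.smul_apply, smul_eq_mul]
      ring
    have hY : ContDiff ℝ ∞ (fun u => taylorFun e.2 u τ) :=
      contDiff_pi.mp (contDiff_taylorFun e.2) τ
    have e4 := congrFun (opList_pd_translate (fun u => taylorFun e.2 u τ +
      (ε * (Pi.single σ (1 : ℝ) : Fin m → ℝ) τ) * η u) t (idxList J.1)) 0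
    rw [e1]
    refine Eq.trans ?_ e4.symm
    simp only [add_zero]
    have e2 := (frameOn_std isOpen_univ).opList_add hY.contDiffOn
      ((contDiff_const (c := ε * (Pi.single σ (1 : ℝ) : Fin m → ℝ) τ)).mul hη).contDiffOn
      (idxList J.1) (Set.mem_univ t)
    have e3 := (frameOn_std isOpen_univ).opList_const_mul
      (ε * (Pi.single σ (1 : ℝ) : Fin m → ℝ) τ) hη.contDiffOn (idxList J.1) (Set.mem_univ t)
    rw [pd_eq_frame]
    refine Eq.trans (congrArg₂ (· + ·) rfl (Eq.trans ?_ e3.symm)) e2.symm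
    by_cases hτ : τ = σ
    · subst hτ; simp
    · simp [Pi.single_eq_of_ne hτ]

end Vary

variable {n m : ℕ} {X : Type*} [TopologicalSpace X] [ChartedSpace (Fin (n + m) → ℝ) X]

/-! ### The variation field read in the second chart -/

section Euler

variable {ψ ψ' : Chart n m X} {s : ℕ}

lemma varFam_slice_zero (e : Coords n m s) (η : (Fin n → ℝ) → ℝ) (σ : Fin m) :
    (fun t => varFam e η σ (0, t)) = polyCurve e := funext (varFam_zero e η σ)

lemma zero_mem_famDom_polyCurve {e : Coords n m s} (he : e ∈ adaptedOverlap s ψ ψ') :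
    0 ∈ famDom ψ ψ' (stdVec n) (polyCurve e) :=
  (mem_famDom_slice (contDiff_polyFam n m s)).mpr he

lemma transition_eq_prolong_polyCurve (hs : 1 ≤ s) {e : Coords n m s}
    (he : e ∈ adaptedOverlap s ψ ψ') : transition s ψ ψ' e =
      prolong s (stdVec n) (famX ψ ψ' (polyCurve e)) (famY ψ ψ' (polyCurve e)) 0 := by
  rw [transition_eq_prolong hs he]
  exact (prolong_slice (contDiff_polyFam n m s) s he).symm

lemma frameJac_polyCurve_zero (hs : 1 ≤ s) {e : Coords n m s} (he : e ∈ adaptedOverlap s ψ ψ') :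
    frameJac (stdVec n) (famX ψ ψ' (polyCurve e)) 0 = tangentMatrix ψ ψ' e := by
  have h1 := frameJac_slice (ψ := ψ) (ψ' := ψ') (contDiff_polyFam n m s) (e := e) he.1
  refine h1.trans ?_
  ext i j
  have hd : DifferentiableAt ℝ (fun u => chartChange ψ ψ' u) (polyFam n m s (e, 0)) :=
    differentiableAt_of_contDiffOn (isOpen_chartOverlap ψ ψ') (contDiffOn_chartChange ψ ψ') he.1
  have h2 : HasFDerivAt (fun p => chartChange ψ ψ' (polyFam n m s p)) _ (e, 0) :=
    hd.hasFDerivAt.comp (e, (0 : Fin n → ℝ))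
      ((contDiff_polyFam n m s).differentiable (by simp) (e, 0)).hasFDerivAt
  have h3 : fderiv ℝ (famX ψ ψ' (polyFam n m s) i) (e, 0) = _ :=
    (hasFDerivAt_pi'.mp h2 (Fin.castAdd m i)).fderiv
  simp only [frameJac, Matrix.of_apply, tangentMatrix]
  rw [h3, ContinuousLinearMap.comp_apply, ContinuousLinearMap.comp_apply, fderiv_polyFam hs,
    polyFam_zero]
  rfl

/-- The derivative of the coordinate `A` of `ψ'` along the direction `σ`. -/
def vertDeriv (ψ ψ' : Chart n m X) (σ : Fin m) (A : Fin (n + m)) (u : Fin (n + m) → ℝ) : ℝ :=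
  dirDeriv (Fin.append 0 (Pi.single σ 1)) (fun u => chartChange ψ ψ' u A) u

lemma contDiffOn_vertDeriv (σ : Fin m) (A : Fin (n + m)) :
    ContDiffOn ℝ ∞ (vertDeriv ψ ψ' σ A) (chartOverlap ψ ψ') :=
  contDiffOn_dirDeriv (isOpen_chartOverlap ψ ψ') (contDiffOn_chartChange_apply ψ ψ' A) _

lemma contDiffOn_vertDeriv_polyCurve (e : Coords n m s) (σ : Fin m) (A : Fin (n + m)) :
    ContDiffOn ℝ ∞ (fun t => vertDeriv ψ ψ' σ A (polyCurve e t))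
      (famDom ψ ψ' (stdVec n) (polyCurve e)) :=
  (contDiffOn_vertDeriv σ A).comp (contDiff_polyCurve e).contDiffOn fun _ h => h.1

/-- At fixed `t` the family is affine in `ε`, with slope `η t` in the direction `y^σ`. -/
lemma fderiv_varFam_one (e : Coords n m s) {η : (Fin n → ℝ) → ℝ} (hη : ContDiff ℝ ∞ η)
    (σ : Fin m) (t : Fin n → ℝ) : fderiv ℝ (varFam e η σ) (0, t) (1, 0) =
      η t • (Fin.append 0 (Pi.single σ 1) : Fin (n + m) → ℝ) := by
  have h1 := (((contDiff_varFam e hη σ).differentiable (by simp)) (0, t)).hasFDerivAt.hasLineDerivAt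
    (1, 0)
  have h2 : HasDerivAt (fun ε : ℝ => polyCurve e t +
      ε • (η t • (Fin.append 0 (Pi.single σ 1) : Fin (n + m) → ℝ))) _ 0 :=
    ((hasDerivAt_id (0 : ℝ)).smul_const _).const_add _
  rw [one_smul] at h2
  refine HasDerivAt.unique (h1 : HasDerivAt _ _ _) (h2.congr_of_eventuallyEq (.of_forall ?_))
  intro ε
  funext A
  refine Fin.addCases (fun i => ?_) (fun σ => ?_) A <;>
    simp [varFam, polyCurve, polyFam, mul_assoc]

lemma dirDeriv_varFam {e : Coords n m s} {η : (Fin n → ℝ) → ℝ} (hη : ContDiff ℝ ∞ η)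
    (σ : Fin m) {t : Fin n → ℝ} (ht : polyCurve e t ∈ chartOverlap ψ ψ') (A : Fin (n + m)) :
    dirDeriv (1, 0) (fun p => chartChange ψ ψ' (varFam e η σ p) A) (0, t) =
      η t * vertDeriv ψ ψ' σ A (polyCurve e t) := by
  rw [← varFam_zero e η σ t] at ht
  have hd : DifferentiableAt ℝ (fun u => chartChange ψ ψ' u A) (varFam e η σ (0, t)) :=
    differentiableAt_of_contDiffOn (isOpen_chartOverlap ψ ψ')
      (contDiffOn_chartChange_apply ψ ψ' A) ht
  have h2 : HasFDerivAt (fun p => chartChange ψ ψ' (varFam e η σ p) A) _ (0, t) :=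
    hd.hasFDerivAt.comp ((0 : ℝ), t)
      ((contDiff_varFam e hη σ).differentiable (by simp) (0, t)).hasFDerivAt
  rw [dirDeriv, h2.fderiv, ContinuousLinearMap.comp_apply, fderiv_varFam_one e hη, map_smul,
    varFam_zero]
  rfl

/-- The coefficients `P^ν_σ` along the polynomial graph of `e`. -/
def vertCoeff (ψ ψ' : Chart n m X) (e : Coords n m s) (σ ν : Fin m) (t : Fin n → ℝ) : ℝ :=
  vertDeriv ψ ψ' σ (Fin.natAdd n ν) (polyCurve e t) -
    ∑ k, vertDeriv ψ ψ' σ (Fin.castAdd m k) (polyCurve e t) *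
      frame (stdVec n) (famX ψ ψ' (polyCurve e)) k (famY ψ ψ' (polyCurve e) ν) t

lemma contDiffOn_vertCoeff (e : Coords n m s) (σ ν : Fin m) :
    ContDiffOn ℝ ∞ (vertCoeff ψ ψ' e σ ν) (famDom ψ ψ' (stdVec n) (polyCurve e)) :=
  (contDiffOn_vertDeriv_polyCurve e σ _).sub (ContDiffOn.sum fun k _ =>
    (contDiffOn_vertDeriv_polyCurve e σ _).mul
      ((frameOn_famDom (contDiff_polyCurve e)).contDiffOn
        (contDiffOn_famY (contDiff_polyCurve e) ν) k))

/-- The frame derivatives of `ȳ^ν` at parameter `0` are the coordinates `ȳ^ν_i` of the transformed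
point, so the vertical part of the variation is the matrix `P`. -/
lemma vertCoeff_zero (hs : 1 ≤ s) {e : Coords n m s} (he : e ∈ adaptedOverlap s ψ ψ')
    (σ ν : Fin m) : vertCoeff ψ ψ' e σ ν 0 = pMatrix s ψ ψ' ν σ e := by
  have hd := differentiableAt_of_contDiffOn (isOpen_chartOverlap ψ ψ')
    (contDiffOn_chartChange ψ ψ') (basePt_mem_of_adaptedOverlap he)
  have h0 : polyCurve e 0 = basePt e := polyFam_zero e
  have h1 : ∀ A, vertDeriv ψ ψ' σ A (basePt e) =
      fderiv ℝ (chartChange ψ ψ') (basePt e) (Fin.append 0 (Pi.single σ 1)) A := fun A => by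
    rw [vertDeriv, dirDeriv, (hasFDerivAt_pi'.mp hd.hasFDerivAt A).fderiv]
    rfl
  have h2 : ∀ i, yCoord (transition s ψ ψ' e) (unitIdx i) ν =
      frame (stdVec n) (famX ψ ψ' (polyCurve e)) i (famY ψ ψ' (polyCurve e) ν) 0 := fun i => by
    rw [transition_eq_prolong_polyCurve hs he, yCoord_prolong (by simpa [sum_unitIdx] using hs),
      idxList_unit]
    rfl
  rw [pMatrix_eq hs he, vertCoeff]
  simp only [h0, h1, h2]
  congr 1
  exact Finset.sum_congr rfl fun _ _ => mul_comm _ _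

end Euler

variable {n m : ℕ} {X : Type*} [TopologicalSpace X] [ChartedSpace (Fin (n + m) → ℝ) X]

/-! ### The first variation in two charts -/

section Euler

open MeasureTheory

variable {ψ ψ' : Chart n m X} {r s : ℕ} {𝓛 : ImmVel n m X r → ℝ} {L L' : Coords n m r → ℝ}

lemma mem_overSet {Ω : Set (Fin (n + m) → ℝ)} {e : Coords n m s} :
    e ∈ overSet n m s Ω ↔ basePt e ∈ Ω := Iff.rfl

lemma append_famX_famY {E : Type*} (c : E → Fin (n + m) → ℝ) (t : E) :
    Fin.append (fun i => famX ψ ψ' c i t) (fun σ => famY ψ ψ' c σ t) =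
      chartChange ψ ψ' (c t) := by
  funext A
  refine Fin.addCases (fun i => ?_) (fun σ => ?_) A <;> simp [famX, famY]

lemma chartChange_mem {u : Fin (n + m) → ℝ} (hu : u ∈ chartOverlap ψ ψ') :
    chartChange ψ ψ' u ∈ ψ'.1.target := ψ'.1.map_source hu.2

/-- The first variation of the two local expressions of the Lagrangian. -/
lemma first_variation (hr : 1 ≤ r) (hL : IsLocalLagrangian 𝓛 ψ L)
    (hL' : IsLocalLagrangian 𝓛 ψ' L') (sL : ContDiffOn ℝ ∞ L (overSet n m r ψ.1.target))
    (sL' : ContDiffOn ℝ ∞ L' (overSet n m r ψ'.1.target)) (e : Coords n m s)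
    {η : (Fin n → ℝ) → ℝ} (hη : ContDiff ℝ ∞ η) (σ : Fin m) {t : Fin n → ℝ}
    (ht : t ∈ famDom ψ ψ' (stdVec n) (polyCurve e)) :
    ∑ J : MultiIdx n r, opList pd (idxList J.1) η t * fderiv ℝ L (polyJet r e t) (yVec J σ) =
      (∑ J : MultiIdx n r, ∑ ν, opList (frame (stdVec n) (famX ψ ψ' (polyCurve e))) (idxList J.1)
          (fun t => η t * vertCoeff ψ ψ' e σ ν t) t *
          fderiv ℝ L' (prolong r (stdVec n) (famX ψ ψ' (polyCurve e))
            (famY ψ ψ' (polyCurve e)) t) (yVec J ν) +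
        ∑ k, frame (stdVec n) (famX ψ ψ' (polyCurve e)) k
          (fun t => η t * (vertDeriv ψ ψ' σ (Fin.castAdd m k) (polyCurve e t) *
            L' (prolong r (stdVec n) (famX ψ ψ' (polyCurve e)) (famY ψ ψ' (polyCurve e)) t))) t) *
        (frameJac (stdVec n) (famX ψ ψ' (polyCurve e)) t).det := by
  have hc := contDiff_varFam e hη σ
  have hF := frameOn_famDom (ψ := ψ) (ψ' := ψ') (v := sndVec ℝ n) hc
  have hY : ∀ ν, ContDiffOn ℝ ∞ (famY ψ ψ' (varFam e η σ) ν) _ :=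
    fun ν => contDiffOn_famY (v := sndVec ℝ n) hc ν
  have c0 := varFam_slice_zero e η σ
  have hmem : ∀ {t}, t ∈ famDom ψ ψ' (stdVec n) (polyCurve e) →
      ((0 : ℝ), t) ∈ famDom ψ ψ' (sndVec ℝ n) (varFam e η σ) := fun {t} ht => by
    rw [← mem_famDom_slice hc, c0]
    exact ht
  have hT' : IsOpen (overSet n m r ψ'.1.target) := isOpen_overSet ψ'.1.open_target
  have hm' : Set.MapsTo (prolong r (sndVec ℝ n) (famX ψ ψ' (varFam e η σ))
      (famY ψ ψ' (varFam e η σ))) (famDom ψ ψ' (sndVec ℝ n) (varFam e η σ))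
      (overSet n m r ψ'.1.target) := fun p hp => by
    rw [mem_overSet, basePt_prolong, append_famX_famY]
    exact chartChange_mem hp.1
  have hpr := hF.contDiffOn_prolong (s := r) hY
  -- the derivative of the left hand side
  have hLd : DifferentiableAt ℝ L (polyJet r e t) := by
    refine differentiableAt_of_contDiffOn (isOpen_overSet ψ.1.open_target) sL ?_
    rw [mem_overSet, basePt_polyJet]
    exact ht.1.1
  have h1 : HasDerivAt _ _ _ := hLd.hasFDerivAt.hasLineDerivAt
    ((0, fun J => Pi.single σ (opList pd (idxList J.1) η t)) : Coords n m r)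
  -- the derivative of the right hand side
  have hG := (contDiffOn_det (k := ∞) hF.jac_smooth).mul (sL'.comp hpr hm')
  have h2 : HasDerivAt _ _ _ := (differentiableAt_of_contDiffOn hF.isOpen hG
    (hmem ht)).hasFDerivAt.hasLineDerivAt ((1 : ℝ), (0 : Fin n → ℝ))
  have ho : ∀ᶠ ε in 𝓝 (0 : ℝ), (ε, t) ∈ famDom ψ ψ' (sndVec ℝ n) (varFam e η σ) :=
    (hF.isOpen.preimage (continuous_id.prodMk continuous_const)).mem_nhds (hmem ht)
  -- The two expressions agree only for `ε` near `0`, while the perturbed graph is still transverse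
  -- in `ψ'`; this determines the derivative at `0`.
  have h3 := h1.unique (h2.congr_of_eventuallyEq (by
    filter_upwards [ho] with ε hε
    rw [lagrangian_varFam hr hL hL' e hη σ hε]
    simp))
  have h4 := hF.dirDeriv_density hY hT' hm' sL' ((1 : ℝ), (0 : Fin n → ℝ)) (hmem ht)
  have h5 := h3.trans h4
  rw [sum_yVec] at h5
  simp only [map_sum, map_smul, smul_eq_mul] at h5
  have e1 : ∀ J : MultiIdx n r, ∑ ν, (Pi.single σ (opList pd (idxList J.1) η t) : Fin m → ℝ) ν *
      fderiv ℝ L (polyJet r e t) (yVec J ν) =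
      opList pd (idxList J.1) η t * fderiv ℝ L (polyJet r e t) (yVec J σ) := fun J => by
    rw [Finset.sum_eq_single σ (fun ν _ h => by simp [Pi.single_eq_of_ne h]) (by simp)]
    simp
  simp only [e1] at h5
  have hpe : ∀ {t}, t ∈ famDom ψ ψ' (stdVec n) (polyCurve e) →
      prolong r (sndVec ℝ n) (famX ψ ψ' (varFam e η σ)) (famY ψ ψ' (varFam e η σ)) (0, t) =
      prolong r (stdVec n) (famX ψ ψ' (polyCurve e)) (famY ψ ψ' (polyCurve e)) t :=
    fun {t} ht => by
      rw [← prolong_slice hc r (hmem ht), c0]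
  have hU : FrameOn (famDom ψ ψ' (stdVec n) (polyCurve e)) (stdVec n)
    (famX ψ ψ' (polyCurve e)) := frameOn_famDom (contDiff_polyCurve e)
  -- operators on the slice
  have hop : ∀ {f : ℝ × (Fin n → ℝ) → ℝ} {g : (Fin n → ℝ) → ℝ},
      ContDiffOn ℝ ∞ f (famDom ψ ψ' (sndVec ℝ n) (varFam e η σ)) →
      (∀ t ∈ famDom ψ ψ' (stdVec n) (polyCurve e), f (0, t) = g t) → ∀ l,
      ∀ t ∈ famDom ψ ψ' (stdVec n) (polyCurve e),
      opList (frame (sndVec ℝ n) (famX ψ ψ' (varFam e η σ))) l f (0, t) =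
        opList (frame (stdVec n) (famX ψ ψ' (polyCurve e))) l g t := by
    intro f g hf hg l t ht
    have a1 := opList_slice hc hf l 0 (hmem ht)
    rw [c0] at a1
    rw [← opList_frame_congr hU.isOpen hg l ht]
    exact a1.symm
  have hvx : ∀ k, ∀ t ∈ famDom ψ ψ' (stdVec n) (polyCurve e),
      dirDeriv (1, 0) (famX ψ ψ' (varFam e η σ) k) (0, t) =
        η t * vertDeriv ψ ψ' σ (Fin.castAdd m k) (polyCurve e t) :=
    fun k t ht => dirDeriv_varFam hη σ ht.1 _
  have hvv : ∀ ν, ∀ t ∈ famDom ψ ψ' (stdVec n) (polyCurve e),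
      vertVar (sndVec ℝ n) (famX ψ ψ' (varFam e η σ)) (1, 0) (famY ψ ψ' (varFam e η σ) ν) (0, t) =
        η t * vertCoeff ψ ψ' e σ ν t := by
    intro ν t ht
    have hfr : ∀ k, frame (sndVec ℝ n) (famX ψ ψ' (varFam e η σ)) k
        (famY ψ ψ' (varFam e η σ) ν) (0, t) =
        frame (stdVec n) (famX ψ ψ' (polyCurve e)) k (famY ψ ψ' (polyCurve e) ν) t := fun k =>
      hop (hY ν) (fun t _ => congrFun (congrArg (fun c => famY ψ ψ' c ν) c0) t) [k] t ht
    simp only [vertVar, hvx _ t ht, hfr, vertCoeff]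
    rw [show dirDeriv (1, 0) (famY ψ ψ' (varFam e η σ) ν) (0, t) = _ from
      dirDeriv_varFam hη σ ht.1 _, mul_sub, Finset.mul_sum]
    congr 1
    exact Finset.sum_congr rfl fun _ _ => by ring
  rw [h5, hpe ht, ← frameJac_slice hc (hmem ht).1, c0]
  congr 2
  · refine Finset.sum_congr rfl fun J _ => Finset.sum_congr rfl fun ν _ => ?_
    rw [hop (hF.contDiffOn_vertVar (hY ν) _) (hvv ν) _ t ht]
  · refine Finset.sum_congr rfl fun k _ => ?_
    refine hop ((contDiffOn_dirDeriv hF.isOpen (hF.smooth k) _).mul (sL'.comp hpr hm'))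
      (fun t ht => ?_) [k] t ht
    rw [Function.comp_apply, hpe ht, hvx k t ht, mul_assoc]

end Euler

variable {n m : ℕ} {X : Type*} [TopologicalSpace X] [ChartedSpace (Fin (n + m) → ℝ) X]

/-! ### Integration of the first variation -/

section Euler

open MeasureTheory

lemma TestOn.eq_zero_of_notMem {U : Set (Fin n → ℝ)} {h : (Fin n → ℝ) → ℝ} (hh : TestOn U h)
    {t : Fin n → ℝ} (ht : t ∉ U) : h t = 0 := TestOn.eq_zero fun hc => ht (hh.subset hc)

lemma FrameOn.integral_sum_opList_mul {U : Set (Fin n → ℝ)} {x : Fin n → (Fin n → ℝ) → ℝ}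
    (hf : FrameOn U (stdVec n) x) {h : (Fin n → ℝ) → ℝ} (hh : TestOn U h) {r : ℕ}
    {a : MultiIdx n r → (Fin n → ℝ) → ℝ} (ha : ∀ J, ContDiffOn ℝ ∞ (a J) U) :
    ∫ t, (∑ J, opList (frame (stdVec n) x) (idxList J.1) h t * a J t) *
        (frameJac (stdVec n) x t).det =
      ∫ t, h t * ((∑ J, (-1) ^ (∑ i, J.1 i) * opList (frame (stdVec n) x) (idxList J.1) (a J) t) *
        (frameJac (stdVec n) x t).det) := by
  have hd : ContDiffOn ℝ ∞ (fun t => (frameJac (stdVec n) x t).det) U := contDiffOn_det hf.jac_smooth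
  have h1 : ∀ J, TestOn U (fun t => opList (frame (stdVec n) x) (idxList J.1) h t * a J t *
      (frameJac (stdVec n) x t).det) := fun J =>
    ((hf.testOn_opList hh _).mul hf.isOpen (ha J)).mul hf.isOpen hd
  have h2 : ∀ J, TestOn U (fun t => h t * opList (frame (stdVec n) x) (idxList J.1) (a J) t *
      (frameJac (stdVec n) x t).det) := fun J =>
    (hh.mul hf.isOpen (hf.contDiffOn_opList (ha J) _)).mul hf.isOpen hd
  simp only [Finset.sum_mul, Finset.mul_sum]
  rw [integral_finsetSum _ fun J _ => (h1 J).integrable]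
  have h3 : ∀ J : MultiIdx n r, (fun t => h t * ((-1) ^ (∑ i, J.1 i) *
      opList (frame (stdVec n) x) (idxList J.1) (a J) t * (frameJac (stdVec n) x t).det)) =
      fun t => (-1) ^ (∑ i, J.1 i) * (h t * opList (frame (stdVec n) x) (idxList J.1) (a J) t *
      (frameJac (stdVec n) x t).det) := fun J => funext fun t => by ring
  rw [integral_finsetSum _ fun J _ => by rw [h3]; exact (h2 J).integrable.const_mul _]
  refine Finset.sum_congr rfl fun J _ => ?_
  rw [h3, integral_const_mul, hf.integral_opList_mul hh (ha J), idxList_length]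

variable {ψ ψ' : Chart n m X} {r s : ℕ} {𝓛 : ImmVel n m X r → ℝ} {L L' : Coords n m r → ℝ}

lemma frameJac_translate (a t : Fin n → ℝ) :
    frameJac (stdVec n) (fun i t => a i + t i) t = 1 := by
  rw [← frameJac_std t]
  ext i j
  simp only [frameJac, Matrix.of_apply, fderiv_const_add]
  rfl

/-- The law is proved along the entire polynomial graph of `e` inside `U`, because localisation by
test functions needs an open set of parameters; it is then evaluated at parameter `0`. -/
lemma eulerLagrange_transform_of_contDiffOn (hr : 1 ≤ r) (hs : 2 * r ≤ s)
    (hL : IsLocalLagrangian 𝓛 ψ L)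
    (hL' : IsLocalLagrangian 𝓛 ψ' L') (sL : ContDiffOn ℝ ∞ L (overSet n m r ψ.1.target))
    (sL' : ContDiffOn ℝ ∞ L' (overSet n m r ψ'.1.target)) {e : Coords n m s}
    (he : e ∈ adaptedOverlap s ψ ψ') (σ : Fin m) :
    eulerLagrange s L σ e = jacobianDet s ψ ψ' e *
      ∑ ν, pMatrix s ψ ψ' ν σ e * eulerLagrange s L' ν (transition s ψ ψ' e) := by
  let U := famDom ψ ψ' (stdVec n) (polyCurve e)
  let x := famX ψ ψ' (polyCurve e)
  let y := famY ψ ψ' (polyCurve e)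
  have hF : FrameOn U (stdVec n) x := frameOn_famDom (contDiff_polyCurve e)
  have hU := hF.isOpen
  have hy : ∀ ν, ContDiffOn ℝ ∞ (y ν) U := contDiffOn_famY (contDiff_polyCurve e)
  have hT : FrameOn U (stdVec n) (fun i t => e.1 i + t i) := frameOn_translate hU e.1
  have hτ : ∀ ν, ContDiffOn ℝ ∞ (fun t => taylorFun e.2 t ν) U :=
    fun ν => (contDiff_pi.mp (contDiff_taylorFun e.2) ν).contDiffOn
  have hd : ContDiffOn ℝ ∞ (fun t => (frameJac (stdVec n) x t).det) U := contDiffOn_det hF.jac_smooth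
  have hm : ∀ t ∈ U, Fin.append (fun i => e.1 i + t i) (fun ν => taylorFun e.2 t ν) ∈
      ψ.1.target := fun t ht => ht.1.1
  have hm' : ∀ t ∈ U, Fin.append (fun i => x i t) (fun ν => y ν t) ∈ ψ'.1.target := fun t ht => by
    rw [append_famX_famY]
    exact chartChange_mem ht.1
  have hmt : Set.MapsTo (polyJet r e) U (overSet n m r ψ.1.target) := fun t ht => by
    rw [mem_overSet, basePt_polyJet]
    exact ht.1.1
  have hmt' : ∀ k, Set.MapsTo (prolong k (stdVec n) x y) U (overSet n m k ψ'.1.target) :=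
    fun k t ht => by
      rw [mem_overSet, basePt_prolong]
      exact hm' t ht
  have hmts : Set.MapsTo (polyJet s e) U (overSet n m s ψ.1.target) := fun t ht => by
    rw [mem_overSet, basePt_polyJet]
    exact ht.1.1
  have sa : ∀ J : MultiIdx n r,
      ContDiffOn ℝ ∞ (fun t => fderiv ℝ L (polyJet r e t) (yVec J σ)) U := fun J =>
    (contDiffOn_dirDeriv (isOpen_overSet ψ.1.open_target) sL (yVec J σ)).comp
      (hT.contDiffOn_prolong hτ) hmt
  have sb : ∀ (J : MultiIdx n r) ν,
      ContDiffOn ℝ ∞ (fun t => fderiv ℝ L' (prolong r (stdVec n) x y t) (yVec J ν)) U :=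
    fun J ν => (contDiffOn_dirDeriv (isOpen_overSet ψ'.1.open_target) sL' (yVec J ν)).comp
      (hF.contDiffOn_prolong hy) (hmt' r)
  have sP := fun ν => contDiffOn_vertCoeff (ψ := ψ) (ψ' := ψ') e σ ν
  have sE : ContDiffOn ℝ ∞ (fun t => eulerLagrange s L σ (polyJet s e t)) U :=
    (contDiffOn_eulerLagrange ψ.1.open_target sL σ).comp (hT.contDiffOn_prolong hτ) hmts
  have sE' : ∀ ν, ContDiffOn ℝ ∞
      (fun t => eulerLagrange s L' ν (prolong s (stdVec n) x y t)) U := fun ν =>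
    (contDiffOn_eulerLagrange ψ'.1.open_target sL' ν).comp (hF.contDiffOn_prolong hy) (hmt' s)
  have sR : ContDiffOn ℝ ∞ (fun t => (frameJac (stdVec n) x t).det *
      ∑ ν, vertCoeff ψ ψ' e σ ν t * eulerLagrange s L' ν (prolong s (stdVec n) x y t)) U :=
    hd.mul (ContDiffOn.sum fun ν _ => (sP ν).mul (sE' ν))
  have sK : ∀ k, ContDiffOn ℝ ∞ (fun t => vertDeriv ψ ψ' σ (Fin.castAdd m k) (polyCurve e t) *
      L' (prolong r (stdVec n) x y t)) U := fun k =>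
    (contDiffOn_vertDeriv_polyCurve e σ _).mul
      (sL'.comp (hF.contDiffOn_prolong hy) (hmt' r))
  have key : Set.EqOn (fun t => eulerLagrange s L σ (polyJet s e t) -
      (frameJac (stdVec n) x t).det * ∑ ν, vertCoeff ψ ψ' e σ ν t *
        eulerLagrange s L' ν (prolong s (stdVec n) x y t)) 0 U := by
    -- Here `i1` and `i2` move all derivatives off `η` and off the products `η P^ν_σ`, while `i3`
    -- removes the divergences.
    refine eqOn_zero_of_integral_test hU (sE.sub sR) fun η hη => ?_
    have i1 := hT.integral_sum_opList_mul hη sa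
    have i2 := fun ν => hF.integral_sum_opList_mul (hη.mul hU (sP ν)) (fun J => sb J ν)
    have i3 := fun k => hF.integral_frame (hη.mul hU (sK k)) k
    simp only [frameJac_translate, Matrix.det_one, mul_one] at i1
    have t1 : ∀ J : MultiIdx n r, TestOn U (fun t => opList (frame (stdVec n)
        fun i t => e.1 i + t i) (idxList J.1) η t * fderiv ℝ L (polyJet r e t) (yVec J σ)) :=
      fun J => (hT.testOn_opList hη _).mul hU (sa J)
    have t2 : ∀ (J : MultiIdx n r) ν, TestOn U (fun t => opList (frame (stdVec n) x) (idxList J.1)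
        (fun t => η t * vertCoeff ψ ψ' e σ ν t) t *
          fderiv ℝ L' (prolong r (stdVec n) x y t) (yVec J ν)) :=
      fun J ν => (hF.testOn_opList (hη.mul hU (sP ν)) _).mul hU (sb J ν)
    have t3 := fun k => hF.testOn_frame (hη.mul hU (sK k)) k
    -- the integrated first variation
    have fv : ∫ t, ∑ J : MultiIdx n r, opList (frame (stdVec n)
          fun i t => e.1 i + t i) (idxList J.1) η t * fderiv ℝ L (polyJet r e t) (yVec J σ) =
        ∑ ν, (∫ t, (∑ J : MultiIdx n r, opList (frame (stdVec n) x) (idxList J.1)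
          (fun t => η t * vertCoeff ψ ψ' e σ ν t) t *
          fderiv ℝ L' (prolong r (stdVec n) x y t) (yVec J ν)) *
            (frameJac (stdVec n) x t).det) +
        ∑ k, ∫ t, frame (stdVec n) x k (fun t => η t *
          (vertDeriv ψ ψ' σ (Fin.castAdd m k) (polyCurve e t) *
            L' (prolong r (stdVec n) x y t))) t * (frameJac (stdVec n) x t).det := by
      rw [← integral_finsetSum _ fun k _ => ((t3 k).mul hU hd).integrable,
        ← integral_finsetSum _ fun ν _ => ?_, ← integral_add]
      · refine integral_congr_ae (.of_forall fun t => ?_)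
        -- The pointwise first variation is available only on `U`; outside it every integrand
        -- vanishes by support.
        by_cases ht : t ∈ U
        · simp only [opList_frame_translate]
          rw [first_variation hr hL hL' sL sL' e hη.smooth σ ht, add_mul, Finset.sum_comm,
            Finset.sum_mul, Finset.sum_mul]
        · have h1 := fun J => (t1 J).eq_zero_of_notMem ht
          have h2 := fun J ν => (t2 J ν).eq_zero_of_notMem ht
          have h3 := fun k => (t3 k).eq_zero_of_notMem ht
          simp only [h1, h2, h3, Finset.sum_const_zero, zero_mul, add_zero]
      · refine integrable_finsetSum _ fun ν _ => ?_
        simp only [Finset.sum_mul]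
        exact integrable_finsetSum _ fun J _ => ((t2 J ν).mul hU hd).integrable
      · exact integrable_finsetSum _ fun k _ => ((t3 k).mul hU hd).integrable
      · simp only [Finset.sum_mul]
        exact integrable_finsetSum _ fun J _ => ((t2 J ν).mul hU hd).integrable
    rw [Finset.sum_eq_zero (fun k _ => i3 k), add_zero, i1, Finset.sum_congr rfl fun ν _ => i2 ν,
      ← integral_finsetSum _ fun ν _ => ?_] at fv
    · have hfin : (fun t => η t * (eulerLagrange s L σ (polyJet s e t) -
          (frameJac (stdVec n) x t).det * ∑ ν, vertCoeff ψ ψ' e σ ν t *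
            eulerLagrange s L' ν (prolong s (stdVec n) x y t))) = fun t =>
          η t * (∑ J : MultiIdx n r, (-1) ^ (∑ i, J.1 i) * opList (frame (stdVec n)
            fun i t => e.1 i + t i) (idxList J.1)
              (fun t => fderiv ℝ L (polyJet r e t) (yVec J σ)) t) -
          ∑ ν, η t * vertCoeff ψ ψ' e σ ν t * ((∑ J : MultiIdx n r, (-1) ^ (∑ i, J.1 i) *
            opList (frame (stdVec n) x) (idxList J.1)
              (fun t => fderiv ℝ L' (prolong r (stdVec n) x y t) (yVec J ν)) t) *
                (frameJac (stdVec n) x t).det) := by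
        funext t
        by_cases ht : t ∈ U
        · have h1 := hT.eulerLagrange_prolong hτ hs ψ.1.open_target hm sL σ ht
          have h2 := fun ν => hF.eulerLagrange_prolong hy hs ψ'.1.open_target hm' sL' ν ht
          rw [mul_sub]
          congr 1
          · exact congrArg (η t * ·) h1
          · rw [Finset.mul_sum, Finset.mul_sum]
            refine Finset.sum_congr rfl fun ν _ => ?_
            rw [h2]
            ring
        · simp [hη.eq_zero_of_notMem ht]
      rw [hfin, integral_sub, fv, sub_self]
      · refine TestOn.integrable (U := U) (hη.mul hU (ContDiffOn.sum fun J _ =>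
          contDiffOn_const.mul (hT.contDiffOn_opList (sa J) _)))
      · exact integrable_finsetSum _ fun ν _ => ((hη.mul hU (sP ν)).mul hU
          ((ContDiffOn.sum fun J _ =>
            contDiffOn_const.mul (hF.contDiffOn_opList (sb J ν) _)).mul hd)).integrable
    · exact ((hη.mul hU (sP ν)).mul hU ((ContDiffOn.sum fun J _ =>
        contDiffOn_const.mul (hF.contDiffOn_opList (sb J ν) _)).mul hd)).integrable
  -- At parameter `0` the jet of the graph is `e`, its image is the transformed point, the density
  -- is `𝒥` and the vertical coefficients are `P`.
  have h0 := key (zero_mem_famDom_polyCurve he)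
  have hs1 : 1 ≤ s := by omega
  simp only [Pi.zero_apply, x, y, polyJet_zero, frameJac_polyCurve_zero hs1 he,
    vertCoeff_zero hs1 he, ← transition_eq_prolong_polyCurve hs1 he] at h0
  rw [jacobianDet_eq hs1 he]
  exact sub_eq_zero.mp h0

lemma IsLocalLagrangian.contDiffOn (hr : 1 ≤ r) (h𝓛 : IsHomogeneousLagrangian 𝓛)
    (hL : IsLocalLagrangian 𝓛 ψ L) : ContDiffOn ℝ ∞ L (overSet n m r ψ.1.target) := by
  rw [← chartTarget_eq_overSet hr]
  exact (contDiffOn_localLagrangian hr h𝓛 ψ).congr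
    (hL.eqOn (isLocalLagrangian_localLagrangian hr h𝓛 ψ))

/-- The transformation law of the Euler–Lagrange expressions. -/
lemma eulerLagrange_transform (hr : 1 ≤ r) (hs : 2 * r ≤ s) (h𝓛 : IsHomogeneousLagrangian 𝓛)
    (hL : IsLocalLagrangian 𝓛 ψ L) (hL' : IsLocalLagrangian 𝓛 ψ' L') {e : Coords n m s}
    (he : e ∈ adaptedOverlap s ψ ψ') (σ : Fin m) :
    eulerLagrange s L σ e = jacobianDet s ψ ψ' e *
      ∑ ν, pMatrix s ψ ψ' ν σ e * eulerLagrange s L' ν (transition s ψ ψ' e) :=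
  eulerLagrange_transform_of_contDiffOn hr hs hL hL' (hL.contDiffOn hr h𝓛)
    (hL'.contDiffOn hr h𝓛) he σ

end Euler

/-! ### The wedge product of alternating maps -/

section Wedge

variable {V : Type*} [AddCommGroup V] [Module ℝ V] {p q k : ℕ}

/-- The wedge product of two alternating maps. -/
def altMul (a : V [⋀^Fin p]→ₗ[ℝ] ℝ) (b : V [⋀^Fin q]→ₗ[ℝ] ℝ) : V [⋀^Fin (p + q)]→ₗ[ℝ] ℝ :=
  ((LinearMap.mul' ℝ ℝ).compAlternatingMap (a.domCoprod b)).domDomCongr finSumFinEquiv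

/-- The product of two multilinear maps. -/
def tensorMul (a : MultilinearMap ℝ (fun _ : Fin p => V) ℝ)
    (b : MultilinearMap ℝ (fun _ : Fin q => V) ℝ) :
    MultilinearMap ℝ (fun _ : Fin (p + q) => V) ℝ :=
  ((LinearMap.mul' ℝ ℝ).compMultilinearMap (a.domCoprod b)).domDomCongr finSumFinEquiv

lemma tensorMul_apply (a : MultilinearMap ℝ (fun _ : Fin p => V) ℝ)
    (b : MultilinearMap ℝ (fun _ : Fin q => V) ℝ) (v : Fin (p + q) → V) :
    tensorMul a b v = a (fun i => v (Fin.castAdd q i)) * b (fun i => v (Fin.natAdd p i)) := by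
  simp [tensorMul]

lemma alternatization_domDomCongr {ι ι' : Type*} [Fintype ι] [Fintype ι'] [DecidableEq ι]
    [DecidableEq ι'] (e : ι ≃ ι') (m : MultilinearMap ℝ (fun _ : ι => V) ℝ) :
    MultilinearMap.alternatization (m.domDomCongr e) =
      (MultilinearMap.alternatization m).domDomCongr e := by
  ext v
  simp only [MultilinearMap.alternatization_apply, AlternatingMap.domDomCongr_apply]
  rw [← Equiv.sum_comp e.permCongr]
  refine Finset.sum_congr rfl fun σ _ => ?_
  rw [Equiv.Perm.sign_permCongr]
  congr 1
  simp [MultilinearMap.domDomCongr_apply, Function.comp_def]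

lemma alternatization_tensorMul (a : MultilinearMap ℝ (fun _ : Fin p => V) ℝ)
    (b : MultilinearMap ℝ (fun _ : Fin q => V) ℝ) :
    MultilinearMap.alternatization (tensorMul a b) =
      altMul (MultilinearMap.alternatization a) (MultilinearMap.alternatization b) := by
  rw [tensorMul, alternatization_domDomCongr, LinearMap.compMultilinearMap_alternatization,
    MultilinearMap.domCoprod_alternization]
  rfl

/-- The wedge product as a bilinear map. -/
def altMulL : (V [⋀^Fin p]→ₗ[ℝ] ℝ) →ₗ[ℝ] (V [⋀^Fin q]→ₗ[ℝ] ℝ) →ₗ[ℝ]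
    (V [⋀^Fin (p + q)]→ₗ[ℝ] ℝ) :=
  LinearMap.mk₂ ℝ altMul
    (fun a a' b => by
      simp only [altMul, ← AlternatingMap.domCoprod'_apply, TensorProduct.add_tmul, map_add]
      ext v; simp)
    (fun c a b => by
      simp only [altMul, ← AlternatingMap.domCoprod'_apply, ← TensorProduct.smul_tmul', map_smul]
      ext v; simp)
    (fun a b b' => by
      simp only [altMul, ← AlternatingMap.domCoprod'_apply, TensorProduct.tmul_add, map_add]
      ext v; simp)
    (fun c a b => by
      simp only [altMul, ← AlternatingMap.domCoprod'_apply, TensorProduct.tmul_smul, map_smul]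
      ext v; simp)

lemma altMulL_apply (a : V [⋀^Fin p]→ₗ[ℝ] ℝ) (b : V [⋀^Fin q]→ₗ[ℝ] ℝ) :
    altMulL a b = altMul a b := rfl

lemma alternatization_coe_fin (a : V [⋀^Fin p]→ₗ[ℝ] ℝ) :
    MultilinearMap.alternatization (a : MultilinearMap ℝ (fun _ : Fin p => V) ℝ) =
      (p.factorial : ℝ) • a := by
  rw [AlternatingMap.coe_alternatization, Fintype.card_fin, Nat.cast_smul_eq_nsmul]

/-- Alternating the tensor product of the three maps gives either bracketing multiplied by `p! q!
k!`. Tensor products are associative up to reindexing, and the factorials are invertible. -/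
lemma altMul_assoc (a : V [⋀^Fin p]→ₗ[ℝ] ℝ) (b : V [⋀^Fin q]→ₗ[ℝ] ℝ)
    (c : V [⋀^Fin k]→ₗ[ℝ] ℝ) :
    (altMul (altMul a b) c).domDomCongr (finCongr (Nat.add_assoc p q k)) =
      altMul a (altMul b c) := by
  have h1 := alternatization_tensorMul
    (tensorMul a.toMultilinearMap b.toMultilinearMap) c.toMultilinearMap
  have h2 := alternatization_tensorMul a.toMultilinearMap
    (tensorMul b.toMultilinearMap c.toMultilinearMap)
  rw [alternatization_tensorMul a.toMultilinearMap] at h1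
  rw [alternatization_tensorMul b.toMultilinearMap] at h2
  simp only [alternatization_coe_fin, ← altMulL_apply, map_smul, LinearMap.smul_apply] at h1 h2
  have h3 : tensorMul a.toMultilinearMap
        (tensorMul b.toMultilinearMap c.toMultilinearMap) =
      (tensorMul (tensorMul a.toMultilinearMap b.toMultilinearMap) c.toMultilinearMap).domDomCongr
        (finCongr (Nat.add_assoc p q k)) := by
    ext v
    have e1 : ∀ i, finCongr (Nat.add_assoc p q k) (Fin.castAdd k (Fin.castAdd q i)) =
      Fin.castAdd (q + k) i := fun i => rfl
    have e2 : ∀ i, finCongr (Nat.add_assoc p q k) (Fin.castAdd k (Fin.natAdd p i)) =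
      Fin.natAdd p (Fin.castAdd k i) := fun i => rfl
    have e3 : ∀ i, finCongr (Nat.add_assoc p q k) (Fin.natAdd (p + q) i) =
      Fin.natAdd p (Fin.natAdd q i) := fun i => Fin.ext (by simp [Nat.add_assoc])
    simp only [MultilinearMap.domDomCongr_apply, tensorMul_apply, mul_assoc]
    exact congrArg₂ (· * ·) (congrArg a (funext fun i => congrArg v (e1 i).symm))
      (congrArg₂ (· * ·) (congrArg b (funext fun i => congrArg v (e2 i).symm))
        (congrArg c (funext fun i => congrArg v (e3 i).symm)))
  rw [h3, alternatization_domDomCongr, h1] at h2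
  have hp : (p.factorial : ℝ) ≠ 0 := by positivity
  have hq : (q.factorial : ℝ) ≠ 0 := by positivity
  have hk : (k.factorial : ℝ) ≠ 0 := by positivity
  have h4 : ∀ {d : ℝ} {x : V [⋀^Fin (p + q + k)]→ₗ[ℝ] ℝ},
      (d • x).domDomCongr (finCongr (Nat.add_assoc p q k)) =
        d • x.domDomCongr (finCongr (Nat.add_assoc p q k)) := by
    intro d x; ext v; simp
  rw [h4, h4, h4] at h2
  exact smul_right_injective _ hp (smul_right_injective _ hq (smul_right_injective _ hk h2))

/-- A linear form as an alternating map of degree one. -/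
def altOne (f : V →ₗ[ℝ] ℝ) : V [⋀^Fin 1]→ₗ[ℝ] ℝ :=
  AlternatingMap.ofSubsingleton ℝ V ℝ (0 : Fin 1) f

@[simp] lemma altOne_apply (f : V →ₗ[ℝ] ℝ) (v : Fin 1 → V) : altOne f v = f (v 0) := rfl

/-- The wedge product `f ∧ b` of a linear form with an alternating map. -/
def oneMul (f : V →ₗ[ℝ] ℝ) (b : V [⋀^Fin k]→ₗ[ℝ] ℝ) : V [⋀^Fin (k + 1)]→ₗ[ℝ] ℝ :=
  (altMul (altOne f) b).domDomCongr (finCongr (Nat.add_comm 1 k))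

lemma oneMul_apply (f : V →ₗ[ℝ] ℝ) (b : V [⋀^Fin k]→ₗ[ℝ] ℝ) (v : Fin (k + 1) → V) :
    oneMul f b v = ∑ i : Fin (k + 1), (if i = 0 then 1 else -1) *
      (f (v i) * b fun j => v (Equiv.swap 0 i j.succ)) := by
  have h1 := alternatization_tensorMul (altOne f).toMultilinearMap b.toMultilinearMap
  simp only [alternatization_coe_fin, ← altMulL_apply, map_smul,
    Nat.factorial_one, Nat.cast_one, one_smul] at h1
  have h2 : MultilinearMap.alternatization
      ((tensorMul (altOne f).toMultilinearMap b.toMultilinearMap).domDomCongr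
        (finCongr (Nat.add_comm 1 k))) v =
      (k.factorial : ℝ) * oneMul f b v := by
    rw [alternatization_domDomCongr, h1]
    rfl
  have hk : (k.factorial : ℝ) ≠ 0 := by positivity
  refine mul_left_cancel₀ hk ?_
  -- A permutation of `k + 1` places is the choice of the place `i` fed to `f` together with a
  -- permutation of the rest. Since `b` is alternating, the latter all contribute equally and
  -- account for the factor `k!`.
  rw [← h2, MultilinearMap.alternatization_apply, ← Equiv.sum_comp Equiv.Perm.decomposeFin.symm,
    Fintype.sum_prod_type, Finset.mul_sum]
  refine Finset.sum_congr rfl fun i _ => ?_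
  have h3 : ∀ σ : Equiv.Perm (Fin k), (Equiv.Perm.sign (Equiv.Perm.decomposeFin.symm (i, σ))) •
      (((tensorMul (altOne f).toMultilinearMap b.toMultilinearMap).domDomCongr
        (finCongr (Nat.add_comm 1 k))).domDomCongr (Equiv.Perm.decomposeFin.symm (i, σ))) v =
      (if i = 0 then 1 else -1) * (f (v i) * b fun j => v (Equiv.swap 0 i j.succ)) := by
    intro σ
    simp only [MultilinearMap.domDomCongr_apply, tensorMul_apply]
    have e1 : (finCongr (Nat.add_comm 1 k)) (Fin.castAdd k 0) = 0 := Fin.ext rfl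
    have e2 : ∀ j, (finCongr (Nat.add_comm 1 k)) (Fin.natAdd 1 j) = j.succ := fun j =>
      Fin.ext (by simp)
    simp only [e2, Equiv.Perm.decomposeFin_symm_apply_succ, AlternatingMap.coe_multilinearMap,
      altOne_apply, e1, Equiv.Perm.decomposeFin_symm_apply_zero]
    have e3 := b.map_perm (fun j => v (Equiv.swap 0 i j.succ)) σ
    simp only [Function.comp_def] at e3
    rw [e3, Equiv.Perm.decomposeFin.symm_sign, Units.smul_def, Units.smul_def]
    rcases Int.units_eq_one_or (Equiv.Perm.sign σ) with h | h <;> rw [h] <;> split_ifs <;> simp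
  rw [Finset.sum_congr rfl fun σ _ => h3 σ, Finset.sum_const, Finset.card_univ, Fintype.card_perm,
    Fintype.card_fin, nsmul_eq_mul]

end Wedge

/-! ### Contraction with a vector and projection along it -/

section Contraction

variable {V W : Type*} [AddCommGroup V] [Module ℝ V] [AddCommGroup W] [Module ℝ W] {k : ℕ}

lemma oneMul_compLinearMap (f : V →ₗ[ℝ] ℝ) (b : V [⋀^Fin k]→ₗ[ℝ] ℝ) (A : W →ₗ[ℝ] V) :
    (oneMul f b).compLinearMap A = oneMul (f.comp A) (b.compLinearMap A) := by
  ext v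
  simp [oneMul_apply]

lemma alternatingMap_sum_apply {ι : Type*} (S : Finset ι) (f : ι → V [⋀^Fin k]→ₗ[ℝ] ℝ)
    (v : Fin k → V) : (∑ i ∈ S, f i) v = ∑ i ∈ S, f i v :=
  map_sum (⟨⟨fun f : V [⋀^Fin k]→ₗ[ℝ] ℝ => f v, rfl⟩, fun _ _ => rfl⟩ :
    (V [⋀^Fin k]→ₗ[ℝ] ℝ) →+ ℝ) f S

lemma oneMul_sum_left {ι : Type*} (S : Finset ι) (c : ι → ℝ) (f : ι → V →ₗ[ℝ] ℝ)
    (b : V [⋀^Fin k]→ₗ[ℝ] ℝ) : oneMul (∑ i ∈ S, c i • f i) b = ∑ i ∈ S, c i • oneMul (f i) b := by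
  ext v
  simp only [oneMul_apply, LinearMap.sum_apply, LinearMap.smul_apply, alternatingMap_sum_apply,
    AlternatingMap.smul_apply, smul_eq_mul, Finset.mul_sum, Finset.sum_mul]
  rw [Finset.sum_comm]
  refine Finset.sum_congr rfl fun i _ => Finset.sum_congr rfl fun j _ => by ring

lemma oneMul_smul_right (f : V →ₗ[ℝ] ℝ) (c : ℝ) (b : V [⋀^Fin k]→ₗ[ℝ] ℝ) :
    oneMul f (c • b) = c • oneMul f b := by
  ext v
  simp only [oneMul_apply, AlternatingMap.smul_apply, smul_eq_mul, Finset.mul_sum]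
  exact Finset.sum_congr rfl fun i _ => by ring

lemma oneMul_add_right (f : V →ₗ[ℝ] ℝ) (b b' : V [⋀^Fin k]→ₗ[ℝ] ℝ) :
    oneMul f (b + b') = oneMul f b + oneMul f b' := by
  ext v
  simp only [oneMul_apply, AlternatingMap.add_apply, ← Finset.sum_add_distrib]
  exact Finset.sum_congr rfl fun i _ => by ring

lemma oneMul_sub_right (f : V →ₗ[ℝ] ℝ) (b b' : V [⋀^Fin k]→ₗ[ℝ] ℝ) :
    oneMul f (b - b') = oneMul f b - oneMul f b' := by
  rw [sub_eq_add_neg, ← neg_one_smul ℝ b', oneMul_add_right, oneMul_smul_right, neg_one_smul,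
    ← sub_eq_add_neg]

lemma oneMul_curryLeft (f : V →ₗ[ℝ] ℝ) (γ : V [⋀^Fin (k + 1)]→ₗ[ℝ] ℝ) (d : V)
    (v : Fin (k + 1) → V) :
    oneMul f (γ.curryLeft d) v = ∑ i, f (v i) * γ (Function.update v i d) := by
  rw [oneMul_apply]
  refine Finset.sum_congr rfl fun i _ => ?_
  rw [AlternatingMap.curryLeft_apply_apply]
  have h : (Matrix.vecCons d fun j => v (Equiv.swap 0 i j.succ)) =
      Function.update v i d ∘ Equiv.swap 0 i := by
    funext j
    refine Fin.cases ?_ (fun j => ?_) j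
    · simp
    · have : Equiv.swap 0 i j.succ ≠ i := fun hc => by
        have := congrArg (Equiv.swap 0 i) hc
        simp at this
      simp [Function.update_of_ne this]
  rw [h]
  by_cases hi : i = 0
  · subst hi; simp
  · rw [γ.map_swap _ (Ne.symm hi)]
    simp [hi]

/-- Only the terms linear in `d` survive, since an alternating map vanishes when `d` occupies two
places. -/
lemma map_sub_smul_eq (γ : V [⋀^Fin k]→ₗ[ℝ] ℝ) (d : V) (c : Fin k → ℝ) (S : Finset (Fin k))
    (v : Fin k → V) : γ (fun i => if i ∈ S then v i - c i • d else v i) =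
      γ v - ∑ i ∈ S, c i * γ (Function.update v i d) := by
  induction S using Finset.induction_on generalizing v with
  | empty => simp
  | insert q S hq ih =>
    have h1 : (fun i => if i ∈ insert q S then v i - c i • d else v i) =
        Function.update (fun i => if i ∈ S then v i - c i • d else v i) q (v q - c q • d) := by
      funext i
      by_cases hi : i = q
      · subst hi; simp
      · simp [hi]
    have h2 : Function.update (fun i => if i ∈ S then v i - c i • d else v i) q (v q) =
        fun i => if i ∈ S then v i - c i • d else v i := by
      funext i
      by_cases hi : i = q
      · subst hi; simp [hq]
      · simp [hi]
    have h3 : Function.update (fun i => if i ∈ S then v i - c i • d else v i) q d =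
        fun i => if i ∈ S then Function.update v q d i - c i • d else Function.update v q d i := by
      funext i
      by_cases hi : i = q
      · subst hi; simp [hq]
      · simp [hi]
    rw [h1, γ.map_update_sub, γ.map_update_smul, h2, h3, ih, ih, Finset.sum_insert hq]
    have h4 : ∑ i ∈ S, c i * γ (Function.update (Function.update v q d) i d) = 0 := by
      refine Finset.sum_eq_zero fun i hi => ?_
      have hne : i ≠ q := fun h => hq (h ▸ hi)
      rw [γ.map_eq_zero_of_eq _ (i := i) (j := q) (by simp [Function.update_of_ne hne.symm]) hne,
        mul_zero]
    rw [h4, smul_eq_mul]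
    ring

/-- The homotopy formula for the projection `v - f(v) d`. -/
lemma sub_compLinearMap_eq_oneMul (f : V →ₗ[ℝ] ℝ) (γ : V [⋀^Fin (k + 1)]→ₗ[ℝ] ℝ) (d : V) :
    γ - γ.compLinearMap (LinearMap.id - f.smulRight d) = oneMul f (γ.curryLeft d) := by
  ext v
  have h := map_sub_smul_eq γ d (fun i => f (v i)) Finset.univ v
  simp only [Finset.mem_univ, if_true] at h
  rw [oneMul_curryLeft, AlternatingMap.sub_apply, AlternatingMap.compLinearMap_apply]
  have h2 : (fun i => (LinearMap.id - f.smulRight d : V →ₗ[ℝ] V) (v i)) =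
      fun i => v i - f (v i) • d := by
    funext i; simp
  rw [h2, h]
  ring

end Contraction

/-! ### Forms in the ideal of the contact forms -/

section Contact

variable {n m s k : ℕ}

lemma wedge_apply {a b : ℕ} (α : Form n m s a) (β : Form n m s b) (e : Coords n m s) :
    wedge α β e = altMul (α e) (β e) := rfl

/-- The contact forms of order zero. -/
def omegaL (e : Coords n m s) (σ : Fin m) : Coords n m s →ₗ[ℝ] ℝ :=
  (LinearMap.proj (R := ℝ) (φ := fun _ : Fin m => ℝ) σ).comp
    ((LinearMap.proj (R := ℝ) (φ := fun _ : MultiIdx n s => Fin m → ℝ) (zeroIdx n s)).comp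
      (LinearMap.snd ℝ _ _)) -
  ∑ i : Fin n, yCoord e (unitIdx i) σ • (LinearMap.proj i).comp (LinearMap.fst ℝ _ _)

lemma omegaL_apply (e : Coords n m s) (σ : Fin m) (w : Coords n m s) :
    omegaL e σ w = w.2 (zeroIdx n s) σ - ∑ i, yCoord e (unitIdx i) σ * w.1 i := by
  simp [omegaL]

lemma omega_zero_eq (h : ∑ k : Fin n, (0 : Fin n → ℕ) k < s) (σ : Fin m) (e : Coords n m s) :
    omega 0 h σ e = altOne (omegaL e σ) := by
  ext v
  simp only [omega, dy, dx, oneForm, altOne_apply, omegaL_apply, AlternatingMap.sub_apply,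
    alternatingMap_sum_apply, AlternatingMap.smul_apply, zero_add]
  rfl

lemma omegaL_yVec (e : Coords n m s) (σ τ : Fin m) :
    omegaL e σ (yVec (zeroIdx n s) τ) = if σ = τ then 1 else 0 := by
  simp [omegaL_apply, yVec, Pi.single_apply]

/-- The projection along `∂/∂y^τ`, `τ ∈ S`, onto the common kernel of `ω^τ`, `τ ∈ S`. -/
def killL (S : Finset (Fin m)) (e : Coords n m s) : Coords n m s →ₗ[ℝ] Coords n m s :=
  LinearMap.id - ∑ τ ∈ S, (omegaL e τ).smulRight (yVec (zeroIdx n s) τ)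

lemma killL_apply (S : Finset (Fin m)) (e w : Coords n m s) :
    killL S e w = w - ∑ τ ∈ S, omegaL e τ w • yVec (zeroIdx n s) τ := by
  simp [killL, LinearMap.sum_apply]

/-- The vectors `∂/∂y^τ` are dual to the `ω^τ`, so the projection can be built one direction at a
time, as the homotopy formula requires. -/
lemma killL_insert {S : Finset (Fin m)} {τ : Fin m} (hτ : τ ∉ S) (e : Coords n m s) :
    killL (insert τ S) e =
      (killL S e).comp (LinearMap.id - (omegaL e τ).smulRight (yVec (zeroIdx n s) τ)) := by
  refine LinearMap.ext fun w => ?_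
  have h : ∀ ρ ∈ S, omegaL e ρ (w - omegaL e τ w • yVec (zeroIdx n s) τ) = omegaL e ρ w := by
    intro ρ hρ
    have : ρ ≠ τ := fun h => hτ (h ▸ hρ)
    rw [map_sub, map_smul, omegaL_yVec, if_neg this, smul_zero, sub_zero]
  simp only [LinearMap.comp_apply, LinearMap.sub_apply, LinearMap.id_apply,
    LinearMap.smulRight_apply, killL_apply]
  have h2 : ∑ ρ ∈ S, omegaL e ρ (w - omegaL e τ w • yVec (zeroIdx n s) τ) • yVec (zeroIdx n s) ρ =
      ∑ ρ ∈ S, omegaL e ρ w • yVec (zeroIdx n s) ρ :=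
    Finset.sum_congr rfl fun ρ hρ => by rw [h ρ hρ]
  rw [Finset.sum_insert hτ, h2]
  abel

lemma omegaL_killL_univ (e w : Coords n m s) (τ : Fin m) :
    omegaL e τ (killL Finset.univ e w) = 0 := by
  simp [killL_apply, map_sub, map_sum, omegaL_yVec]

lemma contDiff_yCoord (J : Fin n → ℕ) (σ : Fin m) :
    ContDiff ℝ ∞ (fun e : Coords n m s => yCoord e J σ) := by
  by_cases h : ∑ i, J i ≤ s
  · simp only [yCoord, h, dif_pos]
    fun_prop
  · simp only [yCoord, h, dif_neg, not_false_iff]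
    exact contDiff_const

lemma contDiffOn_omegaL {U : Set (Coords n m s)} {w : Coords n m s → Coords n m s}
    (hw : ContDiffOn ℝ ∞ w U) (σ : Fin m) : ContDiffOn ℝ ∞ (fun e => omegaL e σ (w e)) U := by
  simp only [omegaL_apply]
  refine ContDiffOn.sub ?_ (ContDiffOn.sum fun i _ => (contDiff_yCoord _ _).contDiffOn.mul ?_)
  · have : ContDiff ℝ ∞ (fun e : Coords n m s => e.2 (zeroIdx n s) σ) := by fun_prop
    exact this.comp_contDiffOn hw
  · have : ContDiff ℝ ∞ (fun e : Coords n m s => e.1 i) := by fun_prop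
    exact this.comp_contDiffOn hw

lemma contDiffOn_killL {U : Set (Coords n m s)} {w : Coords n m s → Coords n m s}
    (hw : ContDiffOn ℝ ∞ w U) (S : Finset (Fin m)) :
    ContDiffOn ℝ ∞ (fun e => killL S e (w e)) U := by
  simp only [killL_apply]
  exact hw.sub (ContDiffOn.sum fun τ _ => (contDiffOn_omegaL hw τ).smul contDiffOn_const)

end Contact

/-! ### Forms vanishing on the contact kernel -/

section Contact

variable {V : Type*} [AddCommGroup V] [Module ℝ V] {m s k : ℕ}

lemma altMul_domDomCongr_right {p q q' : ℕ} (h : q = q') (a : V [⋀^Fin p]→ₗ[ℝ] ℝ)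
    (b : V [⋀^Fin q]→ₗ[ℝ] ℝ) : altMul a (b.domDomCongr (finCongr h)) =
      (altMul a b).domDomCongr (finCongr (congrArg (p + ·) h)) := by
  subst h
  rfl

lemma oneMul_oneMul (f g : V →ₗ[ℝ] ℝ) (b : V [⋀^Fin k]→ₗ[ℝ] ℝ) (h : 1 + 1 + k = k + 1 + 1) :
    oneMul f (oneMul g b) =
      (altMul (altMul (altOne f) (altOne g)) b).domDomCongr (finCongr h) := by
  rw [oneMul, oneMul, altMul_domDomCongr_right, ← altMul_assoc]
  rfl

lemma oneMul_oneMul_mem_contactOn (hs : 1 ≤ s) {U : Set (Coords (k + 1) m s)}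
    {Φ : Form (k + 1) m s k} (hΦ : SmoothForm Φ U) (σ τ : Fin m) :
    (fun e => oneMul (omegaL e σ) (oneMul (omegaL e τ) (Φ e)) : Form (k + 1) m s (k + 1 + 1)) ∈
      contactOn U := by
  have h0 : ∑ k_1 : Fin (k + 1), (0 : Fin (k + 1) → ℕ) k_1 < s := by simp; omega
  have h1 : 1 + 1 + k = k + 1 + 1 := by omega
  refine ⟨_, Submodule.subset_span ⟨1, 1, k, h1, omega 0 h0 σ, omega 0 h0 τ, Φ,
    .omega 0 h0 σ, .omega 0 h0 τ, hΦ, rfl⟩, fun e _ => ?_⟩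
  change _ = (altMul (altMul (omega 0 h0 σ e) (omega 0 h0 τ e)) (Φ e)).domDomCongr (finCongr h1)
  rw [omega_zero_eq, omega_zero_eq, ← oneMul_oneMul]

/-- `f ω^σ ∧ (γ - γ ∘ π)` is strongly contact, `π` being a projection along contact directions. -/
lemma oneMul_sub_killL_mem_contactOn (hs : 1 ≤ s) {U : Set (Coords (k + 1) m s)}
    {γ : Form (k + 1) m s (k + 1)} {f : Coords (k + 1) m s → ℝ} (hf : ContDiffOn ℝ ∞ f U)
    (hγ : ∀ w : Fin (k + 1) → Coords (k + 1) m s → Coords (k + 1) m s,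
      (∀ i, ContDiffOn ℝ ∞ (w i) U) → ContDiffOn ℝ ∞ (fun e => γ e fun i => w i e) U)
    (σ : Fin m) (S : Finset (Fin m)) :
    (fun e => f e • oneMul (omegaL e σ) (γ e - (γ e).compLinearMap (killL S e)) :
      Form (k + 1) m s (k + 1 + 1)) ∈ contactOn U := by
  induction S using Finset.induction_on with
  | empty =>
    have : (fun e => f e • oneMul (omegaL e σ) (γ e - (γ e).compLinearMap (killL ∅ e)) :
        Form (k + 1) m s (k + 1 + 1)) = 0 := by
      funext e
      have h1 : killL ∅ e = LinearMap.id := by simp [killL]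
      have h2 : γ e - (γ e).compLinearMap (killL ∅ e) = (0 : ℝ) • γ e := by
        ext v
        simp [h1]
      rw [h2, oneMul_smul_right]
      simp
    rw [this]
    exact Submodule.zero_mem _
  | insert τ S hτ ih =>
    -- The contraction with `∂/∂y^τ` supplied by the homotopy formula; it is the smooth cofactor of
    -- `ω^σ ∧ ω^τ`.
    let Φ : Form (k + 1) m s k := fun e =>
      f e • ((γ e).compLinearMap (killL S e)).curryLeft (yVec (zeroIdx (k + 1) s) τ)
    have hΦ : SmoothForm Φ U := fun v => by
      refine hf.mul ?_
      exact hγ (fun i e => killL S e ((Matrix.vecCons _ v : Fin (k + 1) → Coords (k + 1) m s) i))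
        fun i => contDiffOn_killL contDiffOn_const S
    have h := Submodule.add_mem _ ih (oneMul_oneMul_mem_contactOn hs hΦ σ τ)
    refine (congrArg (· ∈ contactOn U) (funext fun e => ?_)).mp h
    have h2 := sub_compLinearMap_eq_oneMul (omegaL e τ) ((γ e).compLinearMap (killL S e))
      (yVec (zeroIdx (k + 1) s) τ)
    change f e • oneMul (omegaL e σ) (γ e - (γ e).compLinearMap (killL S e)) +
      oneMul (omegaL e σ) (oneMul (omegaL e τ) (f e • _)) = _
    rw [oneMul_smul_right, oneMul_smul_right, ← smul_add, ← oneMul_add_right, ← h2,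
      killL_insert hτ]
    congr 2
    rw [sub_add_sub_cancel]
    rfl

/-- Projecting onto the common kernel of all `ω^τ` annihilates `γ`, so the preceding difference is
`γ` itself. Smoothness of `γ` is required on variable vector fields because the projection varies
with the point. -/
lemma oneMul_mem_contactOn (hs : 1 ≤ s) {U : Set (Coords (k + 1) m s)}
    {γ : Form (k + 1) m s (k + 1)} {f : Coords (k + 1) m s → ℝ} (hf : ContDiffOn ℝ ∞ f U)
    (hγ : ∀ w : Fin (k + 1) → Coords (k + 1) m s → Coords (k + 1) m s,
      (∀ i, ContDiffOn ℝ ∞ (w i) U) → ContDiffOn ℝ ∞ (fun e => γ e fun i => w i e) U)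
    (hγ0 : ∀ e ∈ U, ∀ v : Fin (k + 1) → Coords (k + 1) m s,
      (∀ i τ, omegaL e τ (v i) = 0) → γ e v = 0) (σ : Fin m) :
    (fun e => f e • oneMul (omegaL e σ) (γ e) : Form (k + 1) m s (k + 1 + 1)) ∈ contactOn U := by
  obtain ⟨β, hβ, h⟩ := oneMul_sub_killL_mem_contactOn hs hf hγ σ Finset.univ
  refine ⟨β, hβ, fun e he => ?_⟩
  rw [← h he]
  have : (γ e).compLinearMap (killL Finset.univ e) = 0 := by
    ext v
    exact hγ0 e he _ fun i τ => omegaL_killL_univ e _ τ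
  simp only [this, sub_zero]

end Contact

/-! ### A Riemannian metric in charts -/

variable {n m : ℕ} {X : Type*} [TopologicalSpace X] [ChartedSpace (Fin (n + m) → ℝ) X]

/-- The Jacobian matrix of a change of coordinates on `X`. -/
def changeMatrix (ψ ψ' : Chart n m X) (u : Fin (n + m) → ℝ) :
    Matrix (Fin (n + m)) (Fin (n + m)) ℝ :=
  LinearMap.toMatrix' (fderiv ℝ (chartChange ψ ψ') u : (Fin (n + m) → ℝ) →ₗ[ℝ] (Fin (n + m) → ℝ))

lemma changeMatrix_mulVec (ψ ψ' : Chart n m X) (u w : Fin (n + m) → ℝ) :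
    (changeMatrix ψ ψ' u).mulVec w = fderiv ℝ (chartChange ψ ψ') u w := by
  rw [changeMatrix, LinearMap.toMatrix'_mulVec]
  rfl

lemma differentiableAt_chartChange {ψ ψ' : Chart n m X} {u : Fin (n + m) → ℝ}
    (hu : u ∈ chartOverlap ψ ψ') : DifferentiableAt ℝ (chartChange ψ ψ') u :=
  differentiableAt_of_contDiffOn (isOpen_chartOverlap ψ ψ') (contDiffOn_chartChange ψ ψ') hu

lemma contDiffOn_changeMatrix (ψ ψ' : Chart n m X) (a b : Fin (n + m)) :
    ContDiffOn ℝ ∞ (fun u => changeMatrix ψ ψ' u a b) (chartOverlap ψ ψ') := by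
  refine (contDiffOn_dirDeriv (isOpen_chartOverlap ψ ψ') (contDiffOn_chartChange_apply ψ ψ' a)
    (Pi.single b 1)).congr fun u hu => ?_
  rw [dirDeriv, (hasFDerivAt_pi'.mp (differentiableAt_chartChange hu).hasFDerivAt a).fderiv,
    changeMatrix, LinearMap.toMatrix'_apply]
  rfl

lemma changeMatrix_comp {ψ ψ' ψ'' : Chart n m X} {u : Fin (n + m) → ℝ}
    (h : u ∈ chartOverlap ψ ψ') (h' : u ∈ chartOverlap ψ ψ'') :
    changeMatrix ψ ψ'' u = changeMatrix ψ' ψ'' (chartChange ψ ψ' u) * changeMatrix ψ ψ' u := by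
  have hm : chartChange ψ ψ' u ∈ chartOverlap ψ' ψ'' := by
    refine ⟨ψ'.1.map_source h.2, ?_⟩
    change ψ'.1.symm (ψ'.1 (ψ.1.symm u)) ∈ ψ''.1.source
    rw [ψ'.1.left_inv h.2]
    exact h'.2
  have h1 : chartChange ψ ψ'' =ᶠ[𝓝 u] chartChange ψ' ψ'' ∘ chartChange ψ ψ' := by
    filter_upwards [(isOpen_chartOverlap ψ ψ').mem_nhds h] with v hv
    change _ = ψ''.1 (ψ'.1.symm (ψ'.1 (ψ.1.symm v)))
    rw [ψ'.1.left_inv hv.2]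
    rfl
  rw [changeMatrix, h1.fderiv_eq, fderiv_comp u (differentiableAt_chartChange hm)
    (differentiableAt_chartChange h)]
  exact LinearMap.toMatrix'_comp _ _

lemma changeMatrix_self {ψ : Chart n m X} {u : Fin (n + m) → ℝ} (h : u ∈ ψ.1.target) :
    changeMatrix ψ ψ u = 1 := by
  have h1 : chartChange ψ ψ =ᶠ[𝓝 u] id := by
    filter_upwards [ψ.1.open_target.mem_nhds h] with v hv
    exact ψ.1.right_inv hv
  rw [changeMatrix, h1.fderiv_eq, fderiv_id]
  exact LinearMap.toMatrix'_id

lemma changeMatrix_mulVec_injective {ψ ψ' : Chart n m X} {u : Fin (n + m) → ℝ}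
    (h : u ∈ chartOverlap ψ ψ') : Function.Injective (changeMatrix ψ ψ' u).mulVec := by
  have h1 := changeMatrix_comp (ψ'' := ψ) h ⟨h.1, ψ.1.map_target h.1⟩
  rw [changeMatrix_self h.1] at h1
  refine Function.LeftInverse.injective (g := (changeMatrix ψ' ψ (chartChange ψ ψ' u)).mulVec)
    fun w => ?_
  rw [Matrix.mulVec_mulVec, ← h1, Matrix.one_mulVec]

/-- Pulled-back Euclidean metrics are averaged by a partition of unity subordinate to the atlas.
Positivity survives the averaging, and compatibility is the chain rule for the Jacobian matrices. -/
lemma exists_metric [T2Space X] [SecondCountableTopology X]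
    [IsManifold 𝓘(ℝ, Fin (n + m) → ℝ) ∞ X] :
    ∃ G : Chart n m X → (Fin (n + m) → ℝ) → Matrix (Fin (n + m)) (Fin (n + m)) ℝ,
      (∀ ψ a b, ContDiffOn ℝ ∞ (fun u => G ψ u a b) ψ.1.target) ∧
      (∀ ψ, ∀ u ∈ ψ.1.target, ∀ w, w ≠ 0 → 0 < w ⬝ᵥ (G ψ u).mulVec w) ∧
      ∀ ψ ψ', ∀ u ∈ chartOverlap ψ ψ', G ψ u =
        (changeMatrix ψ ψ' u).transpose * G ψ' (chartChange ψ ψ' u) * changeMatrix ψ ψ' u := by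
  have : LocallyCompactSpace X := ChartedSpace.locallyCompactSpace (Fin (n + m) → ℝ) X
  obtain ⟨ρ, hρ⟩ := SmoothPartitionOfUnity.exists_isSubordinate_chartAt_source
    𝓘(ℝ, Fin (n + m) → ℝ) X
  let c : X → Chart n m X := fun k => ⟨chartAt _ k, IsManifold.chart_mem_maximalAtlas k⟩
  have hsupp : ∀ x, ∀ k ∈ ρ.finsupport x, x ∈ (c k).1.source := fun x k hk =>
    hρ k (subset_tsupport _ (by simpa using hk))
  let g : Chart n m X → X → (Fin (n + m) → ℝ) → Matrix (Fin (n + m)) (Fin (n + m)) ℝ :=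
    fun ψ k u => (changeMatrix ψ (c k) u).transpose * changeMatrix ψ (c k) u
  refine ⟨fun ψ u => ∑ k ∈ ρ.finsupport (ψ.1.symm u), ρ k (ψ.1.symm u) • g ψ k u, ?_, ?_, ?_⟩
  · intro ψ a b u₀ hu₀
    have h1 : ContMDiffAt 𝓘(ℝ, Fin (n + m) → ℝ) 𝓘(ℝ, ℝ) ∞
        (fun x => ∑ᶠ k, ρ k x • g ψ k (ψ.1 x) a b) (ψ.1.symm u₀) := by
      refine ρ.contMDiffAt_finsum fun k hk => ?_
      have hx : ψ.1.symm u₀ ∈ ψ.1.source := ψ.1.map_target hu₀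
      have ho : ψ.1 (ψ.1.symm u₀) ∈ chartOverlap ψ (c k) := by
        rw [ψ.1.right_inv hu₀]
        exact ⟨hu₀, hρ k hk⟩
      have h2 : ContDiffOn ℝ ∞ (fun u => g ψ k u a b) (chartOverlap ψ (c k)) := by
        simp only [g, Matrix.mul_apply, Matrix.transpose_apply]
        exact ContDiffOn.sum fun d _ =>
          (contDiffOn_changeMatrix ψ (c k) d a).mul (contDiffOn_changeMatrix ψ (c k) d b)
      exact (h2.contDiffAt ((isOpen_chartOverlap ψ (c k)).mem_nhds ho)).contMDiffAt.comp _
        (contMDiffAt_chart ψ hx)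
    have h2 := (h1.comp u₀ (contMDiffAt_chart_symm ψ hu₀)).contDiffAt
    refine (h2.congr_of_eventuallyEq ?_).contDiffWithinAt
    filter_upwards [ψ.1.open_target.mem_nhds hu₀] with u hu
    rw [Function.comp_apply, ← ρ.sum_finsupport_smul_eq_finsum (ψ.1.symm u)
      (fun k x => g ψ k (ψ.1 x) a b), Matrix.sum_apply]
    simp only [ψ.1.right_inv hu, Matrix.smul_apply]
  · intro ψ u hu w hw
    have e1 : ∀ k, w ⬝ᵥ (g ψ k u).mulVec w =
        (changeMatrix ψ (c k) u).mulVec w ⬝ᵥ (changeMatrix ψ (c k) u).mulVec w := fun k => by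
      rw [← Matrix.mulVec_mulVec, Matrix.mulVec_transpose, dotProduct_comm,
        Matrix.dotProduct_mulVec]
    rw [Matrix.sum_mulVec, dotProduct_sum]
    simp only [Matrix.smul_mulVec, dotProduct_smul, e1, smul_eq_mul]
    have hne : (ρ.finsupport (ψ.1.symm u)).Nonempty := by
      by_contra hc
      have := ρ.sum_finsupport (ψ.1.symm u) (Set.mem_univ _)
      rw [Finset.not_nonempty_iff_eq_empty.mp hc] at this
      simp at this
    refine Finset.sum_pos (fun k hk => mul_pos ?_ ?_) hne
    · exact lt_of_le_of_ne (ρ.nonneg k _) (Ne.symm (by simpa using hk))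
    · have h0 : (changeMatrix ψ (c k) u).mulVec w ≠ 0 := fun h0 => hw
        (changeMatrix_mulVec_injective ⟨hu, hsupp _ k hk⟩ (h0.trans (Matrix.mulVec_zero _).symm))
      exact lt_of_le_of_ne (Finset.sum_nonneg fun i _ => mul_self_nonneg _)
        (Ne.symm (mt dotProduct_self_eq_zero.mp h0))
  · intro ψ ψ' u hu
    have h1 : ψ'.1.symm (chartChange ψ ψ' u) = ψ.1.symm u := ψ'.1.left_inv hu.2
    simp only [h1]
    rw [Finset.mul_sum, Finset.sum_mul]
    refine Finset.sum_congr rfl fun k hk => ?_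
    simp only [g]
    rw [changeMatrix_comp hu ⟨hu.1, hsupp _ k hk⟩, Matrix.transpose_mul, Matrix.mul_smul,
      Matrix.smul_mul]
    simp only [Matrix.mul_assoc]

/-! ### Retractions onto the tangent spaces -/

section Retraction

variable {ι κ : Type*} [Fintype ι] [Fintype κ] [DecidableEq κ]

/-- The orthogonal projection onto the image of `Γ`, with respect to `G`, in the coordinates
provided by `Γ`. -/
def retraction (G : Matrix ι ι ℝ) (Γ : Matrix ι κ ℝ) : Matrix κ ι ℝ :=
  (Γ.transpose * G * Γ)⁻¹ * (Γ.transpose * G)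

lemma det_gram_ne_zero {G : Matrix ι ι ℝ} {Γ : Matrix ι κ ℝ}
    (hG : ∀ w, w ≠ 0 → 0 < w ⬝ᵥ G.mulVec w) (hΓ : Function.Injective Γ.mulVec) :
    (Γ.transpose * G * Γ).det ≠ 0 := by
  intro h
  obtain ⟨t, ht, h0⟩ := Matrix.exists_mulVec_eq_zero_iff.mpr h
  have h1 : Γ.mulVec t ≠ 0 := fun hc => ht (hΓ (hc.trans (Matrix.mulVec_zero _).symm))
  have h2 := hG _ h1
  have h3 : Γ.mulVec t ⬝ᵥ G.mulVec (Γ.mulVec t) = t ⬝ᵥ (Γ.transpose * G * Γ).mulVec t := by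
    rw [← Matrix.mulVec_mulVec, ← Matrix.mulVec_mulVec, Matrix.dotProduct_mulVec t,
      Matrix.vecMul_transpose]
  rw [h3, h0, dotProduct_zero] at h2
  exact lt_irrefl _ h2

lemma retraction_mul {G : Matrix ι ι ℝ} {Γ : Matrix ι κ ℝ}
    (h : (Γ.transpose * G * Γ).det ≠ 0) : retraction G Γ * Γ = 1 := by
  rw [retraction, Matrix.mul_assoc, Matrix.nonsing_inv_mul _ (isUnit_iff_ne_zero.mpr h)]

/-- An isometry `K` carrying one subspace to the other intertwines the orthogonal projections; `M`
is the induced change of basis. The factors of its transpose cancel. -/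
lemma retraction_change {G G' K : Matrix ι ι ℝ} {Γ Γ' : Matrix ι κ ℝ} {M : Matrix κ κ ℝ}
    (hM : M.det ≠ 0) (hG : G = K.transpose * G' * K) (hΓ : K * Γ = Γ' * M) :
    retraction G' Γ' * K = M * retraction G Γ := by
  have h1 : Γ.transpose * G = M.transpose * (Γ'.transpose * G' * K) := by
    have : Γ.transpose * K.transpose = M.transpose * Γ'.transpose := by
      rw [← Matrix.transpose_mul, ← Matrix.transpose_mul, hΓ]
    rw [hG, ← Matrix.mul_assoc, ← Matrix.mul_assoc, this]
    simp only [Matrix.mul_assoc]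
  have h2 : Γ.transpose * G * Γ = M.transpose * (Γ'.transpose * G' * Γ' * M) := by
    rw [h1, Matrix.mul_assoc, Matrix.mul_assoc _ K, hΓ]
    simp only [Matrix.mul_assoc]
  have hu : IsUnit M.det := isUnit_iff_ne_zero.mpr hM
  have hu' : IsUnit M.transpose.det := by rwa [Matrix.det_transpose]
  rw [retraction, retraction, h2, h1, Matrix.mul_inv_rev, Matrix.mul_inv_rev]
  simp only [Matrix.mul_assoc]
  rw [Matrix.mul_nonsing_inv_cancel_left _ _ hu, Matrix.nonsing_inv_mul_cancel_left _ _ hu']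

end Retraction

/-! ### The retraction onto a contact element and its volume form -/

section Chart

variable {n m s : ℕ} {X : Type*} [TopologicalSpace X] [ChartedSpace (Fin (n + m) → ℝ) X]

/-- The matrix of the tangent map of a contact element. -/
def tangentMat (e : Coords n m s) : Matrix (Fin (n + m)) (Fin n) ℝ :=
  LinearMap.toMatrix' (tangentL e)

lemma tangentMat_mulVec (e : Coords n m s) (t : Fin n → ℝ) :
    (tangentMat e).mulVec t = tangentL e t := LinearMap.toMatrix'_mulVec _ _

lemma tangentMat_mulVec_injective (e : Coords n m s) :
    Function.Injective (tangentMat e).mulVec := fun t t' h => by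
  rw [tangentMat_mulVec, tangentMat_mulVec] at h
  funext i
  simpa using congrFun h (Fin.castAdd m i)

lemma contDiff_tangentMat (a : Fin (n + m)) (b : Fin n) :
    ContDiff ℝ ∞ (fun e : Coords n m s => tangentMat e a b) := by
  simp only [tangentMat, LinearMap.toMatrix'_apply]
  refine Fin.addCases (fun i => ?_) (fun σ => ?_) a
  · simp only [tangentL_castAdd]
    exact contDiff_const
  · simp only [tangentL_natAdd]
    exact ContDiff.sum fun i _ => contDiff_const.mul (contDiff_yCoord _ _)

variable {ψ ψ' : Chart n m X}

lemma changeMatrix_mul_tangentMat (hs : 1 ≤ s) {e : Coords n m s} (he : e ∈ adaptedOverlap s ψ ψ') :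
    changeMatrix ψ ψ' (basePt e) * tangentMat e =
      tangentMat (transition s ψ ψ' e) * tangentMatrix ψ ψ' e := by
  refine Matrix.ext_of_mulVec_single fun j => ?_
  rw [← Matrix.mulVec_mulVec, ← Matrix.mulVec_mulVec, tangentMat_mulVec, tangentMat_mulVec,
    changeMatrix_mulVec, fderiv_chartChange_tangentL hs he]
  congr 1
  funext i
  rw [Matrix.mulVec_single_one]
  rfl

lemma det_tangentMatrix_ne_zero (hs : 1 ≤ s) {e : Coords n m s}
    (he : e ∈ adaptedOverlap s ψ ψ') : (tangentMatrix ψ ψ' e).det ≠ 0 := by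
  rw [← frameJac_polyCurve_zero hs he]
  exact (zero_mem_famDom_polyCurve he).2

lemma basePt_eq_tangentL_add (e w : Coords n m s) :
    basePt w = tangentL e w.1 +
      ∑ σ, omegaL e σ w • (Fin.append 0 (Pi.single σ 1) : Fin (n + m) → ℝ) := by
  funext A
  simp only [Pi.add_apply, Finset.sum_apply, Pi.smul_apply, smul_eq_mul]
  refine Fin.addCases (fun i => ?_) (fun τ => ?_) A
  · simp [basePt]
  · simp [basePt, Pi.single_apply, omegaL_apply, mul_comm]

lemma omegaL_eq_basePt (e w : Coords n m s) (ν : Fin m) :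
    omegaL e ν w = basePt w (Fin.natAdd n ν) -
      ∑ i, yCoord e (unitIdx i) ν * basePt w (Fin.castAdd m i) := by
  simp [omegaL_apply, basePt]

/-- The transformation law of the contact forms of order zero. -/
lemma omegaL_comp_fderiv_transition (hs : 1 ≤ s) {e : Coords n m s}
    (he : e ∈ adaptedOverlap s ψ ψ') (ν : Fin m) :
    (omegaL (transition s ψ ψ' e) ν).comp
        (fderiv ℝ (transition s ψ ψ') e : Coords n m s →ₗ[ℝ] Coords n m s) =
      ∑ σ, pMatrix s ψ ψ' ν σ e • omegaL e σ := by
  refine LinearMap.ext fun w => ?_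
  have h1 : ∀ t, fderiv ℝ (chartChange ψ ψ') (basePt e) (tangentL e t) (Fin.natAdd n ν) -
      ∑ i, yCoord (transition s ψ ψ' e) (unitIdx i) ν *
        fderiv ℝ (chartChange ψ ψ') (basePt e) (tangentL e t) (Fin.castAdd m i) = 0 := fun t => by
    rw [congrFun (fderiv_chartChange_tangentL hs he t) (Fin.natAdd n ν), tangentL_natAdd]
    simp [mul_comm]
  have h2 := fderiv_transition_fst hs he w
  rw [LinearMap.comp_apply, omegaL_eq_basePt]
  change basePt (fderiv ℝ (transition s ψ ψ') e w) _ - ∑ i, _ *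
    basePt (fderiv ℝ (transition s ψ ψ') e w) _ = _
  simp only [h2, basePt_eq_tangentL_add e w, map_add, map_sum, map_smul, Pi.add_apply,
    Finset.sum_apply, Pi.smul_apply, smul_eq_mul, LinearMap.sum_apply, LinearMap.smul_apply,
    pMatrix_eq hs he, mul_add, Finset.sum_add_distrib]
  rw [add_sub_add_comm, h1, zero_add, Finset.sum_congr rfl fun i _ => Finset.mul_sum _ _ _,
    Finset.sum_comm, ← Finset.sum_sub_distrib]
  refine Finset.sum_congr rfl fun σ _ => ?_
  rw [sub_mul, Finset.sum_mul, mul_comm]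
  congr 1
  exact Finset.sum_congr rfl fun i _ => by ring

/-- The retraction of the coordinate space onto `ℝⁿ` induced by a metric on the base. -/
def retractL (G : (Fin (n + m) → ℝ) → Matrix (Fin (n + m)) (Fin (n + m)) ℝ) (e : Coords n m s) :
    Coords n m s →ₗ[ℝ] (Fin n → ℝ) :=
  (Matrix.mulVecLin (retraction (G (basePt e)) (tangentMat e))).comp
    (basePtL n m s : Coords n m s →ₗ[ℝ] (Fin (n + m) → ℝ))

/-- The volume form of the retraction. -/
def retractVol (G : (Fin (n + m) → ℝ) → Matrix (Fin (n + m)) (Fin (n + m)) ℝ) : Form n m s n :=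
  fun e => (Matrix.detRowAlternating : (Fin n → ℝ) [⋀^Fin n]→ₗ[ℝ] ℝ).compLinearMap (retractL G e)

variable {G : (Fin (n + m) → ℝ) → Matrix (Fin (n + m)) (Fin (n + m)) ℝ}
  {Ω : Set (Fin (n + m) → ℝ)}

lemma retractL_apply (e w : Coords n m s) :
    retractL G e w = (retraction (G (basePt e)) (tangentMat e)).mulVec (basePt w) := rfl

/-- The base part of a vector killed by the contact forms is already tangent to the contact element,
so the orthogonal projection leaves it alone. On such vectors the metric volume form agrees with
`θ₀`. -/
lemma retractL_of_omegaL_eq_zero {e w : Coords n m s}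
    (hG : ∀ w, w ≠ 0 → 0 < w ⬝ᵥ (G (basePt e)).mulVec w) (hw : ∀ τ, omegaL e τ w = 0) :
    retractL G e w = w.1 := by
  rw [retractL_apply, basePt_eq_tangentL_add e w]
  simp only [hw, zero_smul, Finset.sum_const_zero, add_zero]
  rw [← tangentMat_mulVec, Matrix.mulVec_mulVec,
    retraction_mul (det_gram_ne_zero hG (tangentMat_mulVec_injective e)), Matrix.one_mulVec]

lemma contDiffOn_retractL (hGs : ∀ a b, ContDiffOn ℝ ∞ (fun u => G u a b) Ω)
    (hG : ∀ u ∈ Ω, ∀ w, w ≠ 0 → 0 < w ⬝ᵥ (G u).mulVec w) {w : Coords n m s → Coords n m s}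
    (hw : ContDiffOn ℝ ∞ w (overSet n m s Ω)) (j : Fin n) :
    ContDiffOn ℝ ∞ (fun e => retractL G e (w e) j) (overSet n m s Ω) := by
  have g : ∀ a b, ContDiffOn ℝ ∞ (fun e : Coords n m s => G (basePt e) a b) (overSet n m s Ω) :=
    fun a b => (hGs a b).comp (basePtL n m s).contDiff.contDiffOn fun e he => he
  have t : ∀ a b, ContDiffOn ℝ ∞ (fun e : Coords n m s => tangentMat e a b) (overSet n m s Ω) :=
    fun a b => (contDiff_tangentMat a b).contDiffOn
  have tg : ∀ a b, ContDiffOn ℝ ∞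
      (fun e : Coords n m s => ((tangentMat e).transpose * G (basePt e)) a b)
      (overSet n m s Ω) := fun a b => by
    simp only [Matrix.mul_apply, Matrix.transpose_apply]
    exact ContDiffOn.sum fun c _ => (t c a).mul (g c b)
  have tgt : ∀ a b, ContDiffOn ℝ ∞ (fun e : Coords n m s =>
      ((tangentMat e).transpose * G (basePt e) * tangentMat e) a b) (overSet n m s Ω) :=
    fun a b => ContDiffOn.congr (ContDiffOn.sum fun c _ => (tg a c).mul (t c b))
      fun e _ => Matrix.mul_apply
  have inv := contDiffOn_inv_apply tgt fun e he =>
    det_gram_ne_zero (hG _ he) (tangentMat_mulVec_injective e)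
  simp only [retractL_apply, Matrix.mulVec, dotProduct, retraction]
  refine ContDiffOn.sum fun A _ => ContDiffOn.mul ?_ ?_
  · exact ContDiffOn.congr (ContDiffOn.sum fun c _ => (inv j c).mul (tg c A))
      fun e _ => Matrix.mul_apply
  · exact ((contDiff_apply ℝ ℝ A).comp (basePtL n m s).contDiff).comp_contDiffOn hw

lemma contDiffOn_retractVol (hGs : ∀ a b, ContDiffOn ℝ ∞ (fun u => G u a b) Ω)
    (hG : ∀ u ∈ Ω, ∀ w, w ≠ 0 → 0 < w ⬝ᵥ (G u).mulVec w)
    {w : Fin n → Coords n m s → Coords n m s}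
    (hw : ∀ i, ContDiffOn ℝ ∞ (w i) (overSet n m s Ω)) :
    ContDiffOn ℝ ∞ (fun e => retractVol G e fun i => w i e) (overSet n m s Ω) :=
  contDiffOn_det (M := fun e => Matrix.of fun i => retractL G e (w i e)) fun i j =>
    contDiffOn_retractL hGs hG (hw i) j

lemma contDiffOn_theta {U : Set (Coords n m s)} {w : Fin n → Coords n m s → Coords n m s}
    (hw : ∀ i, ContDiffOn ℝ ∞ (w i) U) :
    ContDiffOn ℝ ∞ (fun e => theta n m s e fun i => w i e) U :=
  contDiffOn_det (M := fun e => Matrix.of fun i => (w i e).1) fun i j =>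
    ((contDiff_apply ℝ ℝ j).comp contDiff_fst).comp_contDiffOn (hw i)

/-- The retractions in the two charts differ by `tangentMatrix`, whose determinant is `𝒥`. The
equality is exact, whereas for `θ₀` it would hold only modulo contact forms. -/
lemma retractVol_comp_fderiv_transition (hs : 1 ≤ s) {e : Coords n m s}
    (he : e ∈ adaptedOverlap s ψ ψ')
    {G' : (Fin (n + m) → ℝ) → Matrix (Fin (n + m)) (Fin (n + m)) ℝ}
    (hG : G (basePt e) = (changeMatrix ψ ψ' (basePt e)).transpose *
      G' (chartChange ψ ψ' (basePt e)) * changeMatrix ψ ψ' (basePt e)) :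
    (retractVol G' (transition s ψ ψ' e)).compLinearMap
        (fderiv ℝ (transition s ψ ψ') e : Coords n m s →ₗ[ℝ] Coords n m s) =
      jacobianDet s ψ ψ' e • retractVol G e := by
  have h1 : ∀ w, retractL G' (transition s ψ ψ' e) (fderiv ℝ (transition s ψ ψ') e w) =
      (tangentMatrix ψ ψ' e).mulVec (retractL G e w) := fun w => by
    rw [retractL_apply, retractL_apply, fderiv_transition_fst hs he, ← changeMatrix_mulVec,
      Matrix.mulVec_mulVec, Matrix.mulVec_mulVec, basePt_transition hs he,
      retraction_change (det_tangentMatrix_ne_zero hs he) hG (changeMatrix_mul_tangentMat hs he)]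
  ext v
  have h2 : (Matrix.of fun i => retractL G' (transition s ψ ψ' e)
      (fderiv ℝ (transition s ψ ψ') e (v i))) =
      (Matrix.of fun i => retractL G e (v i)) * (tangentMatrix ψ ψ' e).transpose := by
    ext i j
    rw [Matrix.of_apply, h1, Matrix.mul_apply, Matrix.mulVec, dotProduct]
    exact Finset.sum_congr rfl fun k _ =>
      mul_comm (tangentMatrix ψ ψ' e j k) (retractL G e (v i) k)
  change (Matrix.of fun i => retractL G' (transition s ψ ψ' e)
      (fderiv ℝ (transition s ψ ψ') e (v i))).det =
    jacobianDet s ψ ψ' e * (Matrix.of fun i => retractL G e (v i)).det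
  rw [h2, Matrix.det_mul, Matrix.det_transpose, jacobianDet_eq hs he, mul_comm]

end Chart

/-! ### The Euler–Lagrange class -/

variable {n m r s : ℕ} {X : Type*} [TopologicalSpace X] [ChartedSpace (Fin (n + m) → ℝ) X]

open Classical in
/-- The global form obtained from the Euler–Lagrange expressions and a metric. -/
def eulerForm (s : ℕ) (L : Chart n m X → Coords n m r → ℝ)
    (G : Chart n m X → (Fin (n + m) → ℝ) → Matrix (Fin (n + m)) (Fin (n + m)) ℝ) :
    Chart n m X → Form n m s (n + 1) := fun ψ e =>
  if e ∈ chartTarget s ψ then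
    ∑ σ, eulerLagrange s (L ψ) σ e • oneMul (omegaL e σ) (retractVol (G ψ) e)
  else 0

lemma eulerLagrangeForm_apply (hs : 0 < s) (L : Coords n m r → ℝ) (e : Coords n m s) :
    eulerLagrangeForm s hs L e =
      ∑ σ, eulerLagrange s L σ e • oneMul (omegaL e σ) (theta n m s e) := by
  refine Finset.sum_congr rfl fun σ _ => ?_
  congr 1
  rw [castForm, wedge_apply, omega_zero_eq]
  rfl

variable {𝓛 : ImmVel n m X r → ℝ} {L : Chart n m X → Coords n m r → ℝ}
  {G : Chart n m X → (Fin (n + m) → ℝ) → Matrix (Fin (n + m)) (Fin (n + m)) ℝ}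

/-- Pulling back `ω^ν ∧ θ_G` produces the factor `𝒥 P^ν_σ`, which is precisely the one in the
transformation law of the Euler–Lagrange expressions. -/
lemma eulerForm_mem_grassForms (hr : 1 ≤ r) (hs : 2 * r ≤ s) (h𝓛 : IsHomogeneousLagrangian 𝓛)
    (hL : ∀ ψ, IsLocalLagrangian 𝓛 ψ (L ψ))
    (hGs : ∀ ψ a b, ContDiffOn ℝ ∞ (fun u => G ψ u a b) ψ.1.target)
    (hG : ∀ ψ, ∀ u ∈ ψ.1.target, ∀ w, w ≠ 0 → 0 < w ⬝ᵥ (G ψ u).mulVec w)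
    (hGc : ∀ ψ ψ', ∀ u ∈ chartOverlap ψ ψ', G ψ u =
      (changeMatrix ψ ψ' u).transpose * G ψ' (chartChange ψ ψ' u) * changeMatrix ψ ψ' u) :
    eulerForm s L G ∈ grassForms n m X s (n + 1) := by
  have hs1 : 1 ≤ s := by omega
  refine ⟨fun ψ v => ?_, fun ψ e he => if_neg he, fun ψ ψ' p hp => ?_⟩
  · have h : ContDiffOn ℝ ∞ (fun e => (∑ σ, eulerLagrange s (L ψ) σ e •
        oneMul (omegaL e σ) (retractVol (G ψ) e)) v) (chartTarget s ψ) := by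
      rw [chartTarget_eq_overSet hs1]
      simp only [alternatingMap_sum_apply, AlternatingMap.smul_apply, smul_eq_mul, oneMul_apply]
      refine ContDiffOn.sum fun σ _ => ContDiffOn.mul ?_ (ContDiffOn.sum fun i _ =>
        contDiffOn_const.mul (ContDiffOn.mul ?_ ?_))
      · exact contDiffOn_eulerLagrange ψ.1.open_target ((hL ψ).contDiffOn hr h𝓛) σ
      · exact contDiffOn_omegaL contDiffOn_const σ
      · exact contDiffOn_retractVol (hGs ψ) (hG ψ) fun _ => contDiffOn_const
    exact h.congr fun e he => by rw [eulerForm, if_pos he]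
  · have he := chart_mem_adaptedOverlap hs1 hp.1 hp.2
    have ht := transition_chart hs1 (ψ' := ψ') hp.1
    rw [eulerForm, eulerForm, if_pos (chart_mem_chartTarget hp.1),
      if_pos (chart_mem_chartTarget hp.2), ← ht]
    set e := chart s ψ p
    have h1 : ∀ ν, (oneMul (omegaL (transition s ψ ψ' e) ν)
        (retractVol (G ψ') (transition s ψ ψ' e))).compLinearMap
          (fderiv ℝ (transition s ψ ψ') e : Coords n m s →ₗ[ℝ] Coords n m s) =
        ∑ σ, (jacobianDet s ψ ψ' e * pMatrix s ψ ψ' ν σ e) •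
          oneMul (omegaL e σ) (retractVol (G ψ) e) := fun ν => by
      rw [oneMul_compLinearMap, omegaL_comp_fderiv_transition hs1 he,
        retractVol_comp_fderiv_transition hs1 he
          (hGc ψ ψ' _ (basePt_mem_of_adaptedOverlap he)),
        oneMul_smul_right, oneMul_sum_left, Finset.smul_sum]
      exact Finset.sum_congr rfl fun σ _ => by rw [smul_smul]
    ext v
    have h2 : ∀ ν, oneMul (omegaL (transition s ψ ψ' e) ν)
        (retractVol (G ψ') (transition s ψ ψ' e))
          (fun i => (fderiv ℝ (transition s ψ ψ') e : Coords n m s →ₗ[ℝ] Coords n m s) (v i)) =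
        ∑ σ, (jacobianDet s ψ ψ' e * pMatrix s ψ ψ' ν σ e) *
          oneMul (omegaL e σ) (retractVol (G ψ) e) v := fun ν => by
      rw [← AlternatingMap.compLinearMap_apply, h1, alternatingMap_sum_apply]
      rfl
    rw [AlternatingMap.compLinearMap_apply, alternatingMap_sum_apply, alternatingMap_sum_apply]
    simp only [AlternatingMap.smul_apply, smul_eq_mul, h2]
    rw [Finset.sum_congr rfl fun ν _ => Finset.mul_sum _ _ _, Finset.sum_comm]
    refine Finset.sum_congr rfl fun σ _ => ?_
    rw [eulerLagrange_transform hr hs h𝓛 (hL ψ) (hL ψ') he σ, Finset.mul_sum, Finset.sum_mul]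
    exact Finset.sum_congr rfl fun ν _ => by ring

lemma eulerForm_sub_mem_contactOn (hn : 1 ≤ n) (hr : 1 ≤ r) (hs0 : 0 < s)
    (h𝓛 : IsHomogeneousLagrangian 𝓛) (hL : ∀ ψ, IsLocalLagrangian 𝓛 ψ (L ψ))
    (hGs : ∀ ψ a b, ContDiffOn ℝ ∞ (fun u => G ψ u a b) ψ.1.target)
    (hG : ∀ ψ, ∀ u ∈ ψ.1.target, ∀ w, w ≠ 0 → 0 < w ⬝ᵥ (G ψ u).mulVec w) (ψ : Chart n m X)
    {L' : Coords n m r → ℝ} (hL' : IsLocalLagrangian 𝓛 ψ L') :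
    eulerForm s L G ψ - eulerLagrangeForm s hs0 L' ∈ contactOn (chartTarget s ψ) := by
  -- Contraction lowers the degree of `θ_G - θ₀` by one, so `n` is written as a successor.
  obtain ⟨k, rfl⟩ : ∃ k, n = k + 1 := ⟨n - 1, by omega⟩
  have hs1 : 1 ≤ s := hs0
  have h1 : ∀ σ, (fun e => eulerLagrange s (L ψ) σ e •
      oneMul (omegaL e σ) (retractVol (G ψ) e - theta (k + 1) m s e) :
        Form (k + 1) m s (k + 1 + 1)) ∈ contactOn (chartTarget s ψ) := fun σ => by
    rw [chartTarget_eq_overSet hs1]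
    refine oneMul_mem_contactOn hs1 (γ := fun e => retractVol (G ψ) e - theta (k + 1) m s e)
      (contDiffOn_eulerLagrange ψ.1.open_target ((hL ψ).contDiffOn hr h𝓛) σ)
      (fun w hw => ?_) (fun e he v hv => ?_) σ
    · simp only [AlternatingMap.sub_apply]
      exact (contDiffOn_retractVol (hGs ψ) (hG ψ) hw).sub (contDiffOn_theta hw)
    · have h2 : (fun i => retractL (G ψ) e (v i)) = fun i => (v i).1 := funext fun i =>
        retractL_of_omegaL_eq_zero (hG ψ _ he) (hv i)
      rw [AlternatingMap.sub_apply, sub_eq_zero]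
      exact congrArg (Matrix.detRowAlternating : (Fin (k + 1) → ℝ) [⋀^Fin (k + 1)]→ₗ[ℝ] ℝ) h2
  obtain ⟨β, hβ, h2⟩ := Submodule.sum_mem _ fun σ (_ : σ ∈ Finset.univ) => h1 σ
  refine ⟨β, hβ, fun e he => ?_⟩
  rw [← h2 he, Finset.sum_apply, Pi.sub_apply, eulerForm, if_pos he, eulerLagrangeForm_apply,
    ← Finset.sum_sub_distrib]
  refine Finset.sum_congr rfl fun σ _ => ?_
  -- Local Lagrangians are determined only on the image of the chart; this image is open, so the
  -- derivatives agree there as well.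
  have h3 : eulerLagrange s L' σ e = eulerLagrange s (L ψ) σ e := by
    refine eulerLagrange_congr ψ.1.open_target ?_ σ ?_
    · rw [← chartTarget_eq_overSet hr]
      exact hL'.eqOn (hL ψ)
    · rw [← chartTarget_eq_overSet hs1]
      exact he
  rw [h3, oneMul_sub_right, smul_sub]

end

end GrassmannBundle

open GrassmannBundle
theorem mainTheorem6 (n m r s : ℕ) (hn : 1 ≤ n) (hr : 1 ≤ r) (hs : 2 * r ≤ s)
    (X : Type*) [TopologicalSpace X] [T2Space X] [SecondCountableTopology X]
    [ChartedSpace (Fin (n + m) → ℝ) X]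
    [IsManifold (modelWithCornersSelf ℝ (Fin (n + m) → ℝ)) ((⊤ : ℕ∞) : WithTop ℕ∞) X]
    (𝓛 : ImmVel n m X r → ℝ) (h𝓛 : IsHomogeneousLagrangian 𝓛) :
    (∀ ψ : Chart n m X, ∃ L : Coords n m r → ℝ,
      ContDiffOn ℝ ((⊤ : ℕ∞) : WithTop ℕ∞) L (chartTarget r ψ) ∧ IsLocalLagrangian 𝓛 ψ L) ∧
    (∀ (ψ ψ' : Chart n m X) (L L' : Coords n m r → ℝ),
      IsLocalLagrangian 𝓛 ψ L → IsLocalLagrangian 𝓛 ψ' L' →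
      ∀ p ∈ chartDom s ψ ∩ chartDom s ψ', ∀ σ : Fin m,
        eulerLagrange s L σ (chart s ψ p) =
          jacobianDet s ψ ψ' (chart s ψ p) *
            ∑ ν : Fin m, pMatrix s ψ ψ' ν σ (chart s ψ p) *
              eulerLagrange s L' ν (chart s ψ' p)) ∧
    ∃! c : grassForms n m X s (n + 1) ⧸ contactForms n m X s,
      ∀ α : grassForms n m X s (n + 1), (contactForms n m X s).mkQ α = c →
        ∀ (ψ : Chart n m X) (L : Coords n m r → ℝ), IsLocalLagrangian 𝓛 ψ L →
          α.1 ψ - eulerLagrangeForm s (by omega) L ∈ contactOn (chartTarget s ψ) := by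
  have hs1 : 1 ≤ s := by omega
  have hL : ∀ ψ : Chart n m X, IsLocalLagrangian 𝓛 ψ (localLagrangian 𝓛 ψ) :=
    isLocalLagrangian_localLagrangian hr h𝓛
  refine ⟨fun ψ => ⟨_, contDiffOn_localLagrangian hr h𝓛 ψ, hL ψ⟩, ?_, ?_⟩
  · intro ψ ψ' L L' h h' p hp σ
    rw [← transition_chart hs1 (ψ' := ψ') hp.1]
    exact eulerLagrange_transform hr hs h𝓛 h h' (chart_mem_adaptedOverlap hs1 hp.1 hp.2) σ
  · obtain ⟨G, hGs, hG, hGc⟩ := exists_metric (n := n) (m := m) (X := X)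
    let β : grassForms n m X s (n + 1) :=
      ⟨eulerForm s (localLagrangian 𝓛) G, eulerForm_mem_grassForms hr hs h𝓛 hL hGs hG hGc⟩
    have key : ∀ ψ L, IsLocalLagrangian 𝓛 ψ L →
        β.1 ψ - eulerLagrangeForm s (by omega) L ∈ contactOn (chartTarget s ψ) := fun ψ L h =>
      eulerForm_sub_mem_contactOn hn hr _ h𝓛 hL hGs hG ψ h
    refine ⟨(contactForms n m X s).mkQ β, fun α hα ψ L h => ?_, fun c hc => ?_⟩
    · have h1 : α - β ∈ contactForms n m X s := (Submodule.Quotient.eq _).mp hα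
      have h2 := Submodule.add_mem _ (h1 ψ) (key ψ L h)
      refine (congrArg (· ∈ contactOn (chartTarget s ψ)) ?_).mp h2
      exact sub_add_sub_cancel (α.1 ψ) (β.1 ψ) _
    · obtain ⟨α, rfl⟩ := Submodule.mkQ_surjective _ c
      refine (Submodule.Quotient.eq _).mpr fun ψ => ?_
      -- Both forms are compared with the same local Euler–Lagrange form, which cancels from the
      -- difference.
      have h2 := Submodule.sub_mem _ (hc α rfl ψ _ (hL ψ)) (key ψ _ (hL ψ))
      rwa [sub_sub_sub_cancel_right] at h2
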